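/- **Setting.** Let $D\ge 3$, let $I_1,\dots,I_D\subset\mathbb Z$ be finite (the momentum lattice is $L=I_1\times\dots\times I_D$) and let $E:L\to(0,\infty)$ be such that for every colour $a$ the difference $E(t_a,s_a):=E_{p_1\dots t_a\dots p_D}-E_{p_1\dots s_a\dots p_D}$ does not depend on the momenta $p_i$, $i\ne a$. The quartic melonic rank-$D$ complex tensor model has the interaction $V=\lambda\sum_{a=1}^D\mathrm{Tr}_{\mathcal V_a}$, $\mathrm{Tr}_{\mathcal V_a}(\phi,\bar\phi)=\sum_{\mathbf b,\mathbf c\in L}\bar\phi_{\mathbf b}\bar\phi_{\mathbf c}\,\phi_{\mathbf b_{\hat a}c_a}\phi_{\mathbf c_{\hat a}b_a}$, where $\mathbf b_{\hat a}c_a$ is $\mathbf b$ with $b_a$ replaced by $c_a$, and the partition function $$Z[J,\bar J]=\exp\big(-V(\delta/\delta \bar J,\delta/\delta J)\big)\exp\Big(\sum_{\mathbf q\in L}\bar J_{\mathbf q}E_{\mathbf q}^{-1}J_{\mathbf q}\Big)\qquad(\phi\to\delta/\delta\bar J,\ \bar\phi\to\delta/\delta J),$$ a formal power series in $J,\bar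 J$ and in the coupling $\lambda$. Put $Z_0=Z[0,0]$ and $W=\log (Z/Z_0)$. A $D$-coloured graph $\mathcal B$ with $2k$ vertices has $k$ white vertices $v^1,\dots,v^k$ and $k$ black vertices $w^1,\dots,w^k$, each edge joining a white to a black vertex and each vertex having exactly one edge of each colour $1,\dots,D$. For $\mathbf X=(\mathbf x^1,\dots,\mathbf x^k)\in L^k$ let $\mathcal B_*(\mathbf X)=(\mathbf y^1,\dots,\mathbf y^k)$ with $y^\alpha_a=x^\nu_a$ if an $a$-coloured edge joins $v^\nu$ to $w^\alpha$, let $\mathbb J(\mathcal B)(\mathbf X)=\prod_{\alpha}J_{\mathbf x^\alpha}\bar J_{\mathbf y^\alpha}$ and $\partial F/\partial\mathcal B(\mathbf X)=\prod_\alpha\frac{\delta}{\delta J_{\mathbf x^\alpha}}\frac{\delta}{\delta\bar J_{\mathbf y^\alpha}}F|_{J=\bar J=0}$. Let $\mathcal F_{D,k}\subset L^k$ be the set of $\mathbf X$ with $x^\alpha_a\neq x^\nu_a$ for all $a$ and all $\alpha\ne\nu$. For every $D$-coloured graph $\mathcal C$ with labelled vertices and every $\mathbf X\in L^k$, generic or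 not, let $G^{(2k)}_{\mathcal C}(\mathbf X)$ be the sum of the amplitudes of the connected Feynman graphs with boundary graph $\mathcal C$ and external momenta $\mathbf X$ (external legs labelled; weight $(-\lambda)^n/n!$ for the Wick contractions of $n$ labelled vertices; a factor $1/E$ for each propagator; closed faces summed over the lattice). Let $\mathcal Z_{\mathcal C}(\mathbf X)$ be $Z_0^{-1}$ times the corresponding sum over all Feynman graphs, connected or not, with boundary graph $\mathcal C$. Both are formal power series in $\lambda$. For a white vertex $r$ of $\mathcal B$ let $e_a^r$ be its $a$-coloured edge and $t$ the black end of $e_a^r$. The graph $\mathcal B\ominus e_a^r$ arises by deleting $r$, $t$ and all edges between them and gluing the remaining broken edges colourwise. The function $(\Delta^{\mathcal B}_{s_a,r}G_{\mathcal B})(\mathbf Y)$ arises from $G_{\mathcal B}$ by inserting at $r$ the momentum $\mathbf z$ with $z_a=s_a$, with $z_i$ summed over $I_i$ for the other colours $i$ of edges between $r$ and $t$, and with $z_i=y_i^{v}$ for the remaining colours $i$, where $v$ is the white vertex whose $i$-coloured edge ends at $t$. The functions $\mathfrak f^{(a)}_{\mathcal C,s_a}$ are the coefficients in $$Y^{(a)}_{s_a}[J,\bar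 J]=\sum_{\mathcal B}\frac{1}{|\mathrm{Aut}_c(\mathcal B)|}\sum_{r}\sum_{\mathbf Y}(\Delta^{\mathcal B}_{s_a,r}G_{\mathcal B})(\mathbf Y)\,\mathbb J(\mathcal B\ominus e_a^r)(\mathbf Y)=\sum_{\mathcal C}\sum_{\mathbf Y}\mathfrak f^{(a)}_{\mathcal C,s_a}(\mathbf Y)\,\mathbb J(\mathcal C)(\mathbf Y)$$ (sums over isomorphism classes of $D$-coloured graphs; for each $(\mathcal B,r)$ with $\mathcal B\ominus e^r_a\cong\mathcal C$ the arguments are transported along isomorphisms, averaging over them). For a coloured automorphism $\sigma$ put $(\sigma^*f)(\mathbf x^1,\dots,\mathbf x^k)=f(\mathbf x^{\sigma^{-1}(1)},\dots,\mathbf x^{\sigma^{-1}(k)})$, and let $\varsigma_a(\mathcal B;\alpha,\rho)$ be $\mathcal B$ with the $a$-coloured edges at the black vertices $w^\alpha,w^\rho$ swapped. **Theorem (Schwinger–Dyson equations).** Let $\mathcal B$ be a connected $D$-coloured graph with $2k$ vertices and let $1\le\alpha\le k$. (i) For all $\mathbf X,\mathbf Y\in L^k$, $$\prod_{\nu}\frac{\delta}{\delta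 J_{\mathbf x^\nu}}\frac{\delta}{\delta\bar J_{\mathbf y^\nu}}W\Big|_{0}=\sum_{\mathcal C:\ \mathcal C_*(\mathbf X)=\mathbf Y}G^{(2k)}_{\mathcal C}(\mathbf X),\qquad Z_0^{-1}\prod_{\nu}\frac{\delta}{\delta J_{\mathbf x^\nu}}\frac{\delta}{\delta\bar J_{\mathbf y^\nu}}Z\Big|_{0}=\sum_{\mathcal C:\ \mathcal C_*(\mathbf X)=\mathbf Y}\mathcal Z_{\mathcal C}(\mathbf X),$$ the sums being over the $D$-coloured graphs $\mathcal C$ on $k$ labelled white and $k$ labelled black vertices. In particular, for $\mathbf X\in\mathcal F_{D,k}$ and every such $\mathcal C$, $G^{(2k)}_{\mathcal C}(\mathbf X)=\partial W/\partial\mathcal C(\mathbf X)$ and $\mathcal Z_{\mathcal C}(\mathbf X)=Z_0^{-1}\,\partial Z/\partial\mathcal C(\mathbf X)$. (ii) For all $\mathbf X\in\mathcal F_{D,k}$, with $\mathcal B_*(\mathbf X)=(\mathbf y^1,\dots,\mathbf y^k)$ and $\mathbf s=\mathbf y^\alpha$, $$\Big(1+\frac{2\lambda}{E_{\mathbf s}}\sum_{a=1}^D\sum_{\mathbf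 q_{\hat a}}G^{(2)}(s_a,\mathbf q_{\hat a})\Big)G^{(2k)}_{\mathcal B}(\mathbf X)=\frac{\delta_{1,k}}{E_{\mathbf s}}-\frac{2\lambda}{E_{\mathbf s}}\sum_{a=1}^D\Big\{\sum_{\sigma\in\mathrm{Aut}_c(\mathcal B)}\sigma^*\mathfrak f^{(a)}_{\mathcal B,s_a}(\mathbf X)$$ $$+\sum_{\rho\neq\alpha}\frac{1}{E(y^\rho_a,s_a)}\big[\mathcal Z_{\varsigma_a(\mathcal B;\alpha,\rho)}(\mathbf X)-\mathcal Z_{\varsigma_a(\mathcal B;\alpha,\rho)}(\mathbf X|_{s_a\to y_a^\rho})\big]-\sum_{b_a\in I_a}\frac{1}{E(s_a,b_a)}\big[G^{(2k)}_{\mathcal B}(\mathbf X)-G^{(2k)}_{\mathcal B}(\mathbf X|_{s_a\to b_a})\big]\Big\}.$$ Here $G^{(2)}$ is the two-point function (of the graph with two vertices and $D$ edges), $\mathbf X|_{s_a\to b}$ is $\mathbf X$ with the coordinate $x^\gamma_a=s_a$ replaced by $b$, where $v^\gamma$ is the white vertex joined to $w^\alpha$ by an $a$-coloured edge of $\mathcal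 B$. A quotient whose denominator vanishes (in particular the one for $b_a=s_a$) denotes its limit: if $t$ is added to the energies of all propagators on the external face of colour $a$ that starts at $v^\gamma$, then $\frac{1}{E(s_a,b_a)}[G_{\mathcal B}^{(2k)}(\mathbf X)-G_{\mathcal B}^{(2k)}(\mathbf X|_{s_a\to b_a})]$ is read as $\frac{d}{dt}G_{\mathcal B}^{(2k)}\big|_{t=0}$, and $\frac{1}{E(y_a^\rho,s_a)}[\dots]$ as $-\frac{d}{dt}\mathcal Z_{\varsigma_a(\mathcal B;\alpha,\rho)}\big|_{t=0}$, coefficientwise in $\lambda$. -/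

import Mathlib

open scoped PowerSeries

/-! ### Coloured graphs -/

/-- A vertex-bipartite, regularly edge-`D`-coloured graph with white vertices `W` and black
vertices `K`: at every vertex there is exactly one edge of each colour, so the edges of colour `a`
are recorded by the bijection sending a white vertex to the black end of its `a`-coloured edge. -/
@[ext] structure ColouredGraph (D : ℕ) (W K : Type) where
  edge : Fin D → (W ≃ K)

namespace ColouredGraph

variable {D : ℕ} {W K W' K' : Type}

/-- The underlying graph on all (white and black) vertices. -/
def toSimpleGraph (B : ColouredGraph D W K) : SimpleGraph (W ⊕ K) :=
  SimpleGraph.fromRel fun x y => ∃ a v, x = Sum.inl v ∧ y = Sum.inr (B.edge a v)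

def Connected (B : ColouredGraph D W K) : Prop := B.toSimpleGraph.Connected

/-- The graph with one white vertex, one black vertex and `D` edges. -/
def melon (D : ℕ) : ColouredGraph D (Fin 1) (Fin 1) := ⟨fun _ => Equiv.refl _⟩

/-- `ς_a(B; w, w')`: swap the `a`-coloured edges at the black vertices `w` and `w'`. -/
def swapEdges [DecidableEq K] (B : ColouredGraph D W K) (a : Fin D) (w w' : K) :
    ColouredGraph D W K :=
  ⟨fun c => if c = a then (B.edge c).trans (Equiv.swap w w') else B.edge c⟩

/-- `B ⊖ e_a^r`: remove the `a`-coloured edge at the white vertex `r`, its two end-vertices `r` and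
`t = B.edge a r` and all edges joining these two; then, for each other colour `c`, glue the broken
edge of `r` to the broken edge of `t`: the white vertex whose `c`-edge ended at `t`
becomes joined to the black vertex `B.edge c r`. -/
def contract [DecidableEq K] (B : ColouredGraph D W K) (a : Fin D) (r : W) :
    ColouredGraph D {v : W // v ≠ r} {w : K // w ≠ B.edge a r} :=
  ⟨fun c =>
    ((B.edge c).trans (Equiv.swap (B.edge c r) (B.edge a r))).subtypeEquiv (by
      intro v
      have h : ((B.edge c).trans (Equiv.swap (B.edge c r) (B.edge a r))) r = B.edge a r := by
        simp
      rw [Ne, Ne, ← Equiv.apply_eq_iff_eq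
        ((B.edge c).trans (Equiv.swap (B.edge c r) (B.edge a r))), h])⟩

/-- Coloured isomorphisms: bijections of white and of black vertices preserving the edges and
their colours. -/
def IsIso (B : ColouredGraph D W K) (B' : ColouredGraph D W' K')
    (θ : (W ≃ W') × (K ≃ K')) : Prop :=
  ∀ a v, B'.edge a (θ.1 v) = θ.2 (B.edge a v)

open Classical in
/-- The finite set of coloured isomorphisms from `B` to `B'`. -/
noncomputable def isos [Fintype W] [Fintype K] [Fintype W'] [Fintype K']
    (B : ColouredGraph D W K) (B' : ColouredGraph D W' K') :
    Finset ((W ≃ W') × (K ≃ K')) :=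
  Finset.univ.filter (IsIso B B')

/-- The set of coloured automorphisms `Aut_c(B)`. -/
noncomputable def aut [Fintype W] [Fintype K] (B : ColouredGraph D W K) :
    Finset ((W ≃ W) × (K ≃ K)) := isos B B

/-- Isomorphism of `D`-coloured graphs with `2n` vertices. -/
def isoSetoid (D n : ℕ) : Setoid (ColouredGraph D (Fin n) (Fin n)) where
  r B B' := ∃ θ, IsIso B B' θ
  iseqv :=
    { refl := fun B => ⟨(Equiv.refl _, Equiv.refl _), fun _ _ => rfl⟩
      symm := by
        rintro B B' ⟨θ, h⟩
        refine ⟨(θ.1.symm, θ.2.symm), fun a v => ?_⟩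
        have := h a (θ.1.symm v)
        simp only [Equiv.apply_symm_apply] at this
        simp [this]
      trans := by
        rintro B B' B'' ⟨θ, h⟩ ⟨η, g⟩
        exact ⟨(θ.1.trans η.1, θ.2.trans η.2), fun a v => by simp [h a v, g a (θ.1 v)]⟩ }

open Classical in
noncomputable instance [Fintype W] [Fintype K] : Fintype (ColouredGraph D W K) :=
  Fintype.ofInjective (fun B => B.edge) (fun _ _ h => ColouredGraph.ext h)

open Classical in
noncomputable instance (n : ℕ) : Fintype (Quotient (isoSetoid D n)) :=
  Fintype.ofSurjective (Quotient.mk (isoSetoid D n)) Quotient.mk_surjective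

end ColouredGraph

/-! ### Momenta -/

/-- The regularised momentum lattice `I_1 × ⋯ × I_D`, each `I_a` being a finite set of integers. -/
abbrev Momentum {D : ℕ} (I : Fin D → Finset ℤ) : Type := (a : Fin D) → I a

/-- Membership in `F_{D,k}`: on each row `a` all entries are different. -/
def IsGeneric {D : ℕ} {I : Fin D → Finset ℤ} {W : Type} (X : W → Momentum I) : Prop :=
  ∀ a v w, v ≠ w → X v a ≠ X w a

/-- The map `B_*`: the black vertex `w` gets the momentum `y^w` with `y^w_a = x^v_a` whenever an
`a`-coloured edge joins the white vertex `v` to `w`. -/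
def ColouredGraph.target {D : ℕ} {W K : Type} {I : Fin D → Finset ℤ} (B : ColouredGraph D W K)
    (X : W → Momentum I) : K → Momentum I :=
  fun w a => X ((B.edge a).symm w) a

/-- `X|_{x^γ_a → b}`: replace the coordinate `x^γ_a` by `b`. -/
def replaceCoord {D : ℕ} {W : Type} [DecidableEq W] {I : Fin D → Finset ℤ} (X : W → Momentum I)
    (γ : W) (a : Fin D) (b : I a) : W → Momentum I :=
  Function.update X γ (Function.update (X γ) a b)

/-! ### The generating functionals

Formal power series in the sources, with coefficients that are formal power series in the coupling
constant `λ = PowerSeries.X`. The variable `Sum.inl x` is `J_x`, the variable `Sum.inr x` is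
`J̄_x`. -/

section Functionals

variable {D : ℕ} {I : Fin D → Finset ℤ}

/-- `exp (∑_q J̄_q E_q⁻¹ J_q)`. -/
noncomputable def freePartition (E : Momentum I → ℝ) :
    MvPowerSeries (Momentum I ⊕ Momentum I) ℝ :=
  (PowerSeries.exp ℝ).subst
    (∑ q : Momentum I, MvPowerSeries.C (E q)⁻¹ *
      (MvPowerSeries.X (Sum.inr q) * MvPowerSeries.X (Sum.inl q)) :
      MvPowerSeries (Momentum I ⊕ Momentum I) ℝ)

/-- The operator `∑_c Tr_{V_c}(φ, φ̄)` with `φ → δ/δJ̄` and `φ̄ → δ/δJ`, where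
`Tr_{V_c}(φ, φ̄) = ∑_{b,b'} φ̄_b φ̄_{b'} φ_{b with b'_c} φ_{b' with b_c}` is the quartic melonic
invariant of colour `c`. -/
noncomputable def interactionOp (F : MvPowerSeries (Momentum I ⊕ Momentum I) ℝ) :
    MvPowerSeries (Momentum I ⊕ Momentum I) ℝ :=
  ∑ c : Fin D, ∑ b : Momentum I, ∑ b' : Momentum I,
    MvPowerSeries.pderiv ℝ (Sum.inl b) (MvPowerSeries.pderiv ℝ (Sum.inl b')
      (MvPowerSeries.pderiv ℝ (Sum.inr (Function.update b c (b' c)))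
        (MvPowerSeries.pderiv ℝ (Sum.inr (Function.update b' c (b c))) F)))

/-- `Z[J, J̄] = exp (-λ ∑_c Tr_{V_c}(δ/δJ̄, δ/δJ)) exp (∑_q J̄_q E_q⁻¹ J_q)`. -/
noncomputable def partitionFunction (E : Momentum I → ℝ) :
    MvPowerSeries (Momentum I ⊕ Momentum I) ℝ⟦X⟧ :=
  fun d => PowerSeries.mk fun n =>
    ((-1 : ℝ) ^ n / n.factorial) * MvPowerSeries.coeff d (interactionOp^[n] (freePartition E))

/-- `Z_0 = Z[0, 0]`. -/
noncomputable def vacuum (E : Momentum I → ℝ) : ℝ⟦X⟧ :=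
  MvPowerSeries.constantCoeff (partitionFunction E)

/-- The free energy `W[J, J̄] = log Z[J, J̄]`, normalised by `W[0, 0] = 0`. -/
noncomputable def freeEnergy (E : Momentum I → ℝ) :
    MvPowerSeries (Momentum I ⊕ Momentum I) ℝ⟦X⟧ :=
  (PowerSeries.log ℝ).subst
    (MvPowerSeries.C (vacuum E)⁻¹ * partitionFunction E - 1 :
      MvPowerSeries (Momentum I ⊕ Momentum I) ℝ⟦X⟧)

/-- The derivative `∏_v δ/δJ_{x^v} ∏_w δ/δJ̄_{y^w}` of a functional, at `J = J̄ = 0`: the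
coefficient of the monomial `m = ∏_v J_{x^v} ∏_w J̄_{y^w}` times the factorials of its exponents. -/
noncomputable def sourceDeriv {W K : Type} [Fintype W] [Fintype K]
    (F : MvPowerSeries (Momentum I ⊕ Momentum I) ℝ⟦X⟧)
    (X : W → Momentum I) (Y : K → Momentum I) : ℝ⟦X⟧ :=
  let m : (Momentum I ⊕ Momentum I) →₀ ℕ :=
    ∑ v, Finsupp.single (Sum.inl (X v)) 1 + ∑ w, Finsupp.single (Sum.inr (Y w)) 1
  (m.prod fun _ j => (j.factorial : ℝ⟦X⟧)) * MvPowerSeries.coeff m F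

/-- The graph derivative `∂F/∂B(X)`. -/
noncomputable def graphDeriv {W K : Type} [Fintype W] [Fintype K]
    (F : MvPowerSeries (Momentum I ⊕ Momentum I) ℝ⟦X⟧)
    (B : ColouredGraph D W K) (X : W → Momentum I) : ℝ⟦X⟧ :=
  sourceDeriv F X (B.target X)

end Functionals

/-! ### Feynman graphs

An open Feynman graph of order `n` with labelled `J`-legs `W` and labelled `J̄`-legs `K` is given by
the colours `c i` of the interaction vertices `i : Fin n` and by the propagators (the edges of
colour `0`). The vertex `i` has two fields `φ̄` and two fields `φ`, both labelled by
`(i, false)`, `(i, true)`. Each propagator joins a `J`-leg or a field `φ̄` (an element of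
`W ⊕ Fin n × Bool`) to a `J̄`-leg or a field `φ` (an element of `K ⊕ Fin n × Bool`): taking the
derivative with respect to `J` inserts a `φ̄`, that with respect to `J̄` inserts a `φ`. -/

/-- A Feynman graph of order `n` of the quartic melonic model. -/
structure FeynmanGraph (D : ℕ) (W K : Type) (n : ℕ) where
  colour : Fin n → Fin D
  propagator : (W ⊕ Fin n × Bool) ≃ (K ⊕ Fin n × Bool)

namespace FeynmanGraph

variable {D : ℕ} {W K : Type} {n : ℕ} {I : Fin D → Finset ℤ}

open Classical in
noncomputable instance [Fintype W] [Fintype K] : Fintype (FeynmanGraph D W K n) :=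
  Fintype.ofInjective (fun Γ => (Γ.colour, Γ.propagator)) (by
    rintro ⟨c, p⟩ ⟨c', p'⟩ h
    simpa using h)

/-- In a melonic vertex of colour `c i`, the `a`-coloured edge at the field `φ` labelled `(i, ε)`
ends at the field `φ̄` with the same label if `a ≠ c i`, and at the other one if `a = c i`. -/
def vertexEdge (Γ : FeynmanGraph D W K n) (a : Fin D) (h : Fin n × Bool) : Fin n × Bool :=
  (h.1, if a = Γ.colour h.1 then !h.2 else h.2)

/-- The graph formed by the edges of colours `0` and `a`. -/
def faceGraph (Γ : FeynmanGraph D W K n) (a : Fin D) :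
    SimpleGraph ((W ⊕ Fin n × Bool) ⊕ (K ⊕ Fin n × Bool)) :=
  SimpleGraph.fromRel fun x y =>
    (∃ u, x = Sum.inl u ∧ y = Sum.inr (Γ.propagator u)) ∨
    (∃ h, x = Sum.inr (Sum.inr h) ∧ y = Sum.inl (Sum.inr (Γ.vertexEdge a h)))

/-- The Feynman graph is connected, as a graph with all edges of colours `0, 1, …, D`. -/
def Connected (Γ : FeynmanGraph D W K n) : Prop :=
  (SimpleGraph.fromRel fun x y =>
    (∃ u, x = Sum.inl u ∧ y = Sum.inr (Γ.propagator u)) ∨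
    (∃ a h, x = Sum.inr (Sum.inr h) ∧ y = Sum.inl (Sum.inr (Γ.vertexEdge a h)))).Connected

/-- `∂Γ = B`: the external legs joined by an `a`-coloured edge of `B` are
the ends of a `(0a)`-bicoloured path in `Γ`. -/
def HasBoundary (Γ : FeynmanGraph D W K n) (B : ColouredGraph D W K) : Prop :=
  ∀ a v, (Γ.faceGraph a).Reachable (Sum.inl (Sum.inl v)) (Sum.inr (Sum.inl (B.edge a v)))

/-- The propagator starting at `u` belongs to the external face of colour `a` that starts at the
`J`-leg `v`. -/
def OnExternalFace (Γ : FeynmanGraph D W K n) (v : W) (a : Fin D) (u : W ⊕ Fin n × Bool) : Prop :=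
  (Γ.faceGraph a).Reachable (Sum.inl (Sum.inl v)) (Sum.inl u)

/-- The assignments of a momentum to each propagator (labelled by its starting point) that agree
with the external momenta and are conserved along every coloured edge of every vertex. They are
constant along each face, so closed faces carry free momentum coordinates. -/
def IsConserving (Γ : FeynmanGraph D W K n) (X : W → Momentum I)
    (p : W ⊕ Fin n × Bool → Momentum I) : Prop :=
  (∀ v, p (Sum.inl v) = X v) ∧
  ∀ h a, p (Γ.propagator.symm (Sum.inr h)) a = p (Sum.inr (Γ.vertexEdge a h)) a

open Classical in
/-- The amplitude `∑_p ∏ 1/E_p`, where the energies of all propagators on the external face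
`(v, a)` are shifted by `δ v a`. The amplitude proper is the case `δ = 0`. Because of the form of
`E`, a shift by `E(b_a, x^v_a)` has the effect of replacing `x^v_a` by `b_a`. -/
noncomputable def amplitude [Fintype W] [DecidableEq W] (Γ : FeynmanGraph D W K n)
    (E : Momentum I → ℝ) (X : W → Momentum I) (δ : W → Fin D → ℝ) : ℝ :=
  ∑ p ∈ (Finset.univ : Finset (W ⊕ Fin n × Bool → Momentum I)).filter (Γ.IsConserving X),
    ∏ u, (E (p u) + ∑ v, ∑ a, if Γ.OnExternalFace v a u then δ v a else 0)⁻¹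

end FeynmanGraph

/-! ### Correlation functions -/

section Correlations

variable {D : ℕ} {I : Fin D → Finset ℤ}

open Classical in
/-- The sum over all connected Feynman graphs with boundary `B`, with the weight `(-λ)^n / n!` at
order `n`, where the energies of the external faces are shifted by `δ`. -/
noncomputable def corrShift {W K : Type} [Fintype W] [Fintype K] [DecidableEq W]
    (E : Momentum I → ℝ) (B : ColouredGraph D W K) (X : W → Momentum I)
    (δ : W → Fin D → ℝ) : ℝ⟦X⟧ :=
  PowerSeries.mk fun n => ((-1 : ℝ) ^ n / n.factorial) *
    ∑ Γ ∈ (Finset.univ : Finset (FeynmanGraph D W K n)).filter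
      (fun Γ => Γ.Connected ∧ Γ.HasBoundary B), Γ.amplitude E X δ

/-- The connected correlation function `G_B^{(2k)}(X)`: the sum over all connected Feynman graphs
with boundary `B`. It is defined at all momenta `X`; on generic ones it is `∂W/∂B(X)`. -/
noncomputable def corr {W K : Type} [Fintype W] [Fintype K] [DecidableEq W]
    (E : Momentum I → ℝ) (B : ColouredGraph D W K) (X : W → Momentum I) : ℝ⟦X⟧ :=
  corrShift E B X 0

open Classical in
/-- `Z_0⁻¹` times the sum over all Feynman graphs, connected or not, with boundary `B`, where the
energies of the external faces are shifted by `δ`. -/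
noncomputable def partitionCorrShift {W K : Type} [Fintype W] [Fintype K] [DecidableEq W]
    (E : Momentum I → ℝ) (B : ColouredGraph D W K) (X : W → Momentum I)
    (δ : W → Fin D → ℝ) : ℝ⟦X⟧ :=
  (vacuum E)⁻¹ * PowerSeries.mk fun n => ((-1 : ℝ) ^ n / n.factorial) *
    ∑ Γ ∈ (Finset.univ : Finset (FeynmanGraph D W K n)).filter
      (fun Γ => Γ.HasBoundary B), Γ.amplitude E X δ

/-- `Z_0⁻¹ ∂Z/∂B(X)`, the part of the normalised partition function belonging to the boundary graph
`B`. It is defined at all momenta `X`. -/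
noncomputable def partitionCorr {W K : Type} [Fintype W] [Fintype K] [DecidableEq W]
    (E : Momentum I → ℝ) (B : ColouredGraph D W K) (X : W → Momentum I) : ℝ⟦X⟧ :=
  partitionCorrShift E B X 0

open Classical in
/-- `(Δ_{s_a,r}^B G_B)(Y)`, where `Y` is indexed by the white vertices of `B ⊖ e_a^r`: insert at
the white vertex `r` the momentum `z` with `z_a = s_a`; with `z_i = y^v_i` if the `i`-coloured edge
at the black vertex `B.edge a r` comes from a white vertex `v ≠ r`; and with
`z_i` summed over for the remaining colours `i`, those of the other edges joining `r` to
`B.edge a r`. -/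
noncomputable def edgeRemoval {W K : Type} [Fintype W] [Fintype K] [DecidableEq W]
    (E : Momentum I → ℝ) (B : ColouredGraph D W K) (a : Fin D) (s : I a) (r : W)
    (Y : {v : W // v ≠ r} → Momentum I) : ℝ⟦X⟧ :=
  ∑ z ∈ (Finset.univ : Finset (Momentum I)).filter (fun z =>
      z a = s ∧ ∀ i, ∀ v : {v : W // v ≠ r}, B.edge i v = B.edge a r → z i = Y v i),
    corr E B (fun v => if h : v = r then z else Y ⟨v, h⟩)

/-- The coefficient function `f^{(a)}_{C,s_a}` of `𝕁(C)` in the Ward-identity term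
`Y^{(a)}_{s_a} = ∑_B |Aut_c(B)|⁻¹ ∑_r (Δ_{s_a,r}^B G_B) ⋆ 𝕁(B ⊖ e_a^r)`, the sum over `B` being over
isomorphism classes of `D`-coloured graphs. For each `(B, r)` with `B ⊖ e_a^r ≅ C` the
arguments are matched to the white vertices of `C` by an isomorphism; we average over the
isomorphisms, on which the pairing with `𝕁(C)` does not depend. -/
noncomputable def wardCoeff (E : Momentum I → ℝ) {k : ℕ} (C : ColouredGraph D (Fin k) (Fin k))
    (a : Fin D) (s : I a) (X : Fin k → Momentum I) : ℝ⟦X⟧ :=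
  ∑ q : Quotient (ColouredGraph.isoSetoid D (k + 1)),
    ((q.out.aut.card : ℝ)⁻¹) • ∑ r : Fin (k + 1),
      ((C.aut.card : ℝ)⁻¹) • ∑ θ ∈ C.isos (q.out.contract a r),
        edgeRemoval E q.out a s r (fun v => X (θ.1.symm v))

/-- The difference quotient `[Φ(X) - Φ(X|_{x^γ_a → b})] / E(x^γ_a, b)`, where `Φ X δ` is a
correlation function with shifted energies of external faces and `Ediff a t s` is `E(t_a, s_a)`.
If `E(x^γ_a, b) = 0`, in particular if `b = x^γ_a`, it denotes its limit: the derivative (of each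
coefficient) with respect to the energy carried by the external face with momentum
coordinate `x^γ_a`. -/
noncomputable def diffQuot {W : Type} [DecidableEq W] (Ediff : (a : Fin D) → I a → I a → ℝ)
    (Φ : (W → Momentum I) → (W → Fin D → ℝ) → ℝ⟦X⟧)
    (X : W → Momentum I) (γ : W) (a : Fin D) (b : I a) : ℝ⟦X⟧ :=
  if Ediff a (X γ a) b = 0 then
    PowerSeries.mk fun n =>
      deriv (fun t : ℝ => PowerSeries.coeff n (Φ X (Pi.single γ (Pi.single a t)))) 0
  else (Ediff a (X γ a) b)⁻¹ • (Φ X 0 - Φ (replaceCoord X γ a b) 0)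

end Correlations

/-!
# The Schwinger–Dyson equations of the quartic melonic tensor model

Everything is reduced to identities between finite sums over Feynman diagrams. A `Diagram` is a
Feynman graph whose interaction vertices are labelled by an arbitrary type `V`; faces and
connectedness are encoded by invariance of predicates: two propagators lie on the same face if no
property that is constant along the faces of that colour separates them, and a diagram is connected
if its legs and vertices cannot be split into two parts (`IsSplit`) joined by no propagator. This
makes relabelling, disjoint unions and surgery on diagrams formal, and the faces are recovered as
explicit paths by `Diagram.exists_isFacePath`. The exponential series `expSeries`, with weight
`(-λ)^n / n!` at order `n`, turns distributions of the vertices over two parts of a diagram into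
products (`expSeries_mul`).

*Boundary graph expansions.* Wick's theorem (`multiDeriv_freePartition`) follows by induction from
`∂F/∂J_x = E_x⁻¹ J̄_x F` for the free partition function `F`, and gives the Feynman expansion
`sourceDeriv_partitionFunction`. As `∂Z = Z ∂ log Z`, the derivatives of the free energy satisfy the
same recursion as the sums over connected diagrams, namely the one that singles out the component of
one leg; this is the linked cluster theorem `sourceDeriv_freeEnergy`. Since momenta are transported
along external faces, a diagram with boundary graph `C` contributes only if the momenta of the
`J̄`-legs are `C_*(X)`. On generic momenta this determines `C`.

*Schwinger–Dyson equations.* Vacuum components cancel against `Z_0` (`partitionCorrShift_eq_noVac`),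
so `Z_C` is the sum over the diagrams without vacuum component (`NoVac`), and so is `G_C` if `C` is
connected. In a connected diagram the propagator at the leg `α` is either the whole diagram, which
gives the term `δ_{1,k} / E_s`, or it starts at a vertex. Removing this vertex leaves a diagram with
one more `J`-leg and one more `J̄`-leg, both called `none`, and cancels the order `n` against `n!`;
the factor `2` is the symmetry of the vertex (`corr_eq_insertion`). If the vertex has colour `a`,
the smaller diagram is classified by the end of the `a`-coloured face that starts at the new leg.

* It ends at the other new leg (`sum_edge_eq_none`). The new legs then form a separate component,
  which gives the two-point function times `G_B`, or the smaller diagram is connected. In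
  the latter case the boundary graph `C` gives `B` by removal of the vertices `none`. Graphs `C` on
  labelled vertices are counted against isomorphism classes by the orbit–stabiliser relation
  `ColouredGraph.sum_inv_card_aut_mul_card_isos`, and their sum is `∑_σ σ^* 𝔣` (`sum_wardCoeff`).
* It ends at a leg `ρ` (`sum_edge_ne_none`). Identifying the two new legs turns the smaller diagram
  into a diagram with boundary graph `ς_a(B; α, ρ)` (which is `B` for `ρ = α`) and a marked
  propagator on the face at `(γ, a)`, at which the coordinate `a` jumps to another value `b`:
  `b` is free for `ρ = α` and equal to `y^ρ_a` otherwise. The energies behind the jump are shifted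
  by a constant, because `E(t_a, s_a)` does not depend on the other momenta. The sum over the marked
  propagator therefore telescopes to a difference quotient or, for a vanishing shift, to a
  derivative (`Diagram.sum_cutSum`). This is the Ward identity.

The equations hold without genericity, since they are equations between sums over diagrams.
-/

/-! ### Formal derivatives of functionals -/

section Series

open MvPowerSeries

/-- A coefficient of `f ∘ a` only involves the powers `a ^ d` with `d` up to its degree. -/
theorem coeff_subst_eq_sum_range {τ R S : Type*} [CommRing R] [CommRing S] [Algebra R S]
    {a : MvPowerSeries τ S} (ha : constantCoeff a = 0) (f : R⟦X⟧) (e : τ →₀ ℕ) {N : ℕ}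
    (hN : e.degree < N) :
    coeff e (f.subst a) = ∑ d ∈ Finset.range N, PowerSeries.coeff d f • coeff e (a ^ d) := by
  rw [PowerSeries.coeff_subst (PowerSeries.HasSubst.of_constantCoeff_zero ha)]
  refine finsum_eq_sum_of_support_subset _ ?_
  intro d hd
  by_contra hdN
  apply hd
  have hle : N ≤ d := by simpa using hdN
  have : coeff e (a ^ d) = 0 := by
    apply coeff_of_lt_order
    have h1 : (1 : ℕ∞) ≤ a.order := by
      rw [Order.one_le_iff_ne_zero]
      exact (MvPowerSeries.order_ne_zero_iff_constCoeff_eq_zero).2 ha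
    calc (e.degree : ℕ∞) < N := by exact_mod_cast hN
      _ ≤ d := by exact_mod_cast hle
      _ = d • (1 : ℕ∞) := by simp
      _ ≤ d • a.order := by gcongr
      _ ≤ _ := MvPowerSeries.le_order_pow _
  simp [this]

/-- The chain rule for formal partial derivatives. -/
theorem pderiv_subst {τ R S : Type*} [CommRing R] [CommRing S] [Algebra R S]
    {a : MvPowerSeries τ S} (ha : constantCoeff a = 0) (f : R⟦X⟧) (i : τ) :
    pderiv S i (f.subst a) = (PowerSeries.derivative R f).subst a * pderiv S i a := by
  classical
  ext e
  set N := e.degree + 2 with hN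
  have h1 : (e + Finsupp.single i 1).degree < N := by simp [hN]
  rw [coeff_pderiv, coeff_subst_eq_sum_range ha f _ h1, coeff_mul]
  have h2 : ∀ x ∈ Finset.HasAntidiagonal.antidiagonal e,
      coeff x.1 ((PowerSeries.derivative R f).subst a) * coeff x.2 (pderiv S i a) =
      ∑ d ∈ Finset.range (N - 1), PowerSeries.coeff d (PowerSeries.derivative R f) •
        (coeff x.1 (a ^ d) * coeff x.2 (pderiv S i a)) := by
    intro x hx
    have hd : x.1.degree < N - 1 := by
      have : x.1.degree + x.2.degree = e.degree := by
        rw [← map_add, Finset.HasAntidiagonal.mem_antidiagonal.1 hx]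
      omega
    rw [coeff_subst_eq_sum_range ha _ _ hd, Finset.sum_mul]
    simp
  rw [Finset.sum_congr rfl h2, Finset.sum_comm, Finset.sum_mul, show N = (N - 1) + 1 by omega,
    Finset.sum_range_succ']
  have h3 : ∀ d, coeff (e + Finsupp.single i 1) (a ^ d) * ((e i : S) + 1) =
      coeff e (pderiv S i (a ^ d)) := fun d => (coeff_pderiv _ _).symm
  simp only [smul_mul_assoc, h3, pderiv_pow, Nat.add_sub_cancel]
  simp only [← Finset.smul_sum, ← coeff_mul]
  simp only [Nat.cast_zero, zero_mul, map_zero, smul_zero, add_zero]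
  refine Finset.sum_congr rfl fun d _ => ?_
  rw [PowerSeries.coeff_derivative, mul_assoc, ← nsmul_eq_mul, map_nsmul, mul_smul,
    ← Nat.cast_succ, Nat.cast_smul_eq_nsmul]

/-- The product of the factorials of the exponents of a monomial. -/
noncomputable def factorialProd {τ : Type*} (R : Type*) [CommRing R] (m : τ →₀ ℕ) : R :=
  m.prod fun _ j => (j.factorial : R)

theorem factorialProd_add_single {τ R : Type*} [CommRing R] (m : τ →₀ ℕ) (i : τ) :
    factorialProd R (m + Finsupp.single i 1) = factorialProd R m * (m i + 1) := by
  classical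
  have h1 : m.support ⊆ insert i m.support := Finset.subset_insert _ _
  have h2 : (m + Finsupp.single i 1).support ⊆ insert i m.support := by
    intro j hj
    by_cases h : j = i
    · simp [h]
    · simp [Ne.symm h] at hj
      simp [hj]
  rw [factorialProd, factorialProd, Finsupp.prod_of_support_subset _ h1 _ (by simp),
    Finsupp.prod_of_support_subset _ h2 _ (by simp),
    ← Finset.mul_prod_erase _ _ (Finset.mem_insert_self i _),
    ← Finset.mul_prod_erase _ (fun j => ((m j).factorial : R)) (Finset.mem_insert_self i _)]
  have h3 : ∀ j ∈ (insert i m.support).erase i,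
      (((m + Finsupp.single i 1 : τ →₀ ℕ) j).factorial : R) = ((m j).factorial : R) := by
    intro j hj
    have : i ≠ j := fun h => by simp [h] at hj
    simp [this]
  rw [Finset.prod_congr rfl h3]
  simp [Nat.factorial_succ]
  ring

/-- The iterated derivative of `F` at the origin with respect to the variables `f l`, `l ∈ S`. -/
noncomputable def multiDeriv {L τ R : Type*} [CommRing R] (f : L → τ) (S : Finset L)
    (F : MvPowerSeries τ R) : R :=
  factorialProd R (∑ l ∈ S, Finsupp.single (f l) 1) * coeff (∑ l ∈ S, Finsupp.single (f l) 1) F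

variable {L L' τ R : Type*} [CommRing R]

theorem multiDeriv_empty (f : L → τ) (F : MvPowerSeries τ R) :
    multiDeriv f ∅ F = constantCoeff F := by
  simp [multiDeriv, factorialProd]

theorem multiDeriv_insert [DecidableEq L] (f : L → τ) {S : Finset L} {l : L} (hl : l ∉ S)
    (F : MvPowerSeries τ R) :
    multiDeriv f (insert l S) F = multiDeriv f S (pderiv R (f l) F) := by
  rw [multiDeriv, multiDeriv, Finset.sum_insert hl, add_comm, factorialProd_add_single,
    coeff_pderiv]
  ring

theorem multiDeriv_add (f : L → τ) (S : Finset L) (F G : MvPowerSeries τ R) :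
    multiDeriv f S (F + G) = multiDeriv f S F + multiDeriv f S G := by
  simp [multiDeriv, mul_add]

theorem multiDeriv_sum {ι : Type*} (f : L → τ) (S : Finset L) (s : Finset ι)
    (F : ι → MvPowerSeries τ R) :
    multiDeriv f S (∑ i ∈ s, F i) = ∑ i ∈ s, multiDeriv f S (F i) := by
  simp [multiDeriv, Finset.mul_sum]

theorem multiDeriv_C_mul (f : L → τ) (S : Finset L) (c : R) (F : MvPowerSeries τ R) :
    multiDeriv f S (C c * F) = c * multiDeriv f S F := by
  simp [multiDeriv, mul_left_comm]

theorem multiDeriv_map (e : L' ↪ L) (f : L → τ) (S : Finset L') (F : MvPowerSeries τ R) :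
    multiDeriv f (S.map e) F = multiDeriv (f ∘ e) S F := by
  simp [multiDeriv]

theorem multiDeriv_univ_equiv [Fintype L] [Fintype L'] (e : L' ≃ L) (f : L → τ)
    (F : MvPowerSeries τ R) :
    multiDeriv f Finset.univ F = multiDeriv (f ∘ e) Finset.univ F := by
  rw [← Finset.map_univ_equiv e, multiDeriv_map]
  rfl

theorem multiDeriv_univ_option [Fintype L] (f : Option L → τ) (F : MvPowerSeries τ R) :
    multiDeriv f Finset.univ F = multiDeriv (f ∘ some) Finset.univ (pderiv R (f none) F) := by
  classical
  have : (Finset.univ : Finset (Option L)) =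
      insert none (Finset.univ.map Function.Embedding.some) := by
    ext x; cases x <;> simp
  rw [this, multiDeriv_insert _ (by simp), multiDeriv_map]
  rfl

/-- The Leibniz rule: the derivatives are distributed over the two factors. -/
theorem multiDeriv_mul [DecidableEq L] (f : L → τ) (S : Finset L) (F G : MvPowerSeries τ R) :
    multiDeriv f S (F * G) = ∑ T ∈ S.powerset, multiDeriv f T F * multiDeriv f (S \ T) G := by
  induction S using Finset.induction_on generalizing F G with
  | empty => simp [multiDeriv_empty]
  | insert l S hl ih =>
    rw [multiDeriv_insert f hl, Derivation.leibniz, smul_eq_mul, smul_eq_mul, multiDeriv_add,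
      mul_comm G, ih, ih, Finset.sum_powerset_insert hl]
    congr 1
    · refine Finset.sum_congr rfl fun T hT => ?_
      have hlT : l ∉ T := fun h => hl (Finset.mem_powerset.1 hT h)
      rw [Finset.insert_sdiff_of_notMem _ hlT, multiDeriv_insert f (by simp [hl])]
    · refine Finset.sum_congr rfl fun T hT => ?_
      have hlT : l ∉ T := fun h => hl (Finset.mem_powerset.1 hT h)
      rw [Finset.insert_sdiff_insert, multiDeriv_insert f hlT,
        Finset.sdiff_insert_of_notMem hl]

theorem multiDeriv_X_mul [DecidableEq L] [DecidableEq τ] (f : L → τ) (S : Finset L) (j : τ)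
    (F : MvPowerSeries τ R) :
    multiDeriv f S (X j * F) =
      ∑ l ∈ S, if f l = j then multiDeriv f (S.erase l) F else 0 := by
  set m : τ →₀ ℕ := ∑ l ∈ S, Finsupp.single (f l) 1 with hm
  have hcard : m j = (S.filter fun l => f l = j).card := by
    rw [hm, Finsupp.finsetSum_apply, Finset.card_filter]
    simp only [Finsupp.single_apply]
  rw [multiDeriv, ← hm, X_def, coeff_monomial_mul, ← Finset.sum_filter]
  by_cases h0 : m j = 0
  · rw [if_neg (by rw [Finsupp.single_le_iff]; omega)]
    rw [h0] at hcard
    rw [Finset.card_eq_zero.1 hcard.symm]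
    simp
  · have hle : Finsupp.single j 1 ≤ m := by rw [Finsupp.single_le_iff]; omega
    obtain ⟨m', hm'⟩ := exists_add_of_le hle
    have h1 : ∀ l ∈ S.filter (fun l => f l = j),
        multiDeriv f (S.erase l) F = factorialProd R m' * coeff m' F := by
      intro l hl
      rw [Finset.mem_filter] at hl
      have : ∑ l ∈ S.erase l, Finsupp.single (f l) 1 = m' := by
        have h2 := Finset.add_sum_erase S (fun l => Finsupp.single (f l) 1) hl.1
        rw [← hm, hm', hl.2] at h2
        exact add_left_cancel h2
      rw [multiDeriv, this]
    rw [Finset.sum_congr rfl h1, Finset.sum_const, ← hcard, if_pos hle, hm', add_comm,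
      factorialProd_add_single, add_tsub_cancel_right]
    simp
    ring

end Series

/-! ### Wick's theorem -/

section Wick

open MvPowerSeries

variable {D : ℕ} {I : Fin D → Finset ℤ}

theorem constantCoeff_freeExponent (E : Momentum I → ℝ) :
    constantCoeff (∑ q : Momentum I, C (E q)⁻¹ * (X (Sum.inr q) * X (Sum.inl q)) :
      MvPowerSeries (Momentum I ⊕ Momentum I) ℝ) = 0 := by
  simp

theorem constantCoeff_freePartition (E : Momentum I → ℝ) :
    constantCoeff (freePartition E) = 1 := by
  have h := coeff_subst_eq_sum_range (constantCoeff_freeExponent E) (PowerSeries.exp ℝ) 0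
    (N := 1) (by simp)
  simpa [freePartition] using h

theorem pderiv_inl_freePartition (E : Momentum I → ℝ) (x : Momentum I) :
    pderiv ℝ (Sum.inl x) (freePartition E) =
      C (E x)⁻¹ * (X (Sum.inr x) * freePartition E) := by
  classical
  have h : pderiv ℝ (Sum.inl x) (∑ q : Momentum I, C (E q)⁻¹ * (X (Sum.inr q) * X (Sum.inl q)) :
      MvPowerSeries (Momentum I ⊕ Momentum I) ℝ) = C (E x)⁻¹ * X (Sum.inr x) := by
    rw [map_sum, Finset.sum_eq_single x]
    · simp
    · intro q _ hq
      simp [pderiv_X_of_ne, hq]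
    · simp
  rw [freePartition, pderiv_subst (constantCoeff_freeExponent E), PowerSeries.derivative_exp, h]
  ring

theorem pderiv_inr_freePartition (E : Momentum I → ℝ) (x : Momentum I) :
    pderiv ℝ (Sum.inr x) (freePartition E) =
      C (E x)⁻¹ * (X (Sum.inl x) * freePartition E) := by
  classical
  have h : pderiv ℝ (Sum.inr x) (∑ q : Momentum I, C (E q)⁻¹ * (X (Sum.inr q) * X (Sum.inl q)) :
      MvPowerSeries (Momentum I ⊕ Momentum I) ℝ) = C (E x)⁻¹ * X (Sum.inl x) := by
    rw [map_sum, Finset.sum_eq_single x]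
    · simp
    · intro q _ hq
      simp [pderiv_X_of_ne, hq]
    · simp
  rw [freePartition, pderiv_subst (constantCoeff_freeExponent E), PowerSeries.derivative_exp, h]
  ring

open Classical in
/-- Wick's theorem: the derivatives of the free partition function are the sum over all pairings
of the derivatives with respect to `J` with those with respect to `J̄`. -/
theorem multiDeriv_freePartition (E : Momentum I → ℝ) {A B : Type} [Fintype A] [Fintype B]
    (x : A → Momentum I) (y : B → Momentum I) :
    multiDeriv (Sum.elim (Sum.inl ∘ x) (Sum.inr ∘ y)) Finset.univ (freePartition E) =
      ∑ π : A ≃ B, ∏ a, if x a = y (π a) then (E (x a))⁻¹ else 0 := by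
  revert x y B
  refine Fintype.induction_empty_option
    (P := fun A _ => ∀ {B : Type} [Fintype B] (x : A → Momentum I) (y : B → Momentum I),
      multiDeriv (Sum.elim (Sum.inl ∘ x) (Sum.inr ∘ y)) Finset.univ (freePartition E) =
      ∑ π : A ≃ B, ∏ a, if x a = y (π a) then (E (x a))⁻¹ else 0) ?_ ?_ ?_ A
  · intro A A' _ e ih B _ x y
    let _ := Fintype.ofEquiv A' e.symm
    rw [multiDeriv_univ_equiv (Equiv.sumCongr e (Equiv.refl B))]
    have h := ih (x ∘ e) y
    have h2 : (Sum.elim (Sum.inl ∘ x) (Sum.inr ∘ y) : A' ⊕ B → Momentum I ⊕ Momentum I) ∘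
        (Equiv.sumCongr e (Equiv.refl B)) = Sum.elim (Sum.inl ∘ (x ∘ e)) (Sum.inr ∘ y) := by
      ext l; cases l <;> rfl
    rw [h2, h]
    refine Fintype.sum_equiv (Equiv.equivCongr e (Equiv.refl B)) _ _ fun π => ?_
    refine Fintype.prod_equiv e _ _ fun a => ?_
    simp
  · intro B _ x y
    rcases isEmpty_or_nonempty B with hB | ⟨⟨b⟩⟩
    · have : (Finset.univ : Finset (PEmpty ⊕ B)) = ∅ := by
        rw [Finset.univ_eq_empty]
      rw [this, multiDeriv_empty, constantCoeff_freePartition]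
      have : Nonempty (PEmpty.{1} ≃ B) := ⟨Equiv.equivOfIsEmpty _ _⟩
      have : Subsingleton (PEmpty.{1} ≃ B) := ⟨fun e e' => Equiv.ext fun a => a.elim⟩
      rw [Fintype.sum_subsingleton _ (Equiv.equivOfIsEmpty _ _)]
      simp
    · have h1 : IsEmpty (PEmpty.{1} ≃ B) := ⟨fun e => (e.symm b).elim⟩
      rw [← Finset.insert_erase (Finset.mem_univ (Sum.inr b : PEmpty ⊕ B)),
        multiDeriv_insert _ (by simp)]
      simp only [Sum.elim_inr, Function.comp_apply]
      rw [pderiv_inr_freePartition, multiDeriv_C_mul, multiDeriv_X_mul, Finset.sum_eq_zero]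
      · simp
      · rintro (l | l) _
        · exact l.elim
        · simp
  · intro A _ ih B _ x y
    have h1 : multiDeriv (Sum.elim (Sum.inl ∘ x) (Sum.inr ∘ y)) Finset.univ (freePartition E) =
        ∑ b : B, if x none = y b then (E (x none))⁻¹ * multiDeriv (Sum.elim (Sum.inl ∘ x ∘ some)
          (Sum.inr ∘ fun b' : {b' // b' ≠ b} => y b')) Finset.univ (freePartition E) else 0 := by
      let e : Option (A ⊕ B) ≃ Option A ⊕ B :=
        { toFun := fun o => o.elim (Sum.inl none) (Sum.map some id)
          invFun := Sum.elim (fun o => o.elim none (fun a => some (Sum.inl a)))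
            (fun b => some (Sum.inr b))
          left_inv := by rintro (_ | _ | _) <;> rfl
          right_inv := by rintro ((_ | _) | _) <;> rfl }
      rw [multiDeriv_univ_equiv e, multiDeriv_univ_option]
      have h2 : ((Sum.elim (Sum.inl ∘ x) (Sum.inr ∘ y)) ∘ e) none =
        (Sum.inl (x none) : Momentum I ⊕ Momentum I) := rfl
      rw [h2, pderiv_inl_freePartition, multiDeriv_C_mul, multiDeriv_X_mul, Fintype.sum_sum_type]
      simp only [Function.comp_apply]
      have h3 : ∀ a : A, Sum.elim (Sum.inl ∘ x) (Sum.inr ∘ y) (e (some (Sum.inl a))) =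
        (Sum.inl (x (some a)) : Momentum I ⊕ Momentum I) := fun _ => rfl
      have h4 : ∀ b : B, Sum.elim (Sum.inl ∘ x) (Sum.inr ∘ y) (e (some (Sum.inr b))) =
        (Sum.inr (y b) : Momentum I ⊕ Momentum I) := fun _ => rfl
      simp only [h3, h4, reduceCtorEq, if_false, Finset.sum_const_zero, zero_add, Sum.inr.injEq]
      rw [Finset.mul_sum]
      refine Finset.sum_congr rfl fun b _ => ?_
      rw [mul_ite, mul_zero]
      refine if_congr eq_comm ?_ rfl
      congr 1
      have h5 : (Finset.univ : Finset (A ⊕ B)).erase (Sum.inr b) =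
          Finset.univ.map ((Function.Embedding.refl A).sumMap
            (Function.Embedding.subtype fun b' => b' ≠ b)) := by
        ext l; cases l <;> simp
      rw [h5, multiDeriv_map]
      congr 1
      ext l; cases l <;> rfl
    rw [h1]
    refine Eq.trans ?_ (Eq.trans (Fintype.sum_fiberwise (fun π : Option A ≃ B => π none)
      (fun π => ∏ a, if x a = y (π a) then (E (x a))⁻¹ else 0)) (by congr!))
    refine Finset.sum_congr rfl fun b _ => ?_
    have h7 : ∀ c : ℝ, (if x none = y b then c else 0) = (if x none = y b then 1 else 0) * c := by
      intro c; split_ifs <;> simp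
    rw [ih (x ∘ some) (fun b' : {b' // b' ≠ b} => y b'), Finset.mul_sum, h7, Finset.mul_sum]
    refine (Finset.sum_equiv (Equiv.optionSubtype b) (by simp) fun π _ => ?_).symm
    rw [Fintype.prod_option, π.2, ← mul_assoc]
    congr 1
    split_ifs <;> simp

end Wick

/-! ### Diagrams with an arbitrary finite set of vertices -/

/-- A Feynman graph whose interaction vertices are labelled by a type `V`. The fields `φ̄` and `φ`
of a vertex and the propagators are encoded as in `FeynmanGraph`. -/
@[ext] structure Diagram (D : ℕ) (W K V : Type) where
  colour : V → Fin D
  propagator : (W ⊕ V × Bool) ≃ (K ⊕ V × Bool)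

namespace Diagram

variable {D : ℕ} {W K V W' K' V' W₁ K₁ V₁ W₂ K₂ V₂ : Type} {I : Fin D → Finset ℤ}

open Classical in
noncomputable instance [Fintype W] [Fintype K] [Fintype V] : Fintype (Diagram D W K V) :=
  Fintype.ofInjective (fun Γ => (Γ.colour, Γ.propagator)) (by
    rintro ⟨c, p⟩ ⟨c', p'⟩ h
    simpa using h)

/-- The field `φ̄` joined by the edge of colour `a` to the field `φ` labelled `h`. -/
def vertexEdge (Γ : Diagram D W K V) (a : Fin D) (h : V × Bool) : V × Bool :=
  (h.1, if a = Γ.colour h.1 then !h.2 else h.2)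

theorem vertexEdge_vertexEdge (Γ : Diagram D W K V) (a : Fin D) (h : V × Bool) :
    Γ.vertexEdge a (Γ.vertexEdge a h) = h := by
  unfold vertexEdge
  ext <;> dsimp only
  split_ifs <;> simp

/-- The relation `R a` holds between the propagators that enter and leave each vertex along an edge
of colour `a`. -/
def Respects (Γ : Diagram D W K V) (R : Fin D → W ⊕ V × Bool → W ⊕ V × Bool → Prop) : Prop :=
  ∀ h a, R a (Γ.propagator.symm (Sum.inr h)) (Sum.inr (Γ.vertexEdge a h))

/-- The momenta of the propagators are conserved along every coloured edge of every vertex. -/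
def IsFlow (Γ : Diagram D W K V) (p : W ⊕ V × Bool → Momentum I) : Prop :=
  Γ.Respects fun a x y => p x a = p y a

/-- The property `f` of propagators is constant along the faces of colour `a`. -/
def FaceInv (Γ : Diagram D W K V) (a : Fin D) (f : W ⊕ V × Bool → Prop) : Prop :=
  Γ.Respects fun c x y => c = a → (f x ↔ f y)

/-- The propagator `u` lies on the external face of colour `a` that starts at the leg `v`. -/
def OnFace (Γ : Diagram D W K V) (v : W) (a : Fin D) (u : W ⊕ V × Bool) : Prop :=
  ∀ f, Γ.FaceInv a f → (f (Sum.inl v) ↔ f u)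

/-- The diagram has the boundary graph `B`: a property that is constant along the faces of colour
`a` does not distinguish the two ends of an `a`-coloured edge of `B`. -/
def HasBdry (Γ : Diagram D W K V) (B : ColouredGraph D W K) : Prop :=
  ∀ a v, Γ.OnFace v a (Γ.propagator.symm (Sum.inl (B.edge a v)))

/-- The legs and vertices selected by `f`, `g`, `h` are a union of connected components: no
propagator joins a selected end to one that is not. -/
def IsSplit (Γ : Diagram D W K V) (f : W → Prop) (g : K → Prop) (h : V → Prop) : Prop :=
  ∀ u, Sum.elim f (fun x => h x.1) u ↔ Sum.elim g (fun x => h x.1) (Γ.propagator u)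

/-- Connectedness: there is no union of components except the trivial ones. -/
def Conn (Γ : Diagram D W K V) : Prop :=
  (Nonempty W ∨ Nonempty K ∨ Nonempty V) ∧ ∀ f g h, Γ.IsSplit f g h →
    ((∀ w, f w) ∧ (∀ k, g k) ∧ ∀ v, h v) ∨ ((∀ w, ¬ f w) ∧ (∀ k, ¬ g k) ∧ ∀ v, ¬ h v)

/-- No component of the diagram is a vacuum diagram. -/
def NoVac (Γ : Diagram D W K V) : Prop :=
  ∀ h, Γ.IsSplit (fun _ => False) (fun _ => False) h → ∀ v, ¬ h v

section WeightedSum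

variable [Fintype W] [Fintype V]

open Classical in
/-- The sum over all momentum flows of the product of the weights `ω u` of the propagators. -/
noncomputable def wsum (Γ : Diagram D W K V) (ω : W ⊕ V × Bool → Momentum I → ℝ) : ℝ :=
  ∑ p ∈ (Finset.univ : Finset (W ⊕ V × Bool → Momentum I)).filter Γ.IsFlow, ∏ u, ω u (p u)

end WeightedSum

theorem IsSplit.not {Γ : Diagram D W K V} {f : W → Prop} {g : K → Prop} {h : V → Prop}
    (H : Γ.IsSplit f g h) : Γ.IsSplit (fun w => ¬ f w) (fun k => ¬ g k) (fun v => ¬ h v) := by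
  intro u
  have := H u
  cases u <;> cases hh : Γ.propagator _ <;> rw [hh] at this <;> simp_all

theorem IsSplit.and {Γ : Diagram D W K V} {f f' : W → Prop} {g g' : K → Prop} {h h' : V → Prop}
    (H : Γ.IsSplit f g h) (H' : Γ.IsSplit f' g' h') :
    Γ.IsSplit (fun w => f w ∧ f' w) (fun k => g k ∧ g' k) (fun v => h v ∧ h' v) := by
  intro u
  have := H u
  have h2 := H' u
  cases u <;> cases hh : Γ.propagator _ <;> rw [hh] at this h2 <;> simp_all

theorem IsSplit.forall {Γ : Diagram D W K V} {ι : Sort*} {f : ι → W → Prop} {g : ι → K → Prop}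
    {h : ι → V → Prop} (H : ∀ i, Γ.IsSplit (f i) (g i) (h i)) :
    Γ.IsSplit (fun w => ∀ i, f i w) (fun k => ∀ i, g i k) (fun v => ∀ i, h i v) := by
  intro u
  have h1 := fun i => H i u
  cases u <;> cases hh : Γ.propagator _ <;> rw [hh] at h1 <;>
    exact forall_congr' fun i => h1 i

theorem Conn.noVac [Nonempty W] {Γ : Diagram D W K V} (h : Γ.Conn) : Γ.NoVac := by
  intro f hf
  rcases h.2 _ _ _ hf with ⟨h1, -⟩ | ⟨-, -, h1⟩
  · exact (h1 (Classical.arbitrary W)).elim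
  · exact h1

theorem HasBdry.isSplit {Γ : Diagram D W K V} {B : ColouredGraph D W K} (hB : Γ.HasBdry B)
    {f : W → Prop} {g : K → Prop} {h : V → Prop} (H : Γ.IsSplit f g h) (a : Fin D) (v : W) :
    f v ↔ g (B.edge a v) := by
  have h1 := hB a v (Sum.elim f (fun x => h x.1)) (by
    intro x c _
    have := H (Γ.propagator.symm (Sum.inr x))
    simpa [vertexEdge] using this)
  rw [H] at h1
  rw [H] at h1
  have h2 := H (Sum.inl v)
  simp only [Sum.elim_inl] at h2
  simpa [← h2] using h1

/-! ### Relabelling -/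

/-- Relabelling of the half-edges induced by relabellings of the legs and of the vertices. -/
def halfEquiv (eW : W ≃ W') (eV : V ≃ V') : W ⊕ V × Bool ≃ W' ⊕ V' × Bool :=
  Equiv.sumCongr eW (Equiv.prodCongr eV (Equiv.refl _))

theorem halfEquiv_symm (eW : W ≃ W') (eV : V ≃ V') :
    (halfEquiv eW eV).symm = halfEquiv eW.symm eV.symm := rfl

@[simp] theorem halfEquiv_inr (eW : W ≃ W') (eV : V ≃ V') (h : V × Bool) :
    halfEquiv eW eV (Sum.inr h) = Sum.inr (eV h.1, h.2) := rfl

@[simp] theorem halfEquiv_inl (eW : W ≃ W') (eV : V ≃ V') (w : W) :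
    halfEquiv eW eV (Sum.inl w) = Sum.inl (eW w) := rfl

/-- The diagram with relabelled legs and vertices. -/
def relabel (eW : W ≃ W') (eK : K ≃ K') (eV : V ≃ V') (Γ : Diagram D W K V) :
    Diagram D W' K' V' where
  colour := Γ.colour ∘ eV.symm
  propagator := (halfEquiv eW eV).symm.trans (Γ.propagator.trans (halfEquiv eK eV))

/-- Relabelling as an equivalence. -/
def relabelEquiv (eW : W ≃ W') (eK : K ≃ K') (eV : V ≃ V') :
    Diagram D W K V ≃ Diagram D W' K' V' where
  toFun := relabel eW eK eV
  invFun := relabel eW.symm eK.symm eV.symm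
  left_inv Γ := by
    ext x
    · simp [relabel]
    · simp [relabel, ← halfEquiv_symm]
  right_inv Γ := by
    ext x
    · simp [relabel]
    · simp [relabel, ← halfEquiv_symm]

section Relabel

variable (eW : W ≃ W') (eK : K ≃ K') (eV : V ≃ V') (Γ : Diagram D W K V)

theorem relabel_respects (R : Fin D → W' ⊕ V' × Bool → W' ⊕ V' × Bool → Prop) :
    (Γ.relabel eW eK eV).Respects R ↔
      Γ.Respects fun a x y => R a (halfEquiv eW eV x) (halfEquiv eW eV y) := by
  constructor
  · intro H h a
    have := H (eV h.1, h.2) a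
    simpa [relabel, halfEquiv_symm, vertexEdge] using this
  · rintro H ⟨v, b⟩ a
    obtain ⟨v, rfl⟩ := eV.surjective v
    have := H (v, b) a
    simpa [relabel, halfEquiv_symm, vertexEdge] using this

theorem relabel_isFlow (p : W' ⊕ V' × Bool → Momentum I) :
    (Γ.relabel eW eK eV).IsFlow p ↔ Γ.IsFlow (p ∘ halfEquiv eW eV) :=
  relabel_respects eW eK eV Γ _

theorem relabel_faceInv (a : Fin D) (f : W' ⊕ V' × Bool → Prop) :
    (Γ.relabel eW eK eV).FaceInv a f ↔ Γ.FaceInv a (f ∘ halfEquiv eW eV) :=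
  relabel_respects eW eK eV Γ _

theorem relabel_onFace (v : W) (a : Fin D) (u : W ⊕ V × Bool) :
    (Γ.relabel eW eK eV).OnFace (eW v) a (halfEquiv eW eV u) ↔ Γ.OnFace v a u := by
  constructor
  · intro H f hf
    have := H (f ∘ (halfEquiv eW eV).symm) ((relabel_faceInv eW eK eV Γ a _).2 (by
      convert hf
      ext x; simp))
    simp only [Function.comp_apply, Equiv.symm_apply_apply] at this
    simpa [halfEquiv_symm] using this
  · intro H f hf
    exact H _ ((relabel_faceInv eW eK eV Γ a _).1 hf)

theorem relabel_hasBdry (B : ColouredGraph D W' K') :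
    (Γ.relabel eW eK eV).HasBdry B ↔
      Γ.HasBdry ⟨fun a => eW.trans ((B.edge a).trans eK.symm)⟩ := by
  refine forall_congr' fun a => ?_
  rw [← eW.forall_congr_right]
  refine forall_congr' fun v => ?_
  rw [← relabel_onFace eW eK eV]
  simp [relabel, halfEquiv_symm]

theorem relabel_isSplit (f : W' → Prop) (g : K' → Prop) (h : V' → Prop) :
    (Γ.relabel eW eK eV).IsSplit f g h ↔ Γ.IsSplit (f ∘ eW) (g ∘ eK) (h ∘ eV) := by
  unfold IsSplit
  rw [← (halfEquiv eW eV).forall_congr_right]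
  refine forall_congr' fun u => ?_
  have h1 : ∀ x : W ⊕ V × Bool, Sum.elim f (fun x => h x.1) (halfEquiv eW eV x) ↔
      Sum.elim (f ∘ eW) (fun x => (h ∘ eV) x.1) x := by
    rintro (x | x) <;> simp
  have h2 : ∀ x : K ⊕ V × Bool, Sum.elim g (fun x => h x.1) (halfEquiv eK eV x) ↔
      Sum.elim (g ∘ eK) (fun x => (h ∘ eV) x.1) x := by
    rintro (x | x) <;> simp
  rw [h1, ← h2]
  simp [relabel]

theorem relabel_conn : (Γ.relabel eW eK eV).Conn ↔ Γ.Conn := by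
  unfold Conn
  refine and_congr ?_ ?_
  · rw [eW.nonempty_congr, eK.nonempty_congr, eV.nonempty_congr]
  · constructor
    · intro H f g h hs
      have := H (f ∘ eW.symm) (g ∘ eK.symm) (h ∘ eV.symm)
        ((relabel_isSplit eW eK eV Γ _ _ _).2 (by simpa [Function.comp_assoc] using hs))
      simpa [eW.symm.forall_congr_left, eK.symm.forall_congr_left,
        eV.symm.forall_congr_left] using this
    · intro H f g h hs
      have := H _ _ _ ((relabel_isSplit eW eK eV Γ _ _ _).1 hs)
      simpa [eW.forall_congr_left, eK.forall_congr_left, eV.forall_congr_left] using this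

theorem relabel_noVac : (Γ.relabel eW eK eV).NoVac ↔ Γ.NoVac := by
  unfold NoVac
  constructor
  · intro H h hs
    have := H (h ∘ eV.symm)
      ((relabel_isSplit eW eK eV Γ _ _ _).2 (by simpa [Function.comp_def] using hs))
    simpa [eV.symm.forall_congr_left] using this
  · intro H h hs
    have := H (h ∘ eV)
      ((relabel_isSplit eW eK eV Γ (fun _ => False) (fun _ => False) h).1 hs)
    simpa [eV.forall_congr_left] using this

theorem relabel_wsum [Fintype W] [Fintype V] [Fintype W'] [Fintype V']
    (ω : W' ⊕ V' × Bool → Momentum I → ℝ) :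
    (Γ.relabel eW eK eV).wsum ω = Γ.wsum fun u => ω (halfEquiv eW eV u) := by
  classical
  unfold wsum
  refine Finset.sum_equiv (Equiv.arrowCongr (halfEquiv eW eV).symm (Equiv.refl _)) ?_ ?_
  · intro p
    simp only [Finset.mem_filter, Finset.mem_univ, true_and]
    exact relabel_isFlow eW eK eV Γ p
  · intro p _
    refine (Fintype.prod_equiv (halfEquiv eW eV) _ _ fun u => ?_).symm
    simp [Equiv.arrowCongr]

end Relabel

/-! ### Disjoint unions -/

/-- The half-edges of a disjoint union. -/
def unionEquiv (eW : W₁ ⊕ W₂ ≃ W) (eV : V₁ ⊕ V₂ ≃ V) :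
    (W₁ ⊕ V₁ × Bool) ⊕ (W₂ ⊕ V₂ × Bool) ≃ W ⊕ V × Bool :=
  (Equiv.sumSumSumComm W₁ (V₁ × Bool) W₂ (V₂ × Bool)).trans
    (Equiv.sumCongr eW ((Equiv.sumProdDistrib V₁ V₂ Bool).symm.trans
      (Equiv.prodCongr eV (Equiv.refl _))))

/-- The disjoint union of two diagrams, with legs and vertices labelled by `W`, `K`, `V`. -/
def union (eW : W₁ ⊕ W₂ ≃ W) (eK : K₁ ⊕ K₂ ≃ K) (eV : V₁ ⊕ V₂ ≃ V)
    (Γ₁ : Diagram D W₁ K₁ V₁) (Γ₂ : Diagram D W₂ K₂ V₂) : Diagram D W K V where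
  colour := Sum.elim Γ₁.colour Γ₂.colour ∘ eV.symm
  propagator := (unionEquiv eW eV).symm.trans
    ((Equiv.sumCongr Γ₁.propagator Γ₂.propagator).trans (unionEquiv eK eV))

section Union

variable (eW : W₁ ⊕ W₂ ≃ W) (eK : K₁ ⊕ K₂ ≃ K) (eV : V₁ ⊕ V₂ ≃ V)
  (Γ₁ : Diagram D W₁ K₁ V₁) (Γ₂ : Diagram D W₂ K₂ V₂)

@[simp] theorem unionEquiv_inl_inl (w : W₁) :
    unionEquiv eW eV (Sum.inl (Sum.inl w)) = Sum.inl (eW (Sum.inl w)) := rfl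

@[simp] theorem unionEquiv_inl_inr (h : V₁ × Bool) :
    unionEquiv eW eV (Sum.inl (Sum.inr h)) = Sum.inr (eV (Sum.inl h.1), h.2) := rfl

@[simp] theorem unionEquiv_inr_inl (w : W₂) :
    unionEquiv eW eV (Sum.inr (Sum.inl w)) = Sum.inl (eW (Sum.inr w)) := rfl

@[simp] theorem unionEquiv_inr_inr (h : V₂ × Bool) :
    unionEquiv eW eV (Sum.inr (Sum.inr h)) = Sum.inr (eV (Sum.inr h.1), h.2) := rfl

@[simp] theorem union_propagator_unionEquiv (x : (W₁ ⊕ V₁ × Bool) ⊕ (W₂ ⊕ V₂ × Bool)) :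
    (union eW eK eV Γ₁ Γ₂).propagator (unionEquiv eW eV x) =
      unionEquiv eK eV (Sum.map Γ₁.propagator Γ₂.propagator x) := by
  simp [union]

@[simp] theorem union_propagator_symm_unionEquiv (x : (K₁ ⊕ V₁ × Bool) ⊕ (K₂ ⊕ V₂ × Bool)) :
    (union eW eK eV Γ₁ Γ₂).propagator.symm (unionEquiv eK eV x) =
      unionEquiv eW eV (Sum.map Γ₁.propagator.symm Γ₂.propagator.symm x) := by
  simp [union]

theorem union_respects (R : Fin D → W ⊕ V × Bool → W ⊕ V × Bool → Prop) :
    (union eW eK eV Γ₁ Γ₂).Respects R ↔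
      (Γ₁.Respects fun a x y => R a (unionEquiv eW eV (Sum.inl x)) (unionEquiv eW eV (Sum.inl y))) ∧
      (Γ₂.Respects fun a x y =>
        R a (unionEquiv eW eV (Sum.inr x)) (unionEquiv eW eV (Sum.inr y))) := by
  constructor
  · intro H
    refine ⟨fun h a => ?_, fun h a => ?_⟩
    · have := H (eV (Sum.inl h.1), h.2) a
      rw [← unionEquiv_inl_inr eK eV, union_propagator_symm_unionEquiv] at this
      simpa [vertexEdge, union] using this
    · have := H (eV (Sum.inr h.1), h.2) a
      rw [← unionEquiv_inr_inr eK eV, union_propagator_symm_unionEquiv] at this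
      simpa [vertexEdge, union] using this
  · rintro ⟨H1, H2⟩ ⟨v, b⟩ a
    obtain ⟨v, rfl⟩ := eV.surjective v
    rcases v with v | v
    · have := H1 (v, b) a
      rw [← unionEquiv_inl_inr eK eV (v, b), union_propagator_symm_unionEquiv]
      simpa [vertexEdge, union] using this
    · have := H2 (v, b) a
      rw [← unionEquiv_inr_inr eK eV (v, b), union_propagator_symm_unionEquiv]
      simpa [vertexEdge, union] using this

theorem union_isSplit (f : W → Prop) (g : K → Prop) (h : V → Prop) :
    (union eW eK eV Γ₁ Γ₂).IsSplit f g h ↔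
      Γ₁.IsSplit (fun w => f (eW (Sum.inl w))) (fun k => g (eK (Sum.inl k)))
        (fun v => h (eV (Sum.inl v))) ∧
      Γ₂.IsSplit (fun w => f (eW (Sum.inr w))) (fun k => g (eK (Sum.inr k)))
        (fun v => h (eV (Sum.inr v))) := by
  unfold IsSplit
  rw [← (unionEquiv eW eV).forall_congr_right]
  simp only [union_propagator_unionEquiv, Sum.forall, Sum.map_inl, Sum.map_inr,
    unionEquiv_inl_inl, unionEquiv_inl_inr, unionEquiv_inr_inl, unionEquiv_inr_inr, Sum.elim_inl,
    Sum.elim_inr]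
  have h1 : ∀ x : K₁ ⊕ V₁ × Bool, Sum.elim g (fun x => h x.1) (unionEquiv eK eV (Sum.inl x)) ↔
      Sum.elim (fun k => g (eK (Sum.inl k))) (fun x => h (eV (Sum.inl x.1))) x := by
    rintro (x | x) <;> simp
  have h2 : ∀ x : K₂ ⊕ V₂ × Bool, Sum.elim g (fun x => h x.1) (unionEquiv eK eV (Sum.inr x)) ↔
      Sum.elim (fun k => g (eK (Sum.inr k))) (fun x => h (eV (Sum.inr x.1))) x := by
    rintro (x | x) <;> simp
  simp only [h1, h2]

theorem union_isSplit_isLeft : (union eW eK eV Γ₁ Γ₂).IsSplit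
    (fun w => (eW.symm w).isLeft) (fun k => (eK.symm k).isLeft) (fun v => (eV.symm v).isLeft) := by
  rw [union_isSplit]
  constructor <;> intro u <;> cases u <;> cases hh : Diagram.propagator _ _ <;> simp

theorem union_wsum [Fintype W] [Fintype V] [Fintype W₁] [Fintype V₁] [Fintype W₂] [Fintype V₂]
    (ω : W ⊕ V × Bool → Momentum I → ℝ) :
    (union eW eK eV Γ₁ Γ₂).wsum ω =
      Γ₁.wsum (fun u => ω (unionEquiv eW eV (Sum.inl u))) *
      Γ₂.wsum (fun u => ω (unionEquiv eW eV (Sum.inr u))) := by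
  classical
  unfold wsum
  rw [Finset.sum_mul_sum, ← Finset.sum_product']
  refine Finset.sum_equiv ((Equiv.arrowCongr (unionEquiv eW eV).symm (Equiv.refl _)).trans
    (Equiv.sumArrowEquivProdArrow _ _ _)) ?_ ?_
  · intro p
    simp only [Finset.mem_filter, Finset.mem_univ, true_and, Finset.mem_product]
    exact union_respects eW eK eV Γ₁ Γ₂ _
  · intro p _
    rw [← (unionEquiv eW eV).prod_comp, Fintype.prod_sum_type]
    rfl

theorem union_injective {Γ₁ Γ₁' : Diagram D W₁ K₁ V₁} {Γ₂ Γ₂' : Diagram D W₂ K₂ V₂}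
    (h : union eW eK eV Γ₁ Γ₂ = union eW eK eV Γ₁' Γ₂') : Γ₁ = Γ₁' ∧ Γ₂ = Γ₂' := by
  have hc : ∀ v, (union eW eK eV Γ₁ Γ₂).colour (eV v) = (union eW eK eV Γ₁' Γ₂').colour (eV v) := by
    rw [h]; simp
  have hp : ∀ u, (union eW eK eV Γ₁ Γ₂).propagator (unionEquiv eW eV u) =
      (union eW eK eV Γ₁' Γ₂').propagator (unionEquiv eW eV u) := by
    rw [h]; simp
  simp only [union_propagator_unionEquiv, EmbeddingLike.apply_eq_iff_eq] at hp
  refine ⟨Diagram.ext ?_ (Equiv.ext fun u => ?_), Diagram.ext ?_ (Equiv.ext fun u => ?_)⟩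
  · ext v; simpa [union] using congrArg Fin.val (hc (Sum.inl v))
  · simpa using hp (Sum.inl u)
  · ext v; simpa [union] using congrArg Fin.val (hc (Sum.inr v))
  · simpa using hp (Sum.inr u)

/-- A diagram is a disjoint union if no propagator joins the two parts. -/
theorem exists_eq_union {Γ : Diagram D W K V}
    (h : Γ.IsSplit (fun w => (eW.symm w).isLeft) (fun k => (eK.symm k).isLeft)
      (fun v => (eV.symm v).isLeft)) :
    ∃ Γ₁ Γ₂, Γ = union eW eK eV Γ₁ Γ₂ := by
  have hW : ∀ x : (W₁ ⊕ V₁ × Bool) ⊕ (W₂ ⊕ V₂ × Bool),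
      Sum.elim (fun w => ((eW.symm w).isLeft : Prop)) (fun x => ((eV.symm x.1).isLeft : Prop))
        (unionEquiv eW eV x) ↔ x.isLeft := by
    rintro ((x | x) | (x | x)) <;> simp
  have hK : ∀ x : (K₁ ⊕ V₁ × Bool) ⊕ (K₂ ⊕ V₂ × Bool),
      Sum.elim (fun w => ((eK.symm w).isLeft : Prop)) (fun x => ((eV.symm x.1).isLeft : Prop))
        (unionEquiv eK eV x) ↔ x.isLeft := by
    rintro ((x | x) | (x | x)) <;> simp
  set e := (unionEquiv eW eV).trans (Γ.propagator.trans (unionEquiv eK eV).symm) with he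
  have hΓ : Γ.propagator = (unionEquiv eW eV).symm.trans (e.trans (unionEquiv eK eV)) := by
    ext; simp [he]
  have key : ∀ x, x.isLeft = (e x).isLeft := by
    intro x
    have h1 := h (unionEquiv eW eV x)
    rw [hW, hΓ] at h1
    simp only [Equiv.trans_apply, Equiv.symm_apply_apply, hK] at h1
    exact Bool.eq_iff_iff.2 h1
  have key' : ∀ x, x.isLeft = (e.symm x).isLeft := fun x => by rw [key]; simp
  have k1 : ∀ x, (e (Sum.inl x)).isLeft := fun x => by rw [← key]; rfl
  have k2 : ∀ x, (e.symm (Sum.inl x)).isLeft := fun x => by rw [← key']; rfl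
  have k3 : ∀ x, (e (Sum.inr x)).isRight := fun x => by
    rw [← Sum.not_isLeft, ← key]; simp
  have k4 : ∀ x, (e.symm (Sum.inr x)).isRight := fun x => by
    rw [← Sum.not_isLeft, ← key']; simp
  refine ⟨⟨fun v => Γ.colour (eV (Sum.inl v)),
    ⟨fun x => (e (Sum.inl x)).getLeft (k1 x), fun x => (e.symm (Sum.inl x)).getLeft (k2 x),
      fun x => ?_, fun x => ?_⟩⟩, ⟨fun v => Γ.colour (eV (Sum.inr v)),
    ⟨fun x => (e (Sum.inr x)).getRight (k3 x), fun x => (e.symm (Sum.inr x)).getRight (k4 x),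
      fun x => ?_, fun x => ?_⟩⟩, ?_⟩
  · apply Sum.inl_injective (β := W₂ ⊕ V₂ × Bool)
    simp
  · apply Sum.inl_injective (β := K₂ ⊕ V₂ × Bool)
    simp
  · apply Sum.inr_injective (α := W₁ ⊕ V₁ × Bool)
    simp
  · apply Sum.inr_injective (α := K₁ ⊕ V₁ × Bool)
    simp
  · refine Diagram.ext ?_ (Equiv.ext fun u => ?_)
    · funext v
      obtain ⟨v, rfl⟩ := eV.surjective v
      cases v <;> simp [union]
    · obtain ⟨u, rfl⟩ := (unionEquiv eW eV).surjective u
      rw [union_propagator_unionEquiv, hΓ]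
      cases u <;> simp

open Classical in
/-- The sum over the diagrams that split into two given parts. -/
theorem sum_isSplit [Fintype W] [Fintype K] [Fintype V] [Fintype W₁] [Fintype K₁] [Fintype V₁]
    [Fintype W₂] [Fintype K₂] [Fintype V₂] {M : Type*} [AddCommMonoid M] (F : Diagram D W K V → M) :
    ∑ Γ ∈ (Finset.univ : Finset (Diagram D W K V)).filter (fun Γ => Γ.IsSplit
      (fun w => (eW.symm w).isLeft) (fun k => (eK.symm k).isLeft) (fun v => (eV.symm v).isLeft)),
      F Γ = ∑ Γ₁ : Diagram D W₁ K₁ V₁, ∑ Γ₂ : Diagram D W₂ K₂ V₂, F (union eW eK eV Γ₁ Γ₂) := by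
  rw [← Finset.sum_product']
  refine (Finset.sum_bij (fun x _ => union eW eK eV x.1 x.2) ?_ ?_ ?_ ?_).symm
  · intro x _
    simpa using union_isSplit_isLeft eW eK eV x.1 x.2
  · intro x _ y _ h
    exact Prod.ext_iff.2 (union_injective eW eK eV h)
  · intro Γ hΓ
    obtain ⟨Γ₁, Γ₂, h⟩ := exists_eq_union eW eK eV (by simpa using hΓ)
    exact ⟨(Γ₁, Γ₂), by simp, h.symm⟩
  · simp

end Union

end Diagram

/-! ### Faces and the boundary graph -/

namespace Diagram

variable {D : ℕ} {W K V : Type} {I : Fin D → Finset ℤ}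

/-- `u` lists the propagators on the face of colour `a` that leads from the leg `v` to the leg
`w`. -/
structure IsFacePath (Γ : Diagram D W K V) (a : Fin D) (v : W) (w : K) {m : ℕ}
    (u : Fin (m + 1) → W ⊕ V × Bool) : Prop where
  injective : Function.Injective u
  zero : u 0 = Sum.inl v
  step : ∀ i : Fin m, ∃ h, Γ.propagator (u i.castSucc) = Sum.inr h ∧
    u i.succ = Sum.inr (Γ.vertexEdge a h)
  last : Γ.propagator (u (Fin.last m)) = Sum.inl w

theorem vertexEdge_injective (Γ : Diagram D W K V) (a : Fin D) :
    Function.Injective (Γ.vertexEdge a) := fun x y h => by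
  rw [← Γ.vertexEdge_vertexEdge a x, h, Γ.vertexEdge_vertexEdge]

/-- The next propagator on the face of colour `a`; stationary at the end of an external face. -/
def next (Γ : Diagram D W K V) (a : Fin D) (x : W ⊕ V × Bool) : W ⊕ V × Bool :=
  Sum.elim (fun _ => x) (fun h => Sum.inr (Γ.vertexEdge a h)) (Γ.propagator x)

theorem next_iterate_ne (Γ : Diagram D W K V) (a : Fin D) (v : W) {m : ℕ}
    (hm : ∀ k < m, (Γ.propagator ((Γ.next a)^[k] (Sum.inl v))).isRight) :
    ∀ i j, i + j + 1 ≤ m → (Γ.next a)^[i] (Sum.inl v) ≠ (Γ.next a)^[i + j + 1] (Sum.inl v) := by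
  have step : ∀ k < m, ∃ h, Γ.propagator ((Γ.next a)^[k] (Sum.inl v)) = Sum.inr h ∧
      (Γ.next a)^[k + 1] (Sum.inl v) = Sum.inr (Γ.vertexEdge a h) := by
    intro k hk
    obtain ⟨h, hh⟩ := Sum.isRight_iff.1 (hm k hk)
    refine ⟨h, hh, ?_⟩
    rw [Function.iterate_succ_apply', next, hh]
    rfl
  intro i
  induction i with
  | zero =>
    intro j hj h
    obtain ⟨x, -, hx⟩ := step (0 + j) (by omega)
    rw [hx] at h
    simp at h
  | succ i ih =>
    intro j hj h
    obtain ⟨x, hx1, hx2⟩ := step i (by omega)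
    obtain ⟨y, hy1, hy2⟩ := step (i + 1 + j) (by omega)
    rw [hx2, hy2, Sum.inr.injEq] at h
    have := Γ.vertexEdge_injective a h
    rw [this, ← hy1, Γ.propagator.apply_eq_iff_eq] at hx1
    exact ih j (by omega) (by rw [hx1]; congr 1; omega)

/-- Every external face is a path from a `J`-leg to a `J̄`-leg. -/
theorem exists_isFacePath [Finite W] [Finite V] (Γ : Diagram D W K V) (a : Fin D) (v : W) :
    ∃ (w : K) (m : ℕ) (u : Fin (m + 1) → W ⊕ V × Bool), Γ.IsFacePath a v w u := by
  have hinj : ∀ m, (∀ k < m, (Γ.propagator ((Γ.next a)^[k] (Sum.inl v))).isRight) →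
      ∀ i j, i ≤ m → j ≤ m → (Γ.next a)^[i] (Sum.inl v) = (Γ.next a)^[j] (Sum.inl v) → i = j := by
    intro m hm i j hi hj h
    by_contra hne
    rcases lt_or_gt_of_ne hne with hlt | hlt
    · obtain ⟨d, rfl⟩ := Nat.exists_eq_add_of_lt hlt
      exact Γ.next_iterate_ne a v hm i d (by omega) h
    · obtain ⟨d, rfl⟩ := Nat.exists_eq_add_of_lt hlt
      exact Γ.next_iterate_ne a v hm j d (by omega) h.symm
  have hex : ∃ n, (Γ.propagator ((Γ.next a)^[n] (Sum.inl v))).isLeft := by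
    by_contra hno
    push Not at hno
    have : Function.Injective fun n => (Γ.next a)^[n] (Sum.inl v : W ⊕ V × Bool) := by
      intro i j h
      exact hinj (max i j) (fun k _ => by simpa using hno k) i j (by simp) (by simp) h
    exact not_injective_infinite_finite _ this
  classical
  obtain ⟨w, hw⟩ := Sum.isLeft_iff.1 (Nat.find_spec hex)
  have hlt : ∀ k < Nat.find hex, (Γ.propagator ((Γ.next a)^[k] (Sum.inl v))).isRight := by
    intro k hk
    simpa using Nat.find_min hex hk
  refine ⟨w, Nat.find hex, fun i => (Γ.next a)^[i] (Sum.inl v), ?_, rfl, ?_, hw⟩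
  · intro i j h
    exact Fin.ext (hinj _ hlt i j (by omega) (by omega) h)
  · intro i
    obtain ⟨h, hh⟩ := Sum.isRight_iff.1 (hlt i i.2)
    refine ⟨h, hh, ?_⟩
    simp only [Fin.val_succ, Function.iterate_succ_apply', next]
    rw [hh]
    rfl

namespace IsFacePath

variable {Γ : Diagram D W K V} {a : Fin D} {v : W} {w : K} {m : ℕ}
  {u : Fin (m + 1) → W ⊕ V × Bool}

/-- A path is entered only at its first propagator. -/
theorem inr_vertexEdge_mem_iff (hu : Γ.IsFacePath a v w u) (h : V × Bool) (i : Fin (m + 1)) :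
    u i = Sum.inr (Γ.vertexEdge a h) ↔
      ∃ j : Fin m, i = j.succ ∧ u j.castSucc = Γ.propagator.symm (Sum.inr h) := by
  constructor
  · intro hi
    have hi0 : i ≠ 0 := by
      rintro rfl
      rw [hu.zero] at hi
      simp at hi
    obtain ⟨j, rfl⟩ := Fin.exists_succ_eq.2 hi0
    obtain ⟨h', h1, h2⟩ := hu.step j
    rw [h2, Sum.inr.injEq] at hi
    rw [Γ.vertexEdge_injective a hi] at h1
    exact ⟨j, rfl, by rw [← h1]; simp⟩
  · rintro ⟨j, rfl, hj⟩
    obtain ⟨h', h1, h2⟩ := hu.step j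
    rw [hj] at h1
    simp only [Equiv.apply_symm_apply, Sum.inr.injEq] at h1
    rw [h2, h1]

theorem propagator_symm_mem_iff (hu : Γ.IsFacePath a v w u) (h : V × Bool) (i : Fin (m + 1)) :
    u i = Γ.propagator.symm (Sum.inr h) ↔
      ∃ j : Fin m, i = j.castSucc ∧ u j.succ = Sum.inr (Γ.vertexEdge a h) := by
  constructor
  · intro hi
    have him : i ≠ Fin.last m := by
      rintro rfl
      have := hu.last
      rw [hi] at this
      simp at this
    obtain ⟨j, rfl⟩ := Fin.exists_castSucc_eq.2 him
    exact ⟨j, rfl, (hu.inr_vertexEdge_mem_iff h _).2 ⟨j, rfl, hi⟩⟩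
  · rintro ⟨j, rfl, hj⟩
    obtain ⟨j', h1, h2⟩ := (hu.inr_vertexEdge_mem_iff h _).1 hj
    rw [Fin.succ_injective _ h1, h2]

theorem faceInv_range (hu : Γ.IsFacePath a v w u) : Γ.FaceInv a (fun x => ∃ i, u i = x) := by
  rintro h c rfl
  constructor
  · rintro ⟨i, hi⟩
    obtain ⟨j, -, hj⟩ := (hu.propagator_symm_mem_iff h i).1 hi
    exact ⟨j.succ, hj⟩
  · rintro ⟨i, hi⟩
    obtain ⟨j, -, hj⟩ := (hu.inr_vertexEdge_mem_iff h i).1 hi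
    exact ⟨j.castSucc, hj⟩

theorem onFace (hu : Γ.IsFacePath a v w u) (i : Fin (m + 1)) : Γ.OnFace v a (u i) := by
  intro f hf
  induction i using Fin.induction with
  | zero => rw [hu.zero]
  | succ i ih =>
    obtain ⟨h, h1, h2⟩ := hu.step i
    rw [ih, h2, ← hf h a rfl, ← h1]
    simp

theorem onFace_iff (hu : Γ.IsFacePath a v w u) (x : W ⊕ V × Bool) :
    Γ.OnFace v a x ↔ ∃ i, u i = x := by
  constructor
  · intro h
    exact (h _ hu.faceInv_range).1 ⟨0, hu.zero⟩
  · rintro ⟨i, rfl⟩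
    exact hu.onFace i

theorem onFace_inl_iff (hu : Γ.IsFacePath a v w u) (v' : W) :
    Γ.OnFace v a (Sum.inl v') ↔ v = v' := by
  rw [hu.onFace_iff]
  constructor
  · rintro ⟨i, hi⟩
    rcases Fin.eq_zero_or_eq_succ i with rfl | ⟨j, rfl⟩
    · rw [hu.zero] at hi
      simpa using hi
    · obtain ⟨h, -, h2⟩ := hu.step j
      rw [h2] at hi
      simp at hi
  · rintro rfl
    exact ⟨0, hu.zero⟩

theorem onFace_symm_inl_iff (hu : Γ.IsFacePath a v w u) (w' : K) :
    Γ.OnFace v a (Γ.propagator.symm (Sum.inl w')) ↔ w = w' := by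
  rw [hu.onFace_iff]
  constructor
  · rintro ⟨i, hi⟩
    rcases Fin.eq_castSucc_or_eq_last i with ⟨j, rfl⟩ | rfl
    · obtain ⟨h, h1, -⟩ := hu.step j
      rw [hi] at h1
      simp at h1
    · have := hu.last
      rw [hi] at this
      simpa using this.symm
  · rintro rfl
    exact ⟨Fin.last m, by rw [← hu.last]; simp⟩

end IsFacePath

theorem onFace_self (Γ : Diagram D W K V) (v : W) (a : Fin D) : Γ.OnFace v a (Sum.inl v) :=
  fun _ _ => Iff.rfl

theorem OnFace.eq [Finite W] [Finite V] {Γ : Diagram D W K V} {v v' : W} {a : Fin D}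
    {x : W ⊕ V × Bool} (h : Γ.OnFace v a x) (h' : Γ.OnFace v' a x) : v = v' := by
  obtain ⟨w, m, u, hu⟩ := Γ.exists_isFacePath a v
  exact (hu.onFace_inl_iff v').1 fun f hf => (h f hf).trans (h' f hf).symm

theorem faceInv_onFace (Γ : Diagram D W K V) (v : W) (a : Fin D) :
    Γ.FaceInv a (Γ.OnFace v a) := by
  rintro h c rfl
  exact forall_congr' fun f => forall_congr' fun hf => by rw [hf h c rfl]

section Boundary

variable [Finite W] [Finite K] [Finite V]

/-- Every diagram has a boundary graph. -/
theorem exists_hasBdry (Γ : Diagram D W K V) : ∃ B : ColouredGraph D W K, Γ.HasBdry B := by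
  choose e m u hu using fun a v => Γ.exists_isFacePath a v
  have hcard : Nat.card W = Nat.card K := by
    have := Nat.card_congr Γ.propagator
    rw [Nat.card_sum, Nat.card_sum] at this
    omega
  have hbij : ∀ a, Function.Bijective (e a) := by
    intro a
    refine (Nat.bijective_iff_injective_and_card _).2 ⟨fun v v' h => ?_, hcard⟩
    exact (((hu a v).onFace_symm_inl_iff _).2 rfl).eq (((hu a v').onFace_symm_inl_iff _).2 h.symm)
  refine ⟨⟨fun a => Equiv.ofBijective _ (hbij a)⟩, fun a v => ?_⟩
  exact ((hu a v).onFace_symm_inl_iff _).2 rfl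

/-- The boundary graph of a diagram. -/
noncomputable def bdry (Γ : Diagram D W K V) : ColouredGraph D W K := Γ.exists_hasBdry.choose

theorem hasBdry_bdry (Γ : Diagram D W K V) : Γ.HasBdry Γ.bdry := Γ.exists_hasBdry.choose_spec

theorem onFace_symm_inl_iff (Γ : Diagram D W K V) (v : W) (a : Fin D) (w : K) :
    Γ.OnFace v a (Γ.propagator.symm (Sum.inl w)) ↔ Γ.bdry.edge a v = w := by
  obtain ⟨w', m, u, hu⟩ := Γ.exists_isFacePath a v
  have := (hu.onFace_symm_inl_iff _).1 (Γ.hasBdry_bdry a v)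
  rw [hu.onFace_symm_inl_iff, this]

theorem hasBdry_iff {Γ : Diagram D W K V} {B : ColouredGraph D W K} :
    Γ.HasBdry B ↔ Γ.bdry = B := by
  constructor
  · intro h
    ext a v
    exact (Γ.onFace_symm_inl_iff v a _).1 (h a v)
  · rintro rfl
    exact Γ.hasBdry_bdry

end Boundary

theorem IsFlow.eq_of_onFace {Γ : Diagram D W K V} {p : W ⊕ V × Bool → Momentum I}
    (hp : Γ.IsFlow p) {v : W} {a : Fin D} {x : W ⊕ V × Bool} (h : Γ.OnFace v a x) :
    p x a = p (Sum.inl v) a := by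
  refine (h (fun y => p y a = p (Sum.inl v) a) ?_).1 rfl
  rintro h' c rfl
  dsimp only
  rw [hp h' c]

/-- Along every external face the momentum coordinate is transported from one leg to the other. -/
theorem HasBdry.flow_eq {Γ : Diagram D W K V} {B : ColouredGraph D W K} (hB : Γ.HasBdry B)
    {p : W ⊕ V × Bool → Momentum I} (hp : Γ.IsFlow p) (w : K) :
    p (Γ.propagator.symm (Sum.inl w)) = B.target (fun v => p (Sum.inl v)) w := by
  funext a
  have := hp.eq_of_onFace (hB a ((B.edge a).symm w))
  simpa [ColouredGraph.target] using this

/-! ### Amplitudes -/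

section Amplitude

variable [Fintype W] [Fintype V]

theorem sum_filter_and_prod {A M : Type*} [Fintype A] [DecidableEq A] [Fintype M]
    (P : A → M → Prop) [∀ u m, Decidable (P u m)] (Q : (A → M) → Prop) [DecidablePred Q]
    (G : A → M → ℝ) :
    ∑ p ∈ (Finset.univ : Finset (A → M)).filter (fun p => (∀ u, P u (p u)) ∧ Q p),
      ∏ u, G u (p u) =
    ∑ p ∈ (Finset.univ : Finset (A → M)).filter Q,
      ∏ u, (if P u (p u) then 1 else 0) * G u (p u) := by
  simp_rw [Finset.sum_filter, ite_mul, one_mul, zero_mul]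
  refine Finset.sum_congr rfl fun p _ => ?_
  by_cases hQ : Q p
  · rw [if_pos hQ, Finset.prod_ite_zero]
    simp [hQ]
  · simp [hQ]

open Classical in
/-- The sum over the momentum flows `p` with external momenta `X` of the product of the propagators
`1 / (E_p + shift)`, where `shift` is the sum of the `δ v a` over the external faces `(v, a)` that
contain the propagator. -/
noncomputable def amplitude (Γ : Diagram D W K V) (E : Momentum I → ℝ) (X : W → Momentum I)
    (δ : W → Fin D → ℝ) : ℝ :=
  ∑ p ∈ (Finset.univ : Finset (W ⊕ V × Bool → Momentum I)).filter
      (fun p => (∀ v, p (Sum.inl v) = X v) ∧ Γ.IsFlow p),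
    ∏ u, (E (p u) + ∑ v, ∑ a, if Γ.OnFace v a u then δ v a else 0)⁻¹

open Classical in
theorem amplitude_eq_wsum (Γ : Diagram D W K V) (E : Momentum I → ℝ) (X : W → Momentum I)
    (δ : W → Fin D → ℝ) :
    Γ.amplitude E X δ = Γ.wsum fun u m => (if ∀ v, u = Sum.inl v → m = X v then 1 else 0) *
      (E m + ∑ v, ∑ a, if Γ.OnFace v a u then δ v a else 0)⁻¹ := by
  refine Eq.trans ?_ (sum_filter_and_prod (fun u m => ∀ v, u = Sum.inl v → m = X v) Γ.IsFlow
    (fun u m => (E m + ∑ v, ∑ a, if Γ.OnFace v a u then δ v a else 0)⁻¹))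
  rw [amplitude]
  refine Finset.sum_congr (Finset.filter_congr fun p _ => and_congr_left fun _ => ?_)
    fun _ _ => rfl
  constructor
  · rintro h _ v rfl
    exact h v
  · intro h v
    exact h _ v rfl

end Amplitude

end Diagram

/-! ### Comparison with the Feynman graphs of a given order -/

theorem ite_eq_ite_of_iff {α : Type*} {p q : Prop} {hp : Decidable p} {hq : Decidable q}
    (h : p ↔ q) (x y : α) : @ite α p hp x y = @ite α q hq x y := by
  by_cases hx : q
  · rw [if_pos hx, if_pos (h.2 hx)]
  · rw [if_neg hx, if_neg (mt h.1 hx)]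

/-- Reachability as invariance of properties: every predicate that is constant along the edges takes
the same value at `x` and `y`. -/
theorem SimpleGraph.fromRel_reachable_iff {X : Type*} (r : X → X → Prop) (x y : X) :
    (SimpleGraph.fromRel r).Reachable x y ↔
      ∀ f : X → Prop, (∀ x y, r x y → (f x ↔ f y)) → (f x ↔ f y) := by
  constructor
  · rintro ⟨p⟩ f hf
    induction p with
    | nil => rfl
    | cons h _ ih =>
      rw [SimpleGraph.fromRel_adj] at h
      rcases h.2 with h | h
      · exact (hf _ _ h).trans ih
      · exact (hf _ _ h).symm.trans ih
  · intro h
    refine (h (fun z => (SimpleGraph.fromRel r).Reachable x z) ?_).1 (SimpleGraph.Reachable.refl x)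
    intro a b hab
    by_cases hne : a = b
    · rw [hne]
    · have hadj : (SimpleGraph.fromRel r).Adj a b := by
        rw [SimpleGraph.fromRel_adj]
        exact ⟨hne, Or.inl hab⟩
      exact ⟨fun h => h.trans hadj.reachable, fun h => h.trans hadj.symm.reachable⟩

theorem ColouredGraph.Connected.forall_or {D : ℕ} {W K : Type} {B : ColouredGraph D W K}
    (hB : B.Connected) {f : W → Prop} {g : K → Prop} (h : ∀ a v, f v ↔ g (B.edge a v)) :
    ((∀ v, f v) ∧ ∀ w, g w) ∨ ((∀ v, ¬ f v) ∧ ∀ w, ¬ g w) := by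
  have key : ∀ x y, Sum.elim f g x ↔ Sum.elim f g y := fun x y =>
    (SimpleGraph.fromRel_reachable_iff _ x y).1 (hB.preconnected x y) _ (by
      rintro _ _ ⟨a, v, rfl, rfl⟩
      exact h a v)
  obtain ⟨x⟩ := hB.nonempty
  by_cases hx : Sum.elim f g x
  · exact Or.inl ⟨fun v => (key x (Sum.inl v)).1 hx, fun w => (key x (Sum.inr w)).1 hx⟩
  · exact Or.inr ⟨fun v hv => hx ((key x (Sum.inl v)).2 hv),
      fun w hw => hx ((key x (Sum.inr w)).2 hw)⟩

namespace FeynmanGraph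

variable {D : ℕ} {W K : Type} {n : ℕ} {I : Fin D → Finset ℤ}

/-- Feynman graphs of order `n` are the diagrams with vertices labelled by `Fin n`. -/
def equivDiagram : FeynmanGraph D W K n ≃ Diagram D W K (Fin n) where
  toFun Γ := ⟨Γ.colour, Γ.propagator⟩
  invFun Γ := ⟨Γ.colour, Γ.propagator⟩
  left_inv _ := rfl
  right_inv _ := rfl

theorem onFace_equivDiagram_iff (Γ : FeynmanGraph D W K n) (v : W) (a : Fin D)
    (u : W ⊕ Fin n × Bool) :
    (equivDiagram Γ).OnFace v a u ↔ Γ.OnExternalFace v a u := by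
  rw [OnExternalFace, faceGraph, SimpleGraph.fromRel_reachable_iff]
  constructor
  · intro h F hF
    refine h (fun u => F (Sum.inl u)) ?_
    rintro h' c rfl
    have h1 := hF _ _ (Or.inl ⟨Γ.propagator.symm (Sum.inr h'), rfl, rfl⟩)
    have h2 := hF _ _ (Or.inr ⟨h', rfl, rfl⟩)
    rw [Equiv.apply_symm_apply] at h1
    exact h1.trans h2
  · intro h f hf
    refine h (Sum.elim f (fun x => f (Γ.propagator.symm x))) ?_
    rintro x y (⟨u, rfl, rfl⟩ | ⟨h', rfl, rfl⟩)
    · simp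
    · exact hf h' a rfl

theorem hasBdry_equivDiagram_iff (Γ : FeynmanGraph D W K n) (B : ColouredGraph D W K) :
    (equivDiagram Γ).HasBdry B ↔ Γ.HasBoundary B := by
  refine forall_congr' fun a => forall_congr' fun v => ?_
  rw [onFace_equivDiagram_iff, OnExternalFace]
  have hadj : (Γ.faceGraph a).Adj
      (Sum.inl (Γ.propagator.symm (Sum.inl (B.edge a v)))) (Sum.inr (Sum.inl (B.edge a v))) := by
    rw [faceGraph, SimpleGraph.fromRel_adj]
    exact ⟨by simp, Or.inl (Or.inl ⟨_, rfl, by simp⟩)⟩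
  exact ⟨fun h => h.trans hadj.reachable, fun h => h.trans hadj.symm.reachable⟩

/-- At least two colours are needed: a vertex of a model with one colour would not join its four
fields. -/
theorem conn_equivDiagram_iff (hD : 2 ≤ D) (Γ : FeynmanGraph D W K n) :
    (equivDiagram Γ).Conn ↔ Γ.Connected := by
  have hne : (Nonempty W ∨ Nonempty K ∨ Nonempty (Fin n)) ↔
      Nonempty ((W ⊕ Fin n × Bool) ⊕ (K ⊕ Fin n × Bool)) := by
    simp only [nonempty_sum, nonempty_prod, Nonempty.intro true, and_true]
    tauto
  rw [Connected, SimpleGraph.connected_iff, Diagram.Conn, hne, and_comm]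
  refine and_congr_left fun hnon => ?_
  unfold SimpleGraph.Preconnected
  simp only [SimpleGraph.fromRel_reachable_iff]
  constructor
  · intro H x y F hF
    -- the four fields of a vertex are joined by its edges, since there are two different colours
    have hprop : ∀ u, F (Sum.inl u) ↔ F (Sum.inr (Γ.propagator u)) := fun u =>
      hF _ _ (Or.inl ⟨u, rfl, rfl⟩)
    have hedge : ∀ (i : Fin n) (ε ε' : Bool),
        F (Sum.inr (Sum.inr (i, ε))) ↔ F (Sum.inl (Sum.inr (i, ε'))) := by
      intro i ε ε'
      by_cases hε : ε = ε'
      · subst hε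
        obtain ⟨a, ha⟩ : ∃ a : Fin D, a ≠ Γ.colour i := by
          have : Nontrivial (Fin D) := Fin.nontrivial_iff_two_le.2 hD
          exact exists_ne _
        have := hF _ _ (Or.inr ⟨a, (i, ε), rfl, rfl⟩)
        simpa [vertexEdge, ha] using this
      · have := hF _ _ (Or.inr ⟨Γ.colour i, (i, ε), rfl, rfl⟩)
        rw [vertexEdge, if_pos rfl, Bool.not_eq.2 hε] at this
        exact this
    have hsplit := H (fun w => F (Sum.inl (Sum.inl w))) (fun k => F (Sum.inr (Sum.inl k)))
      (fun i => F (Sum.inl (Sum.inr (i, true)))) (by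
        intro u
        have h1 := hprop u
        have h2 : ∀ u : W ⊕ Fin n × Bool, Sum.elim (fun w => F (Sum.inl (Sum.inl w)))
            (fun x => F (Sum.inl (Sum.inr (x.1, true)))) u ↔ F (Sum.inl u) := by
          rintro (u | ⟨i, ε⟩)
          · rfl
          · exact (hedge i true true).symm.trans (hedge i true ε)
        have h3 : ∀ u : K ⊕ Fin n × Bool, Sum.elim (fun w => F (Sum.inr (Sum.inl w)))
            (fun x => F (Sum.inl (Sum.inr (x.1, true)))) u ↔ F (Sum.inr u) := by
          rintro (u | ⟨i, ε⟩)
          · rfl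
          · exact (hedge i ε true).symm
        rw [h2]
        exact h1.trans (h3 _).symm)
    rcases hsplit with ⟨h1, h2, h3⟩ | ⟨h1, h2, h3⟩
    · have hall : ∀ x, F x := by
        rintro ((x | ⟨i, ε⟩) | (x | ⟨i, ε⟩))
        · exact h1 x
        · exact ((hedge i true true).symm.trans (hedge i true ε)).1 (h3 i)
        · exact h2 x
        · exact (hedge i ε true).2 (h3 i)
      exact iff_of_true (hall x) (hall y)
    · have hall : ∀ x, ¬ F x := by
        rintro ((x | ⟨i, ε⟩) | (x | ⟨i, ε⟩))
        · exact h1 x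
        · exact fun h => h3 i (((hedge i true true).symm.trans (hedge i true ε)).2 h)
        · exact h2 x
        · exact fun h => h3 i ((hedge i ε true).1 h)
      exact iff_of_false (hall x) (hall y)
  · intro H f g h hs
    have key := fun x y => H x y (Sum.elim (Sum.elim f fun x => h x.1) (Sum.elim g fun x => h x.1))
      (by
        rintro x y (⟨u, rfl, rfl⟩ | ⟨a, h', rfl, rfl⟩)
        · exact hs u
        · rfl)
    obtain ⟨x⟩ := hnon
    by_cases hx : (Sum.elim (Sum.elim f fun x => h x.1) (Sum.elim g fun x => h x.1)) x
    · refine Or.inl ⟨fun w => ?_, fun k => ?_, fun v => ?_⟩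
      · exact (key x (Sum.inl (Sum.inl w))).1 hx
      · exact (key x (Sum.inr (Sum.inl k))).1 hx
      · exact (key x (Sum.inl (Sum.inr (v, true)))).1 hx
    · refine Or.inr ⟨fun w hw => hx ?_, fun k hk => hx ?_, fun v hv => hx ?_⟩
      · exact (key x (Sum.inl (Sum.inl w))).2 hw
      · exact (key x (Sum.inr (Sum.inl k))).2 hk
      · exact (key x (Sum.inl (Sum.inr (v, true)))).2 hv

theorem amplitude_equivDiagram [Fintype W] [DecidableEq W] (Γ : FeynmanGraph D W K n)
    (E : Momentum I → ℝ) (X : W → Momentum I) (δ : W → Fin D → ℝ) :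
    (equivDiagram Γ).amplitude E X δ = Γ.amplitude E X δ := by
  unfold amplitude Diagram.amplitude
  refine Finset.sum_congr ?_ fun p _ => ?_
  · ext p
    simp only [Finset.mem_filter, Finset.mem_univ, true_and]
    rfl
  · refine Finset.prod_congr rfl fun u _ => ?_
    congr 2
    refine Finset.sum_congr rfl fun v _ => Finset.sum_congr rfl fun a _ => ?_
    exact ite_eq_ite_of_iff (onFace_equivDiagram_iff Γ v a u) _ _

end FeynmanGraph

/-! ### Sums over diagrams -/

/-- The power series in the coupling with the weight `(-λ)^n / n!` at order `n`. -/
noncomputable def expSeries (c : ℕ → ℝ) : ℝ⟦X⟧ :=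
  PowerSeries.mk fun n => ((-1 : ℝ) ^ n / n.factorial) * c n

theorem expSeries_mul (a b : ℕ → ℝ) :
    expSeries a * expSeries b =
      expSeries fun n => ∑ U : Finset (Fin n), a U.card * b (n - U.card) := by
  ext n
  rw [PowerSeries.coeff_mul]
  simp only [expSeries, PowerSeries.coeff_mk]
  rw [← Finset.powerset_univ, Finset.sum_powerset_apply_card (fun m => a m * b (n - m)),
    Finset.card_univ, Fintype.card_fin, Finset.mul_sum,
    Finset.Nat.sum_antidiagonal_eq_sum_range_succ
      (fun i j => (-1 : ℝ) ^ i / i.factorial * a i * ((-1 : ℝ) ^ j / j.factorial * b j))]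
  refine Finset.sum_congr rfl fun m hm => ?_
  have hm' : m ≤ n := by simpa [Nat.lt_succ_iff] using hm
  rw [nsmul_eq_mul, Nat.cast_choose ℝ hm']
  have h1 : (-1 : ℝ) ^ n = (-1) ^ m * (-1) ^ (n - m) := by rw [← pow_add]; congr 1; omega
  have h2 : (n.factorial : ℝ) ≠ 0 := by exact_mod_cast n.factorial_ne_zero
  have h3 : (m.factorial : ℝ) ≠ 0 := by exact_mod_cast m.factorial_ne_zero
  have h4 : ((n - m).factorial : ℝ) ≠ 0 := by exact_mod_cast (n - m).factorial_ne_zero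
  rw [h1]
  field_simp

namespace Diagram

variable {D : ℕ} {W K V W' K' V' : Type} {I : Fin D → Finset ℤ}

theorem relabel_amplitude [Fintype W] [Fintype V] [Fintype W'] [Fintype V'] (eW : W ≃ W')
    (eK : K ≃ K') (eV : V ≃ V') (Γ : Diagram D W K V) (E : Momentum I → ℝ)
    (X : W' → Momentum I) (δ : W' → Fin D → ℝ) :
    (Γ.relabel eW eK eV).amplitude E X δ = Γ.amplitude E (X ∘ eW) (δ ∘ eW) := by
  rw [amplitude_eq_wsum, amplitude_eq_wsum, relabel_wsum]
  congr 1
  funext u m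
  congr 1
  · have hiff : (∀ v, halfEquiv eW eV u = Sum.inl v → m = X v) ↔
        ∀ v, u = Sum.inl v → m = (X ∘ eW) v := by
      rw [← eW.forall_congr_right]
      refine forall_congr' fun v => ?_
      rw [← halfEquiv_inl eW eV, (halfEquiv eW eV).apply_eq_iff_eq]
      rfl
    exact ite_eq_ite_of_iff hiff _ _
  · congr 2
    rw [← eW.sum_comp]
    refine Finset.sum_congr rfl fun v _ => Finset.sum_congr rfl fun a _ => ?_
    exact ite_eq_ite_of_iff (relabel_onFace eW eK eV Γ v a u) _ _

variable [Fintype W] [Fintype K] [Fintype V] [Fintype W'] [Fintype K'] [Fintype V']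

open Classical in
/-- The sum of the amplitudes of the diagrams with property `P` and with boundary `B`. -/
noncomputable def bdrySum (P : Diagram D W K V → Prop) (E : Momentum I → ℝ)
    (B : ColouredGraph D W K) (X : W → Momentum I) (δ : W → Fin D → ℝ) : ℝ :=
  ∑ Γ ∈ (Finset.univ : Finset (Diagram D W K V)).filter (fun Γ => P Γ ∧ Γ.HasBdry B),
    Γ.amplitude E X δ

theorem bdrySum_relabel (eW : W ≃ W') (eK : K ≃ K') (eV : V ≃ V') {P : Diagram D W K V → Prop}
    {P' : Diagram D W' K' V' → Prop} (hP : ∀ Γ, P' (relabel eW eK eV Γ) ↔ P Γ)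
    (E : Momentum I → ℝ) (B : ColouredGraph D W' K') (X : W' → Momentum I)
    (δ : W' → Fin D → ℝ) :
    bdrySum P E ⟨fun a => eW.trans ((B.edge a).trans eK.symm)⟩ (X ∘ eW) (δ ∘ eW) =
      bdrySum P' E B X δ := by
  classical
  unfold bdrySum
  refine Finset.sum_equiv (relabelEquiv eW eK eV) ?_ ?_
  · intro Γ
    simp only [Finset.mem_filter, Finset.mem_univ, true_and]
    exact and_congr (hP Γ).symm (relabel_hasBdry eW eK eV Γ B).symm
  · intro Γ _
    exact (relabel_amplitude eW eK eV Γ E X δ).symm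

/-- Sums over diagrams only depend on the number of vertices. -/
theorem bdrySum_vertices (eV : V ≃ V') {P : Diagram D W K V → Prop}
    {P' : Diagram D W K V' → Prop}
    (hP : ∀ Γ, P' (relabel (Equiv.refl W) (Equiv.refl K) eV Γ) ↔ P Γ)
    (E : Momentum I → ℝ) (B : ColouredGraph D W K) (X : W → Momentum I) (δ : W → Fin D → ℝ) :
    bdrySum P E B X δ = bdrySum P' E B X δ :=
  bdrySum_relabel (Equiv.refl W) (Equiv.refl K) eV hP E B X δ

end Diagram

section

variable {D : ℕ} {W K W' K' : Type} {I : Fin D → Finset ℤ}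
variable [Fintype W] [Fintype K] [Fintype W'] [Fintype K']

theorem corrShift_eq_expSeries [DecidableEq W] (hD : 2 ≤ D) (E : Momentum I → ℝ)
    (B : ColouredGraph D W K) (X : W → Momentum I) (δ : W → Fin D → ℝ) :
    corrShift E B X δ =
      expSeries fun n => Diagram.bdrySum (V := Fin n) Diagram.Conn E B X δ := by
  classical
  unfold corrShift expSeries
  congr 1
  funext n
  congr 1
  refine Finset.sum_equiv FeynmanGraph.equivDiagram ?_ ?_
  · intro Γ
    simp [FeynmanGraph.conn_equivDiagram_iff hD, FeynmanGraph.hasBdry_equivDiagram_iff]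
  · intro Γ _
    exact (FeynmanGraph.amplitude_equivDiagram Γ E X δ).symm

theorem partitionCorrShift_eq_expSeries [DecidableEq W] (E : Momentum I → ℝ)
    (B : ColouredGraph D W K) (X : W → Momentum I) (δ : W → Fin D → ℝ) :
    partitionCorrShift E B X δ = (vacuum E)⁻¹ *
      expSeries fun n => Diagram.bdrySum (V := Fin n) (fun _ => True) E B X δ := by
  classical
  unfold partitionCorrShift expSeries
  congr 2
  funext n
  congr 1
  refine Finset.sum_equiv FeynmanGraph.equivDiagram ?_ ?_
  · intro Γ
    simp [FeynmanGraph.hasBdry_equivDiagram_iff]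
  · intro Γ _
    exact (FeynmanGraph.amplitude_equivDiagram Γ E X δ).symm

/-- Correlation functions do not depend on the labels of the external legs. -/
theorem corr_relabel [DecidableEq W] [DecidableEq W'] (hD : 2 ≤ D) (eW : W ≃ W') (eK : K ≃ K')
    (E : Momentum I → ℝ) (B : ColouredGraph D W' K') (X : W' → Momentum I) :
    corr E ⟨fun a => eW.trans ((B.edge a).trans eK.symm)⟩ (X ∘ eW) = corr E B X := by
  unfold corr
  rw [corrShift_eq_expSeries hD, corrShift_eq_expSeries hD]
  congr 1
  funext n
  exact Diagram.bdrySum_relabel eW eK (Equiv.refl _)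
    (fun Γ => Diagram.relabel_conn eW eK (Equiv.refl _) Γ) E B X 0

end

/-! ### The Feynman expansion of the partition function -/

section FeynmanExpansion

open MvPowerSeries

variable {D : ℕ} {I : Fin D → Finset ℤ}

/-- The variables by which the vertex operator of colour `t.1` with momenta `t.2` differentiates:
`Sum.inl ε` are the fields `φ̄`, `Sum.inr ε` the fields `φ`. -/
def vertexVar (t : Fin D × Momentum I × Momentum I) : Bool ⊕ Bool → Momentum I ⊕ Momentum I
  | Sum.inl false => Sum.inl t.2.1
  | Sum.inl true => Sum.inl t.2.2
  | Sum.inr false => Sum.inr (Function.update t.2.1 t.1 (t.2.2 t.1))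
  | Sum.inr true => Sum.inr (Function.update t.2.2 t.1 (t.2.1 t.1))

/-- A vertex operator attaches four more derivatives, by the variables of its four fields. -/
theorem multiDeriv_interactionOp {L : Type*} [Fintype L] (g : L → Momentum I ⊕ Momentum I)
    (F : MvPowerSeries (Momentum I ⊕ Momentum I) ℝ) :
    multiDeriv g Finset.univ (interactionOp F) =
      ∑ t : Fin D × Momentum I × Momentum I,
        multiDeriv (Sum.elim g (vertexVar t)) Finset.univ F := by
  classical
  have huniv : (Finset.univ : Finset (L ⊕ (Bool ⊕ Bool))) =
      insert (Sum.inr (Sum.inr true)) (insert (Sum.inr (Sum.inr false))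
        (insert (Sum.inr (Sum.inl true)) (insert (Sum.inr (Sum.inl false))
          (Finset.univ.map Function.Embedding.inl)))) := by
    ext x
    rcases x with x | (_ | _) | (_ | _) <;> simp
  simp only [interactionOp, multiDeriv_sum, Fintype.sum_prod_type]
  refine Finset.sum_congr rfl fun c _ => Finset.sum_congr rfl fun b _ =>
    Finset.sum_congr rfl fun b' _ => ?_
  rw [huniv, multiDeriv_insert _ (by simp), multiDeriv_insert _ (by simp),
    multiDeriv_insert _ (by simp), multiDeriv_insert _ (by simp), multiDeriv_map]
  rfl

theorem multiDeriv_interactionOp_iterate {L : Type*} [Fintype L]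
    (g : L → Momentum I ⊕ Momentum I) (n : ℕ)
    (F : MvPowerSeries (Momentum I ⊕ Momentum I) ℝ) :
    multiDeriv g Finset.univ (interactionOp^[n] F) =
      ∑ t : Fin n → Fin D × Momentum I × Momentum I,
        multiDeriv (Sum.elim g fun x : Fin n × (Bool ⊕ Bool) => vertexVar (t x.1) x.2)
          Finset.univ F := by
  induction n generalizing F with
  | zero =>
    rw [Fintype.sum_unique, Function.iterate_zero, id]
    refine (multiDeriv_univ_equiv (Equiv.sumEmpty L (Fin 0 × (Bool ⊕ Bool))) g F).trans ?_
    congr 1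
    funext x
    rcases x with x | ⟨i, -⟩
    · rfl
    · exact i.elim0
  | succ n ih =>
    rw [Function.iterate_succ_apply, ih, ← (Fin.consEquiv fun _ => _).sum_comp,
      Fintype.sum_prod_type_right]
    refine Finset.sum_congr rfl fun t _ => ?_
    rw [multiDeriv_interactionOp]
    refine Finset.sum_congr rfl fun t₀ _ => ?_
    let e : (L ⊕ Fin n × (Bool ⊕ Bool)) ⊕ (Bool ⊕ Bool) ≃ L ⊕ Fin (n + 1) × (Bool ⊕ Bool) :=
      { toFun := Sum.elim (Sum.elim Sum.inl fun x => Sum.inr (x.1.succ, x.2))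
          fun x => Sum.inr (0, x)
        invFun := Sum.elim (fun l => Sum.inl (Sum.inl l)) fun x =>
          Fin.cases (motive := fun _ => (L ⊕ Fin n × (Bool ⊕ Bool)) ⊕ (Bool ⊕ Bool))
            (Sum.inr x.2) (fun i => Sum.inl (Sum.inr (i, x.2))) x.1
        left_inv := by rintro ((x | ⟨i, x⟩) | x) <;> simp
        right_inv := by
          rintro (x | ⟨i, x⟩)
          · simp
          · cases i using Fin.cases <;> simp }
    rw [multiDeriv_univ_equiv e]
    congr 1
    funext x
    rcases x with (x | ⟨i, x⟩) | x <;> rfl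

namespace Diagram

variable {W K V : Type}

open Classical in
/-- The weight of the propagator `u` with momentum `m`, if the momenta of the legs are prescribed
by `X` and `Y`. -/
noncomputable def legWeight (Γ : Diagram D W K V) (E : Momentum I → ℝ) (X : W → Momentum I)
    (Y : K → Momentum I) (u : W ⊕ V × Bool) (m : Momentum I) : ℝ :=
  (if (∀ v, u = Sum.inl v → m = X v) ∧ ∀ w, Γ.propagator u = Sum.inl w → m = Y w then 1 else 0) *
    (E m)⁻¹

/-- The amplitude of a diagram with momenta `X` and `Y` of its legs. -/
noncomputable def weight [Fintype W] [Fintype V] (Γ : Diagram D W K V) (E : Momentum I → ℝ)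
    (X : W → Momentum I) (Y : K → Momentum I) : ℝ :=
  Γ.wsum (Γ.legWeight E X Y)

open Classical in
theorem sum_pairing_eq_weight [Fintype W] [Fintype V] (Γ : Diagram D W K V) (E : Momentum I → ℝ)
    (X : W → Momentum I) (Y : K → Momentum I) :
    ∑ p : V × Bool → Momentum I, ∏ u, (if Sum.elim X p u = Sum.elim Y (fun h =>
        Function.update (p h) (Γ.colour h.1) (p (h.1, !h.2) (Γ.colour h.1))) (Γ.propagator u)
      then (E (Sum.elim X p u))⁻¹ else 0) = Γ.weight E X Y := by
  rw [weight, wsum]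
  unfold legWeight
  refine Eq.trans ?_ ((sum_filter_and_prod (fun u m => (∀ v, u = Sum.inl v → m = X v) ∧
    ∀ w, Γ.propagator u = Sum.inl w → m = Y w) Γ.IsFlow (fun _ m => (E m)⁻¹)).trans
    (Finset.sum_congr rfl fun p _ => Finset.prod_congr rfl fun u _ =>
      congrArg (· * _) (ite_eq_ite_of_iff Iff.rfl _ _)))
  have hprod : ∀ p : V × Bool → Momentum I, ∏ u, (if Sum.elim X p u = Sum.elim Y (fun h =>
      Function.update (p h) (Γ.colour h.1) (p (h.1, !h.2) (Γ.colour h.1))) (Γ.propagator u)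
      then (E (Sum.elim X p u))⁻¹ else 0) = if ∀ u, Sum.elim X p u = Sum.elim Y (fun h =>
      Function.update (p h) (Γ.colour h.1) (p (h.1, !h.2) (Γ.colour h.1))) (Γ.propagator u)
      then ∏ u, (E (Sum.elim X p u))⁻¹ else 0 := fun p => by
    rw [Finset.prod_ite_zero]
    exact ite_eq_ite_of_iff (by simp) _ _
  rw [Finset.sum_congr rfl fun p _ => hprod p, ← Finset.sum_filter]
  refine Finset.sum_bij (fun p _ => Sum.elim X p) ?_ ?_ ?_ ?_
  · intro p hp
    simp only [Finset.mem_filter, Finset.mem_univ, true_and] at hp ⊢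
    refine ⟨fun u => ⟨?_, ?_⟩, fun h a => ?_⟩
    · rintro v rfl
      rfl
    · intro w hw
      rw [hp u, hw]
      rfl
    · have := hp (Γ.propagator.symm (Sum.inr h))
      beta_reduce
      rw [this]
      simp only [Equiv.apply_symm_apply, Sum.elim_inr, vertexEdge]
      by_cases ha : a = Γ.colour h.1
      · subst ha; simp
      · simp [ha]
  · intro p _ p' _ h
    funext x
    simpa using congrFun h (Sum.inr x)
  · intro q hq
    simp only [Finset.mem_filter, Finset.mem_univ, true_and] at hq
    have hq' : Sum.elim X (fun x => q (Sum.inr x)) = q := by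
      funext u
      rcases u with u | u
      · exact ((hq.1 (Sum.inl u)).1 u rfl).symm
      · rfl
    refine ⟨fun x => q (Sum.inr x), ?_, hq'⟩
    simp only [Finset.mem_filter, Finset.mem_univ, true_and]
    intro u
    rw [hq']
    rcases hu : Γ.propagator u with w | h
    · exact (hq.1 u).2 w hu
    · obtain rfl : u = Γ.propagator.symm (Sum.inr h) := by rw [← hu]; simp
      funext a
      have hflow := hq.2 h a
      beta_reduce at hflow
      rw [hflow]
      simp only [Sum.elim_inr, vertexEdge]
      by_cases ha : a = Γ.colour h.1
      · subst ha; simp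
      · simp [ha]
  · intro p _
    rfl

end Diagram

/-- The Feynman expansion: the derivatives of the partition function are the sums of the weights
of all diagrams. -/
theorem sourceDeriv_partitionFunction {W K : Type} [Fintype W] [Fintype K] (E : Momentum I → ℝ)
    (X : W → Momentum I) (Y : K → Momentum I) :
    sourceDeriv (partitionFunction E) X Y =
      expSeries fun n => ∑ Γ : Diagram D W K (Fin n), Γ.weight E X Y := by
  classical
  have hsource : ∀ n, PowerSeries.coeff n (sourceDeriv (partitionFunction E) X Y) =
      (-1 : ℝ) ^ n / n.factorial * multiDeriv (Sum.elim (Sum.inl ∘ X) (Sum.inr ∘ Y))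
        Finset.univ (interactionOp^[n] (freePartition E)) := by
    intro n
    unfold sourceDeriv multiDeriv factorialProd
    simp only [Fintype.sum_sum_type, Sum.elim_inl, Sum.elim_inr, Function.comp_apply]
    set m : Momentum I ⊕ Momentum I →₀ ℕ :=
      ∑ v, Finsupp.single (Sum.inl (X v)) 1 + ∑ w, Finsupp.single (Sum.inr (Y w)) 1
    have h1 : (m.prod fun _ j => (j.factorial : ℝ⟦X⟧)) =
        PowerSeries.C (m.prod fun _ j => (j.factorial : ℝ)) := by
      simp [Finsupp.prod]
    rw [h1, PowerSeries.coeff_C_mul]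
    have h2 : PowerSeries.coeff n (MvPowerSeries.coeff m (partitionFunction E)) =
        (-1 : ℝ) ^ n / n.factorial *
          MvPowerSeries.coeff m (interactionOp^[n] (freePartition E)) := by
      change PowerSeries.coeff n (partitionFunction E m) = _
      simp [partitionFunction]
    rw [h2]
    ring
  ext n
  rw [hsource, expSeries, PowerSeries.coeff_mk, multiDeriv_interactionOp_iterate]
  congr 1
  let e : (W ⊕ Fin n × Bool) ⊕ (K ⊕ Fin n × Bool) ≃ (W ⊕ K) ⊕ Fin n × (Bool ⊕ Bool) :=
    (Equiv.sumSumSumComm _ _ _ _).trans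
      (Equiv.sumCongr (Equiv.refl _) (Equiv.prodSumDistrib _ _ _).symm)
  let toDiagram : (Fin n → Fin D) × ((W ⊕ Fin n × Bool) ≃ (K ⊕ Fin n × Bool)) ≃
      Diagram D W K (Fin n) :=
    { toFun := fun x => ⟨x.1, x.2⟩
      invFun := fun Γ => (Γ.colour, Γ.propagator)
      left_inv := fun _ => rfl
      right_inv := fun _ => rfl }
  let momenta : (Fin n → Fin D) × (Fin n × Bool → Momentum I) ≃
      (Fin n → Fin D × Momentum I × Momentum I) :=
    { toFun := fun x i => (x.1 i, x.2 (i, false), x.2 (i, true))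
      invFun := fun t => (fun i => (t i).1, fun h => cond h.2 (t h.1).2.2 (t h.1).2.1)
      left_inv := by
        rintro ⟨c, p⟩
        refine Prod.ext rfl (funext ?_)
        rintro ⟨i, _ | _⟩ <;> rfl
      right_inv := fun _ => rfl }
  rw [← toDiagram.sum_comp, ← momenta.sum_comp, Fintype.sum_prod_type, Fintype.sum_prod_type]
  refine Finset.sum_congr rfl fun c _ => ?_
  simp only [← Diagram.sum_pairing_eq_weight]
  rw [Finset.sum_comm]
  refine Finset.sum_equiv (Equiv.refl _) (by simp) fun p _ => ?_
  rw [Equiv.refl_apply, multiDeriv_univ_equiv e]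
  have hvar : (Sum.elim (Sum.elim (Sum.inl ∘ X) (Sum.inr ∘ Y)) fun x : Fin n × (Bool ⊕ Bool) =>
      vertexVar (momenta (c, p) x.1) x.2) ∘ e = Sum.elim (Sum.inl ∘ Sum.elim X p)
        (Sum.inr ∘ Sum.elim Y
          (fun h => Function.update (p h) (c h.1) (p (h.1, !h.2) (c h.1)))) := by
    funext x
    rcases x with (x | ⟨i, _ | _⟩) | (x | ⟨i, _ | _⟩) <;> rfl
  rw [hvar, multiDeriv_freePartition]
  exact Finset.sum_equiv (Equiv.refl _) (by simp) fun _ _ => rfl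

end FeynmanExpansion

/-! ### The linked cluster theorem -/

theorem expSeries_neg (c : ℕ → ℝ) : expSeries (fun n => -c n) = -expSeries c := by
  ext n
  simp [expSeries]

theorem expSeries_add (c d : ℕ → ℝ) :
    expSeries (fun n => c n + d n) = expSeries c + expSeries d := by
  ext n
  simp [expSeries, mul_add]

theorem expSeries_sum {ι : Type*} (s : Finset ι) (c : ι → ℕ → ℝ) :
    expSeries (fun n => ∑ i ∈ s, c i n) = ∑ i ∈ s, expSeries (c i) := by
  ext n
  simp [expSeries, Finset.mul_sum]

namespace Diagram

variable {D : ℕ} {W K V W' K' V' W₁ K₁ V₁ W₂ K₂ V₂ : Type} {I : Fin D → Finset ℤ}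

theorem union_weight [Fintype W] [Fintype V] [Fintype W₁] [Fintype V₁] [Fintype W₂] [Fintype V₂]
    (eW : W₁ ⊕ W₂ ≃ W) (eK : K₁ ⊕ K₂ ≃ K) (eV : V₁ ⊕ V₂ ≃ V)
    (Γ₁ : Diagram D W₁ K₁ V₁) (Γ₂ : Diagram D W₂ K₂ V₂) (E : Momentum I → ℝ)
    (X : W → Momentum I) (Y : K → Momentum I) :
    (union eW eK eV Γ₁ Γ₂).weight E X Y =
      Γ₁.weight E (fun w => X (eW (Sum.inl w))) (fun k => Y (eK (Sum.inl k))) *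
      Γ₂.weight E (fun w => X (eW (Sum.inr w))) (fun k => Y (eK (Sum.inr k))) := by
  rw [weight, union_wsum]
  congr 1
  · unfold weight
    congr 1
    funext u m
    unfold legWeight
    congr 1
    refine ite_eq_ite_of_iff (and_congr ?_ ?_) _ _
    · rw [← eW.forall_congr_right, Sum.forall]
      rcases u with u | u <;> simp
    · rw [← eK.forall_congr_right, Sum.forall, union_propagator_unionEquiv]
      rcases hu : Γ₁.propagator u with x | x <;> simp [hu]
  · unfold weight
    congr 1
    funext u m
    unfold legWeight
    congr 1
    refine ite_eq_ite_of_iff (and_congr ?_ ?_) _ _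
    · rw [← eW.forall_congr_right, Sum.forall]
      rcases u with u | u <;> simp
    · rw [← eK.forall_congr_right, Sum.forall, union_propagator_unionEquiv]
      rcases hu : Γ₂.propagator u with x | x <;> simp [hu]

theorem relabel_weight [Fintype W] [Fintype V] [Fintype W'] [Fintype V']
    (eW : W ≃ W') (eK : K ≃ K') (eV : V ≃ V') (Γ : Diagram D W K V) (E : Momentum I → ℝ)
    (X : W' → Momentum I) (Y : K' → Momentum I) :
    (relabel eW eK eV Γ).weight E X Y = Γ.weight E (X ∘ eW) (Y ∘ eK) := by
  rw [weight, relabel_wsum]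
  unfold weight
  congr 1
  funext u m
  unfold legWeight
  congr 1
  refine ite_eq_ite_of_iff (and_congr ?_ ?_) _ _
  · rw [← eW.forall_congr_right]
    rcases u with u | u <;> simp
  · rw [← eK.forall_congr_right]
    rcases hu : Γ.propagator u with x | x <;> simp [hu, relabel]

/-- The part of a disjoint union that contains the leg `l` is connected if and only if it is the
smallest union of components containing `l`. -/
theorem union_conn_iff (eW : W₁ ⊕ W₂ ≃ W) (eK : K₁ ⊕ K₂ ≃ K) (eV : V₁ ⊕ V₂ ≃ V)
    (Γ₁ : Diagram D W₁ K₁ V₁) (Γ₂ : Diagram D W₂ K₂ V₂) (l : W₁ ⊕ K₁) :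
    Γ₁.Conn ↔ ∀ f g h, (union eW eK eV Γ₁ Γ₂).IsSplit f g h →
      Sum.elim (fun w => f (eW (Sum.inl w))) (fun k => g (eK (Sum.inl k))) l →
      (∀ w, f (eW (Sum.inl w))) ∧ (∀ k, g (eK (Sum.inl k))) ∧ ∀ v, h (eV (Sum.inl v)) := by
  constructor
  · rintro ⟨-, H⟩ f g h hs hl
    rw [union_isSplit] at hs
    rcases H _ _ _ hs.1 with h1 | ⟨h1, h2, -⟩
    · exact h1
    · rcases l with l | l
      · exact (h1 l hl).elim
      · exact (h2 l hl).elim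
  · intro H
    refine ⟨?_, ?_⟩
    · rcases l with l | l
      · exact Or.inl ⟨l⟩
      · exact Or.inr (Or.inl ⟨l⟩)
    have key : ∀ f g h, Γ₁.IsSplit f g h → Sum.elim f g l →
        (∀ w, f w) ∧ (∀ k, g k) ∧ ∀ v, h v := by
      intro f g h hs hl
      have h2 : Γ₂.IsSplit (fun _ => False) (fun _ => False) (fun _ => False) := by
        intro u
        cases u <;> cases hu : Γ₂.propagator _ <;> simp
      have := H (fun w => Sum.elim f (fun _ => False) (eW.symm w))
        (fun k => Sum.elim g (fun _ => False) (eK.symm k))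
        (fun v => Sum.elim h (fun _ => False) (eV.symm v))
        ((union_isSplit eW eK eV Γ₁ Γ₂ _ _ _).2 (by simpa using ⟨hs, h2⟩)) (by simpa using hl)
      simpa using this
    intro f g h hs
    by_cases hl : Sum.elim f g l
    · exact Or.inl (key f g h hs hl)
    · exact Or.inr (key _ _ _ hs.not (by cases l <;> exact hl))

section Component

/-- The legs in `S` and the vertices in `U` form the component of the leg `l`. -/
def IsComponent (Γ : Diagram D W K V) (l : W ⊕ K) (S : Finset (W ⊕ K)) (U : Finset V) : Prop :=
  Γ.IsSplit (fun w => Sum.inl w ∈ S) (fun k => Sum.inr k ∈ S) (fun v => v ∈ U) ∧ l ∈ S ∧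
    ∀ f g h, Γ.IsSplit f g h → Sum.elim f g l →
      (∀ w, Sum.inl w ∈ S → f w) ∧ (∀ k, Sum.inr k ∈ S → g k) ∧ ∀ v ∈ U, h v

theorem IsComponent.unique {Γ : Diagram D W K V} {l : W ⊕ K} {S S' : Finset (W ⊕ K)}
    {U U' : Finset V} (h : Γ.IsComponent l S U) (h' : Γ.IsComponent l S' U') :
    S = S' ∧ U = U' := by
  have key : ∀ {S S' : Finset (W ⊕ K)} {U U' : Finset V}, Γ.IsComponent l S U →
      Γ.IsComponent l S' U' → S ⊆ S' ∧ U ⊆ U' := by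
    intro S S' U U' h h'
    obtain ⟨h1, h2, h3⟩ := h.2.2 _ _ _ h'.1 (by
      have := h'.2.1
      cases l <;> exact this)
    refine ⟨?_, h3⟩
    rintro (x | x) hx
    · exact h1 x hx
    · exact h2 x hx
  exact ⟨(key h h').1.antisymm (key h' h).1, (key h h').2.antisymm (key h' h).2⟩

theorem exists_isComponent [Fintype W] [Fintype K] [Fintype V] (Γ : Diagram D W K V)
    (l : W ⊕ K) : ∃ S U, Γ.IsComponent l S U := by
  classical
  let ι := {x : (W → Prop) × (K → Prop) × (V → Prop) //
    Γ.IsSplit x.1 x.2.1 x.2.2 ∧ Sum.elim x.1 x.2.1 l}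
  refine ⟨Finset.univ.filter fun l' => ∀ x : ι, Sum.elim x.1.1 x.1.2.1 l',
    Finset.univ.filter fun v => ∀ x : ι, x.1.2.2 v, ?_, ?_, ?_⟩
  · simpa using IsSplit.forall fun x : ι => x.2.1
  · simpa using fun x : ι => x.2.2
  · intro f g h hs hl
    simp only [Finset.mem_filter, Finset.mem_univ, true_and]
    exact ⟨fun w H => H ⟨(f, g, h), hs, hl⟩, fun w H => H ⟨(f, g, h), hs, hl⟩,
      fun w H => H ⟨(f, g, h), hs, hl⟩⟩

open Classical in
/-- The sum over the diagrams in which the component of a leg has given legs and vertices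
factorises. -/
theorem sum_isComponent [Fintype W] [Fintype K] [Fintype V] (E : Momentum I → ℝ)
    (X : W → Momentum I) (Y : K → Momentum I) {l : W ⊕ K} {S : Finset (W ⊕ K)} (hl : l ∈ S)
    (U : Finset V) :
    ∑ Γ ∈ (Finset.univ : Finset (Diagram D W K V)).filter (fun Γ => Γ.IsComponent l S U),
      Γ.weight E X Y =
    (∑ Γ ∈ (Finset.univ : Finset (Diagram D {w : W // Sum.inl w ∈ S} {k : K // Sum.inr k ∈ S}
        {v // v ∈ U})).filter Conn, Γ.weight E (fun w => X w) (fun k => Y k)) *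
    ∑ Γ : Diagram D {w : W // Sum.inl w ∉ S} {k : K // Sum.inr k ∉ S} {v // v ∉ U},
      Γ.weight E (fun w => X w) (fun k => Y k) := by
  set eW := Equiv.sumCompl fun w : W => Sum.inl w ∈ S with heW
  set eK := Equiv.sumCompl fun k : K => Sum.inr k ∈ S with heK
  set eV := Equiv.sumCompl fun v : V => v ∈ U with heV
  have hW : ∀ w, (eW.symm w).isLeft ↔ Sum.inl w ∈ S := by
    intro w
    by_cases h : Sum.inl w ∈ S <;> simp [heW, h]
  have hK : ∀ w, (eK.symm w).isLeft ↔ Sum.inr w ∈ S := by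
    intro w
    by_cases h : Sum.inr w ∈ S <;> simp [heK, h]
  have hV : ∀ w, (eV.symm w).isLeft ↔ w ∈ U := by
    intro w
    by_cases h : w ∈ U <;> simp [heV, h]
  have hsum := sum_isSplit eW eK eV (D := D)
    fun Γ => if Γ.IsComponent l S U then Γ.weight E X Y else 0
  simp only [hW, hK, hV] at hsum
  rw [← Finset.sum_filter, Finset.filter_filter] at hsum
  have hcomp : ∀ Γ : Diagram D W K V, (Γ.IsSplit (fun w => Sum.inl w ∈ S) (fun k => Sum.inr k ∈ S)
      (fun v => v ∈ U) ∧ Γ.IsComponent l S U) ↔ Γ.IsComponent l S U :=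
    fun Γ => ⟨fun h => h.2, fun h => ⟨h.1, h⟩⟩
  simp only [hcomp] at hsum
  rw [hsum, Finset.sum_filter, Finset.sum_mul]
  refine Finset.sum_congr rfl fun Γ₁ _ => ?_
  have hconn : ∀ Γ₂, (union eW eK eV Γ₁ Γ₂).IsComponent l S U ↔ Γ₁.Conn := by
    intro Γ₂
    obtain ⟨l', hl'⟩ : ∃ l' : {w : W // Sum.inl w ∈ S} ⊕ {k : K // Sum.inr k ∈ S},
        ∀ (f : W → Prop) (g : K → Prop), Sum.elim (fun w => f (eW (Sum.inl w)))
          (fun k => g (eK (Sum.inl k))) l' ↔ Sum.elim f g l := by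
      rcases l with w | k
      · exact ⟨Sum.inl ⟨w, hl⟩, fun f g => Iff.rfl⟩
      · exact ⟨Sum.inr ⟨k, hl⟩, fun f g => Iff.rfl⟩
    have hs : (union eW eK eV Γ₁ Γ₂).IsSplit (fun w => Sum.inl w ∈ S) (fun k => Sum.inr k ∈ S)
        (fun v => v ∈ U) := by
      simpa only [hW, hK, hV] using union_isSplit_isLeft eW eK eV Γ₁ Γ₂
    rw [union_conn_iff eW eK eV Γ₁ Γ₂ l', IsComponent]
    constructor
    · rintro ⟨-, -, h⟩ f g q hs' hfl
      obtain ⟨h1, h2, h3⟩ := h f g q hs' ((hl' f g).1 hfl)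
      exact ⟨fun w => h1 _ w.2, fun k => h2 _ k.2, fun v => h3 _ v.2⟩
    · intro h
      refine ⟨hs, hl, fun f g q hs' hfl => ?_⟩
      obtain ⟨h1, h2, h3⟩ := h f g q hs' ((hl' f g).2 hfl)
      exact ⟨fun w hw => h1 ⟨w, hw⟩, fun k hk => h2 ⟨k, hk⟩, fun v hv => h3 ⟨v, hv⟩⟩
  by_cases hc : Γ₁.Conn
  · rw [if_pos hc, Finset.mul_sum]
    refine Finset.sum_congr rfl fun Γ₂ _ => ?_
    rw [if_pos ((hconn Γ₂).2 hc), union_weight]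
    rfl
  · rw [if_neg hc, zero_mul, Finset.sum_eq_zero]
    intro Γ₂ _
    rw [if_neg (mt (hconn Γ₂).1 hc)]

end Component

section Series

variable [Fintype W] [Fintype K] [Fintype W'] [Fintype K']

/-- The sum over all diagrams with prescribed momenta of the legs. -/
noncomputable def allSeries (D : ℕ) {I : Fin D → Finset ℤ} (E : Momentum I → ℝ)
    (X : W → Momentum I) (Y : K → Momentum I) : ℝ⟦X⟧ :=
  expSeries fun n => ∑ Γ : Diagram D W K (Fin n), Γ.weight E X Y

open Classical in
/-- The sum over all connected diagrams with prescribed momenta of the legs. -/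
noncomputable def connSeries (D : ℕ) {I : Fin D → Finset ℤ} (E : Momentum I → ℝ)
    (X : W → Momentum I) (Y : K → Momentum I) : ℝ⟦X⟧ :=
  expSeries fun n => ∑ Γ ∈ (Finset.univ : Finset (Diagram D W K (Fin n))).filter Conn,
    Γ.weight E X Y

open Classical in
theorem sum_conn_weight_relabel [Fintype V] [Fintype V'] (eW : W ≃ W') (eK : K ≃ K') (eV : V ≃ V')
    (E : Momentum I → ℝ) (X : W' → Momentum I) (Y : K' → Momentum I) :
    ∑ Γ ∈ (Finset.univ : Finset (Diagram D W K V)).filter Conn, Γ.weight E (X ∘ eW) (Y ∘ eK) =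
      ∑ Γ ∈ (Finset.univ : Finset (Diagram D W' K' V')).filter Conn, Γ.weight E X Y := by
  refine Finset.sum_equiv (relabelEquiv eW eK eV) ?_ ?_
  · intro Γ
    simp only [Finset.mem_filter, Finset.mem_univ, true_and]
    exact (relabel_conn eW eK eV Γ).symm
  · intro Γ _
    exact (relabel_weight eW eK eV Γ E X Y).symm

theorem sum_weight_relabel [Fintype V] [Fintype V'] (eW : W ≃ W') (eK : K ≃ K') (eV : V ≃ V')
    (E : Momentum I → ℝ) (X : W' → Momentum I) (Y : K' → Momentum I) :
    ∑ Γ : Diagram D W K V, Γ.weight E (X ∘ eW) (Y ∘ eK) =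
      ∑ Γ : Diagram D W' K' V', Γ.weight E X Y :=
  Fintype.sum_equiv (relabelEquiv eW eK eV) _ _ fun Γ =>
    (relabel_weight eW eK eV Γ E X Y).symm

open Classical in
/-- Removing the component of a given leg from a diagram. -/
theorem allSeries_eq_sum (E : Momentum I → ℝ) (X : W → Momentum I) (Y : K → Momentum I)
    (l : W ⊕ K) :
    allSeries D E X Y = ∑ S ∈ (Finset.univ : Finset (Finset (W ⊕ K))).filter (fun S => l ∈ S),
      connSeries D E (fun w : {w : W // Sum.inl w ∈ S} => X w)
          (fun k : {k : K // Sum.inr k ∈ S} => Y k) *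
        allSeries D E (fun w : {w : W // Sum.inl w ∉ S} => X w)
          (fun k : {k : K // Sum.inr k ∉ S} => Y k) := by
  simp only [allSeries, connSeries, expSeries_mul, ← expSeries_sum]
  congr 1
  funext n
  have h1 : ∀ Γ : Diagram D W K (Fin n), Γ.weight E X Y =
      ∑ S ∈ (Finset.univ : Finset (Finset (W ⊕ K))).filter (fun S => l ∈ S),
        ∑ U : Finset (Fin n), if Γ.IsComponent l S U then Γ.weight E X Y else 0 := by
    intro Γ
    obtain ⟨S, U, h⟩ := Γ.exists_isComponent l
    rw [Finset.sum_eq_single S, Finset.sum_eq_single U, if_pos h]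
    · intro U' _ hne
      rw [if_neg fun h' => hne (h'.unique h).2]
    · simp
    · intro S' _ hne
      refine Finset.sum_eq_zero fun U' _ => ?_
      rw [if_neg fun h' => hne (h'.unique h).1]
    · intro hS
      exact (hS (by simpa using h.2.1)).elim
  rw [Finset.sum_congr rfl fun Γ _ => h1 Γ, Finset.sum_comm]
  refine Finset.sum_congr rfl fun S hS => ?_
  rw [Finset.sum_comm]
  refine Finset.sum_congr rfl fun U _ => ?_
  rw [← Finset.sum_filter, sum_isComponent E X Y (by simpa using hS) U]
  congr 1
  · exact sum_conn_weight_relabel (Equiv.refl {w : W // Sum.inl w ∈ S})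
      (Equiv.refl {k : K // Sum.inr k ∈ S}) U.equivFin E (fun w => X w) (fun k => Y k)
  · have hcard : Fintype.card {v // v ∉ U} = n - U.card := by
      rw [Fintype.card_subtype_compl]
      simp
    convert sum_weight_relabel (Equiv.refl {w : W // Sum.inl w ∉ S})
      (Equiv.refl {k : K // Sum.inr k ∉ S}) (Fintype.equivFinOfCardEq hcard) E
      (fun w => X w) (fun k => Y k) <;> rfl

end Series

end Diagram

section LinkedCluster

open MvPowerSeries

variable {D : ℕ} {I : Fin D → Finset ℤ}

theorem constantCoeff_vacuum (E : Momentum I → ℝ) :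
    PowerSeries.constantCoeff (vacuum E) = 1 := by
  have h : PowerSeries.coeff 0 (vacuum E) = 1 := by
    change PowerSeries.coeff 0 (partitionFunction E 0) = 1
    simp [partitionFunction, constantCoeff_freePartition]
  simpa using h

theorem inv_vacuum_mul_vacuum (E : Momentum I → ℝ) : (vacuum E)⁻¹ * vacuum E = 1 :=
  PowerSeries.inv_mul_cancel _ (by rw [constantCoeff_vacuum]; exact one_ne_zero)

/-- The differential equation of the logarithm: `∂F = F · ∂ log F`. -/
theorem pderiv_eq_pderiv_freeEnergy_mul (E : Momentum I → ℝ) (i : Momentum I ⊕ Momentum I) :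
    pderiv ℝ⟦X⟧ i (C (vacuum E)⁻¹ * partitionFunction E) =
      pderiv ℝ⟦X⟧ i (freeEnergy E) * (C (vacuum E)⁻¹ * partitionFunction E) := by
  set F := C (vacuum E)⁻¹ * partitionFunction E with hF
  have h0 : constantCoeff (F - 1) = 0 := by
    have : constantCoeff (partitionFunction E) = vacuum E := rfl
    rw [map_sub, hF, map_mul, this, constantCoeff_C, inv_vacuum_mul_vacuum]
    simp
  have hs := PowerSeries.HasSubst.of_constantCoeff_zero h0
  have hlog : PowerSeries.derivative ℝ (PowerSeries.log ℝ) * (1 + PowerSeries.X) = 1 := by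
    rw [PowerSeries.deriv_log]
    ext n
    rw [mul_add, mul_one, map_add]
    cases n with
    | zero => simp
    | succ n => simp [PowerSeries.coeff_succ_mul_X, pow_succ, PowerSeries.coeff_one]
  have h2 : (PowerSeries.derivative ℝ (PowerSeries.log ℝ)).subst (F - 1) * F = 1 := by
    have h3 := congrArg (fun f : ℝ⟦X⟧ => f.subst (F - 1)) hlog
    simp only [PowerSeries.subst_mul hs, PowerSeries.subst_add hs, PowerSeries.subst_X hs] at h3
    have h4 : PowerSeries.subst (F - 1) (1 : ℝ⟦X⟧) = 1 := by
      rw [← PowerSeries.coe_substAlgHom hs, map_one]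
    rw [h4] at h3
    simpa using h3
  have h5 : pderiv ℝ⟦X⟧ i (freeEnergy E) =
      (PowerSeries.derivative ℝ (PowerSeries.log ℝ)).subst (F - 1) * pderiv ℝ⟦X⟧ i F := by
    rw [freeEnergy, ← hF, pderiv_subst h0]
    simp
  rw [h5, mul_right_comm, h2, one_mul]

theorem multiDeriv_eq_sourceDeriv {W K : Type} [Fintype W] [Fintype K] (X : W → Momentum I)
    (Y : K → Momentum I) (p : W ⊕ K → Prop) [DecidablePred p]
    (F : MvPowerSeries (Momentum I ⊕ Momentum I) ℝ⟦X⟧) :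
    multiDeriv (Sum.elim (Sum.inl ∘ X) (Sum.inr ∘ Y)) (Finset.univ.filter p) F =
      sourceDeriv F (fun w : {w : W // p (Sum.inl w)} => X w)
        (fun k : {k : K // p (Sum.inr k)} => Y k) := by
  classical
  have h : ∑ l ∈ Finset.univ.filter p, Finsupp.single (Sum.elim (Sum.inl ∘ X) (Sum.inr ∘ Y) l) 1 =
      (∑ w : {w : W // p (Sum.inl w)}, Finsupp.single (Sum.inl (X w)) 1 +
        ∑ k : {k : K // p (Sum.inr k)}, Finsupp.single (Sum.inr (Y k)) 1 :
        Momentum I ⊕ Momentum I →₀ ℕ) := by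
    rw [Finset.sum_filter, Fintype.sum_sum_type, ← Finset.sum_filter, ← Finset.sum_filter]
    congr 1
    · exact Finset.sum_subtype _ (by simp) _
    · exact Finset.sum_subtype _ (by simp) _
  rw [multiDeriv, h]
  rfl

open Classical in
/-- The linked cluster theorem: the derivatives of the free energy are the sums over connected
diagrams. Both sides satisfy the recursion that singles out the component of one leg. -/
theorem sourceDeriv_freeEnergy {W K : Type} [Fintype W] [Fintype K] (E : Momentum I → ℝ)
    (X : W → Momentum I) (Y : K → Momentum I) (hne : Nonempty (W ⊕ K)) :
    sourceDeriv (freeEnergy E) X Y = Diagram.connSeries D E X Y := by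
  induction hN : Fintype.card (W ⊕ K) using Nat.strong_induction_on generalizing W K with
  | _ N ih =>
  obtain ⟨l⟩ := hne
  set F : MvPowerSeries (Momentum I ⊕ Momentum I) ℝ⟦X⟧ :=
    C (vacuum E)⁻¹ * partitionFunction E with hF
  set f : W ⊕ K → Momentum I ⊕ Momentum I := Sum.elim (Sum.inl ∘ X) (Sum.inr ∘ Y) with hf
  have hsub : ∀ (S : Finset (W ⊕ K)) (G : MvPowerSeries (Momentum I ⊕ Momentum I) ℝ⟦X⟧),
      multiDeriv f S G = sourceDeriv G (fun w : {w : W // Sum.inl w ∈ S} => X w)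
        (fun k : {k : K // Sum.inr k ∈ S} => Y k) := by
    intro S G
    rw [← multiDeriv_eq_sourceDeriv X Y (fun l => l ∈ S)]
    simp [hf]
  have hsubc : ∀ (S : Finset (W ⊕ K)) (G : MvPowerSeries (Momentum I ⊕ Momentum I) ℝ⟦X⟧),
      multiDeriv f Sᶜ G = sourceDeriv G (fun w : {w : W // Sum.inl w ∉ S} => X w)
        (fun k : {k : K // Sum.inr k ∉ S} => Y k) := by
    intro S G
    rw [← multiDeriv_eq_sourceDeriv X Y (fun l => l ∉ S)]
    congr 1
    ext; simp
  have huniv : ∀ G : MvPowerSeries (Momentum I ⊕ Momentum I) ℝ⟦X⟧,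
      multiDeriv f Finset.univ G = sourceDeriv G X Y := by
    intro G
    simp [multiDeriv, sourceDeriv, hf, factorialProd]
  -- the recursion for the derivatives of `log F`
  have h1 : multiDeriv f Finset.univ F =
      ∑ S ∈ (Finset.univ : Finset (Finset (W ⊕ K))).filter (fun S => l ∈ S),
        multiDeriv f S (freeEnergy E) * multiDeriv f Sᶜ F := by
    rw [← Finset.insert_erase (Finset.mem_univ l), multiDeriv_insert _ (by simp),
      pderiv_eq_pderiv_freeEnergy_mul, multiDeriv_mul]
    refine Finset.sum_bij' (fun T _ => insert l T) (fun S _ => S.erase l) ?_ ?_ ?_ ?_ ?_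
    · simp
    · intro S _
      simp only [Finset.mem_powerset]
      exact Finset.erase_subset_erase _ (Finset.subset_univ _)
    · intro T hT
      refine Finset.erase_insert fun hl => ?_
      simpa using Finset.mem_powerset.1 hT hl
    · intro S hS
      exact Finset.insert_erase (by simpa using hS)
    · intro T hT
      have hl : l ∉ T := fun hl => by simpa using Finset.mem_powerset.1 hT hl
      rw [multiDeriv_insert _ hl]
      congr 2
      ext x
      simp [and_comm]
  -- the recursion for the connected diagrams
  have h2 : multiDeriv f Finset.univ F =
      ∑ S ∈ (Finset.univ : Finset (Finset (W ⊕ K))).filter (fun S => l ∈ S),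
        Diagram.connSeries D E (fun w : {w : W // Sum.inl w ∈ S} => X w)
          (fun k : {k : K // Sum.inr k ∈ S} => Y k) * multiDeriv f Sᶜ F := by
    rw [hF, multiDeriv_C_mul, huniv, sourceDeriv_partitionFunction]
    have := Diagram.allSeries_eq_sum E X Y l
    unfold Diagram.allSeries at this
    rw [this, Finset.mul_sum]
    refine Finset.sum_congr rfl fun S _ => ?_
    rw [multiDeriv_C_mul, hsubc, sourceDeriv_partitionFunction]
    ring
  have h3 := h1.symm.trans h2
  rw [← Finset.sum_erase_add _ _ (show Finset.univ ∈ _ by simp : Finset.univ ∈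
      (Finset.univ : Finset (Finset (W ⊕ K))).filter (fun S => l ∈ S)),
    ← Finset.sum_erase_add _ _ (show Finset.univ ∈ _ by simp : Finset.univ ∈
      (Finset.univ : Finset (Finset (W ⊕ K))).filter (fun S => l ∈ S))] at h3
  have h4 : multiDeriv f (Finset.univᶜ) F = 1 := by
    rw [Finset.compl_univ, multiDeriv_empty, hF, map_mul, constantCoeff_C]
    exact inv_vacuum_mul_vacuum E
  rw [h4, mul_one, mul_one, huniv, Finset.sum_congr rfl (fun S hS => ?_)] at h3
  · rw [add_left_cancel h3]
    unfold Diagram.connSeries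
    congr 1
    funext n
    exact Diagram.sum_conn_weight_relabel (Equiv.subtypeUnivEquiv (by simp))
      (Equiv.subtypeUnivEquiv (by simp)) (Equiv.refl _) E X Y
  · rw [hsub]
    congr 1
    have hlS : l ∈ S := by simpa using (Finset.mem_erase.1 hS).2
    have hcard : Fintype.card ({w : W // Sum.inl w ∈ S} ⊕ {k : K // Sum.inr k ∈ S}) = S.card := by
      rw [← Fintype.card_coe S]
      exact (Fintype.card_congr (Equiv.subtypeSum (p := fun l => l ∈ S))).symm
    refine ih S.card ?_ _ _ ?_ hcard
    · rw [← hN, ← Finset.card_univ]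
      exact Finset.card_lt_card (Finset.ssubset_univ_iff.2 (Finset.mem_erase.1 hS).1)
    · rcases l with w | k
      · exact ⟨Sum.inl ⟨w, hlS⟩⟩
      · exact ⟨Sum.inr ⟨k, hlS⟩⟩

end LinkedCluster

/-! ### Boundary graph expansions -/

namespace Diagram

variable {D : ℕ} {W K V : Type} {I : Fin D → Finset ℤ}
variable [Fintype W] [Fintype K] [Fintype V]

open Classical in
/-- Momentum is transported along the external faces, so the momenta of the `J̄`-legs are determined
by those of the `J`-legs through the boundary graph. -/
theorem weight_eq_ite (Γ : Diagram D W K V) (E : Momentum I → ℝ) (X : W → Momentum I)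
    (Y : K → Momentum I) :
    Γ.weight E X Y = if Γ.bdry.target X = Y then Γ.amplitude E X 0 else 0 := by
  have hw : Γ.weight E X Y = ∑ p ∈ (Finset.univ : Finset (W ⊕ V × Bool → Momentum I)).filter
      (fun p => (∀ u, (∀ v, u = Sum.inl v → p u = X v) ∧
        ∀ w, Γ.propagator u = Sum.inl w → p u = Y w) ∧ Γ.IsFlow p), ∏ u, (E (p u))⁻¹ := by
    refine Eq.trans ?_ (sum_filter_and_prod (fun u m => (∀ v, u = Sum.inl v → m = X v) ∧
      ∀ w, Γ.propagator u = Sum.inl w → m = Y w) Γ.IsFlow (fun _ m => (E m)⁻¹)).symm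
    rw [weight, wsum]
    exact Finset.sum_congr rfl fun p _ => Finset.prod_congr rfl fun u _ =>
      congrArg (· * _) (ite_eq_ite_of_iff Iff.rfl _ _)
  have hleg : ∀ p : W ⊕ V × Bool → Momentum I, ((∀ u, (∀ v, u = Sum.inl v → p u = X v) ∧
      ∀ w, Γ.propagator u = Sum.inl w → p u = Y w) ∧ Γ.IsFlow p) ↔
      Γ.bdry.target X = Y ∧ (∀ v, p (Sum.inl v) = X v) ∧ Γ.IsFlow p := by
    intro p
    constructor
    · rintro ⟨h, hp⟩
      have hX : (fun v => p (Sum.inl v)) = X := funext fun v => (h _).1 v rfl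
      refine ⟨funext fun w => ?_, fun v => (h _).1 v rfl, hp⟩
      rw [← hX, ← Γ.hasBdry_bdry.flow_eq hp]
      exact (h _).2 w (by simp)
    · rintro ⟨rfl, hX, hp⟩
      obtain rfl : (fun v => p (Sum.inl v)) = X := funext hX
      refine ⟨fun u => ⟨?_, fun w hw => ?_⟩, hp⟩
      · rintro v rfl
        rfl
      · rw [← Γ.hasBdry_bdry.flow_eq hp, ← hw]
        simp
  rw [hw]
  split_ifs with h
  · unfold amplitude
    refine Finset.sum_congr (Finset.filter_congr fun p _ => ?_) fun p _ => by simp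
    rw [hleg, and_iff_right h]
  · rw [Finset.filter_false_of_mem, Finset.sum_empty]
    intro p _ hp
    exact h ((hleg p).1 hp).1

open Classical in
theorem sum_weight_eq_sum_bdrySum (P : Diagram D W K V → Prop) (E : Momentum I → ℝ)
    (X : W → Momentum I) (Y : K → Momentum I) :
    ∑ Γ ∈ (Finset.univ : Finset (Diagram D W K V)).filter P, Γ.weight E X Y =
      ∑ C : ColouredGraph D W K, if C.target X = Y then bdrySum P E C X 0 else 0 := by
  have h : ∀ Γ : Diagram D W K V, Γ.weight E X Y =
      ∑ C : ColouredGraph D W K,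
        if Γ.HasBdry C then (if C.target X = Y then Γ.amplitude E X 0 else 0) else 0 := by
    intro Γ
    simp only [hasBdry_iff]
    rw [Finset.sum_ite_eq, if_pos (Finset.mem_univ _)]
    exact weight_eq_ite Γ E X Y
  rw [Finset.sum_congr rfl fun Γ _ => h Γ, Finset.sum_comm]
  refine Finset.sum_congr rfl fun C _ => ?_
  unfold bdrySum
  by_cases hC : C.target X = Y
  · simp only [hC, if_true]
    rw [← Finset.sum_filter, Finset.filter_filter]
  · simp [hC]

end Diagram

section BoundaryExpansion

variable {D : ℕ} {I : Fin D → Finset ℤ} {W K : Type}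

theorem expSeries_ite (p : Prop) [Decidable p] (c : ℕ → ℝ) :
    expSeries (fun n => if p then c n else 0) = if p then expSeries c else 0 := by
  split_ifs
  · rfl
  · ext n
    simp [expSeries]

theorem IsGeneric.eq_of_target_eq {X : W → Momentum I} (hX : IsGeneric X)
    {C C' : ColouredGraph D W K} (h : C.target X = C'.target X) : C = C' := by
  ext a v
  have h1 := congrFun (congrFun h (C.edge a v)) a
  simp only [ColouredGraph.target, Equiv.symm_apply_apply] at h1
  have h2 : v = (C'.edge a).symm (C.edge a v) := by
    by_contra hne
    exact hX a _ _ hne h1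
  rw [Equiv.eq_symm_apply] at h2
  exact h2.symm

variable [Fintype W] [Fintype K]

open Classical in
theorem sourceDeriv_freeEnergy_eq_sum_corr [DecidableEq W] (hD : 2 ≤ D) (E : Momentum I → ℝ)
    (X : W → Momentum I) (Y : K → Momentum I) (hne : Nonempty (W ⊕ K)) :
    sourceDeriv (freeEnergy E) X Y =
      ∑ C : ColouredGraph D W K, if C.target X = Y then corr E C X else 0 := by
  rw [sourceDeriv_freeEnergy E X Y hne, Diagram.connSeries]
  simp only [Diagram.sum_weight_eq_sum_bdrySum, expSeries_sum, expSeries_ite]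
  simp only [corr, corrShift_eq_expSeries hD]

open Classical in
theorem sourceDeriv_partitionFunction_eq_sum_partitionCorr [DecidableEq W] (E : Momentum I → ℝ)
    (X : W → Momentum I) (Y : K → Momentum I) :
    (vacuum E)⁻¹ * sourceDeriv (partitionFunction E) X Y =
      ∑ C : ColouredGraph D W K, if C.target X = Y then partitionCorr E C X else 0 := by
  rw [sourceDeriv_partitionFunction]
  have h : ∀ n, ∑ Γ : Diagram D W K (Fin n), Γ.weight E X Y =
      ∑ C : ColouredGraph D W K, if C.target X = Y then
        Diagram.bdrySum (V := Fin n) (fun _ => True) E C X 0 else 0 := by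
    intro n
    rw [← Diagram.sum_weight_eq_sum_bdrySum]
    simp
  simp only [h, expSeries_sum, expSeries_ite, Finset.mul_sum, mul_ite, mul_zero]
  simp only [partitionCorr, partitionCorrShift_eq_expSeries]

open Classical in
theorem IsGeneric.sum_target_eq {X : W → Momentum I} (hX : IsGeneric X) (C : ColouredGraph D W K)
    (c : ColouredGraph D W K → ℝ⟦X⟧) :
    (∑ C' : ColouredGraph D W K, if C'.target X = C.target X then c C' else 0) = c C := by
  rw [Finset.sum_eq_single C, if_pos rfl]
  · intro C' _ hne
    rw [if_neg fun h => hne (hX.eq_of_target_eq h)]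
  · simp

end BoundaryExpansion

/-! ### Vacuum diagrams -/

/-- The disjoint union of two coloured graphs. -/
def ColouredGraph.union {D : ℕ} {W K W₁ K₁ W₂ K₂ : Type} (eW : W₁ ⊕ W₂ ≃ W) (eK : K₁ ⊕ K₂ ≃ K)
    (B₁ : ColouredGraph D W₁ K₁) (B₂ : ColouredGraph D W₂ K₂) : ColouredGraph D W K :=
  ⟨fun a => eW.symm.trans ((Equiv.sumCongr (B₁.edge a) (B₂.edge a)).trans eK)⟩

namespace Diagram

variable {D : ℕ} {W K V W₁ K₁ V₁ W₂ K₂ V₂ : Type} {I : Fin D → Finset ℤ}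

/-- The legs of a component of a diagram form a union of components of the boundary graph. If the
latter is connected, all components except for one are vacuum diagrams. -/
theorem HasBdry.noVac_iff_conn [Nonempty W] {Γ : Diagram D W K V} {B : ColouredGraph D W K}
    (hB : B.Connected) (h : Γ.HasBdry B) : Γ.NoVac ↔ Γ.Conn := by
  refine ⟨fun hvac => ⟨Or.inl inferInstance, fun f g q hs => ?_⟩, Conn.noVac⟩
  have key : ∀ (f : W → Prop) (g : K → Prop) (q : V → Prop), Γ.IsSplit f g q → (∀ v, ¬ f v) →
      (∀ w, ¬ g w) → ∀ v, ¬ q v := by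
    intro f g q hs hf hg
    have h1 : f = fun _ => False := funext fun v => by simpa using hf v
    have h2 : g = fun _ => False := funext fun v => by simpa using hg v
    subst h1 h2
    exact hvac q hs
  rcases hB.forall_or (fun a v => h.isSplit hs a v) with ⟨h1, h2⟩ | ⟨h1, h2⟩
  · refine Or.inl ⟨h1, h2, ?_⟩
    simpa using key _ _ _ hs.not (by simpa using h1) (by simpa using h2)
  · exact Or.inr ⟨h1, h2, key f g q hs h1 h2⟩

section Union

variable (eW : W₁ ⊕ W₂ ≃ W) (eK : K₁ ⊕ K₂ ≃ K) (eV : V₁ ⊕ V₂ ≃ V)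
  (Γ₁ : Diagram D W₁ K₁ V₁) (Γ₂ : Diagram D W₂ K₂ V₂)

theorem union_faceInv (a : Fin D) (f : W ⊕ V × Bool → Prop) :
    (union eW eK eV Γ₁ Γ₂).FaceInv a f ↔
      Γ₁.FaceInv a (fun x => f (unionEquiv eW eV (Sum.inl x))) ∧
      Γ₂.FaceInv a (fun x => f (unionEquiv eW eV (Sum.inr x))) :=
  union_respects eW eK eV Γ₁ Γ₂ _

theorem faceInv_const (Γ : Diagram D W K V) (a : Fin D) (p : Prop) :
    Γ.FaceInv a (fun _ => p) := fun _ _ _ => Iff.rfl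

theorem union_onFace_inl (v : W₁) (a : Fin D) (x : (W₁ ⊕ V₁ × Bool) ⊕ (W₂ ⊕ V₂ × Bool)) :
    (union eW eK eV Γ₁ Γ₂).OnFace (eW (Sum.inl v)) a (unionEquiv eW eV x) ↔
      Sum.elim (Γ₁.OnFace v a) (fun _ => False) x := by
  constructor
  · intro h
    have h1 := h (fun y => Sum.elim (Γ₁.OnFace v a) (fun _ => False) ((unionEquiv eW eV).symm y))
      ((union_faceInv eW eK eV Γ₁ Γ₂ _ _).2
        (by simpa using ⟨Γ₁.faceInv_onFace v a, Γ₂.faceInv_const a False⟩))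
    have h0 : (unionEquiv eW eV).symm (Sum.inl (eW (Sum.inl v))) = Sum.inl (Sum.inl v) := by
      rw [← unionEquiv_inl_inl eW eV, Equiv.symm_apply_apply]
    rw [h0] at h1
    simpa using h1.1 (Γ₁.onFace_self v a)
  · rcases x with x | x
    · intro h f hf
      exact h _ ((union_faceInv eW eK eV Γ₁ Γ₂ _ _).1 hf).1
    · exact fun h => h.elim

theorem union_onFace_inr (v : W₂) (a : Fin D) (x : (W₁ ⊕ V₁ × Bool) ⊕ (W₂ ⊕ V₂ × Bool)) :
    (union eW eK eV Γ₁ Γ₂).OnFace (eW (Sum.inr v)) a (unionEquiv eW eV x) ↔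
      Sum.elim (fun _ => False) (Γ₂.OnFace v a) x := by
  constructor
  · intro h
    have h1 := h (fun y => Sum.elim (fun _ => False) (Γ₂.OnFace v a) ((unionEquiv eW eV).symm y))
      ((union_faceInv eW eK eV Γ₁ Γ₂ _ _).2
        (by simpa using ⟨Γ₁.faceInv_const a False, Γ₂.faceInv_onFace v a⟩))
    have h0 : (unionEquiv eW eV).symm (Sum.inl (eW (Sum.inr v))) = Sum.inr (Sum.inl v) := by
      rw [← unionEquiv_inr_inl eW eV, Equiv.symm_apply_apply]
    rw [h0] at h1
    simpa using h1.1 (Γ₂.onFace_self v a)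
  · rcases x with x | x
    · exact fun h => h.elim
    · intro h f hf
      exact h _ ((union_faceInv eW eK eV Γ₁ Γ₂ _ _).1 hf).2

theorem union_hasBdry (B₁ : ColouredGraph D W₁ K₁) (B₂ : ColouredGraph D W₂ K₂) :
    (union eW eK eV Γ₁ Γ₂).HasBdry (ColouredGraph.union eW eK B₁ B₂) ↔
      Γ₁.HasBdry B₁ ∧ Γ₂.HasBdry B₂ := by
  unfold HasBdry
  rw [← forall_and]
  refine forall_congr' fun a => ?_
  rw [← eW.forall_congr_right, Sum.forall]
  refine and_congr (forall_congr' fun v => ?_) (forall_congr' fun v => ?_)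
  · have h : (ColouredGraph.union eW eK B₁ B₂).edge a (eW (Sum.inl v)) =
        eK (Sum.inl (B₁.edge a v)) := by simp [ColouredGraph.union]
    rw [h, ← unionEquiv_inl_inl eK eV, union_propagator_symm_unionEquiv, union_onFace_inl]
    rfl
  · have h : (ColouredGraph.union eW eK B₁ B₂).edge a (eW (Sum.inr v)) =
        eK (Sum.inr (B₂.edge a v)) := by simp [ColouredGraph.union]
    rw [h, ← unionEquiv_inr_inl eK eV, union_propagator_symm_unionEquiv, union_onFace_inr]
    rfl

theorem union_amplitude [Fintype W] [Fintype V] [Fintype W₁] [Fintype V₁] [Fintype W₂]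
    [Fintype V₂] (E : Momentum I → ℝ) (X : W → Momentum I) (δ : W → Fin D → ℝ) :
    (union eW eK eV Γ₁ Γ₂).amplitude E X δ =
      Γ₁.amplitude E (fun w => X (eW (Sum.inl w))) (fun w => δ (eW (Sum.inl w))) *
      Γ₂.amplitude E (fun w => X (eW (Sum.inr w))) (fun w => δ (eW (Sum.inr w))) := by
  classical
  rw [amplitude_eq_wsum, union_wsum, amplitude_eq_wsum, amplitude_eq_wsum]
  congr 1
  · congr 1
    funext u m
    congr 1
    · refine ite_eq_ite_of_iff ?_ _ _
      rw [← eW.forall_congr_right, Sum.forall]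
      rcases u with u | u <;> simp
    · congr 2
      rw [← eW.sum_comp, Fintype.sum_sum_type]
      simp [union_onFace_inl, union_onFace_inr]
  · congr 1
    funext u m
    congr 1
    · refine ite_eq_ite_of_iff ?_ _ _
      rw [← eW.forall_congr_right, Sum.forall]
      rcases u with u | u <;> simp
    · congr 2
      rw [← eW.sum_comp, Fintype.sum_sum_type]
      simp [union_onFace_inl, union_onFace_inr]

end Union

/-- The vertices outside of `U` form the vacuum components. -/
def IsCore (Γ : Diagram D W K V) (U : Finset V) : Prop :=
  Γ.IsSplit (fun _ => True) (fun _ => True) (fun v => v ∈ U) ∧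
    ∀ h, Γ.IsSplit (fun _ => False) (fun _ => False) h → ∀ v ∈ U, ¬ h v

theorem IsCore.unique {Γ : Diagram D W K V} {U U' : Finset V} (h : Γ.IsCore U)
    (h' : Γ.IsCore U') : U = U' := by
  have key : ∀ {U U' : Finset V}, Γ.IsCore U → Γ.IsCore U' → U ⊆ U' := by
    intro U U' h h' v hv
    have := h'.1.not
    simp only [not_true_eq_false] at this
    by_contra hv'
    exact h.2 _ this v hv hv'
  exact (key h h').antisymm (key h' h)

theorem exists_isCore [Fintype V] (Γ : Diagram D W K V) : ∃ U, Γ.IsCore U := by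
  classical
  let ι := {h : V → Prop // Γ.IsSplit (fun _ => False) (fun _ => False) h}
  refine ⟨Finset.univ.filter fun v => ∀ x : ι, ¬ x.1 v, ?_, ?_⟩
  · have := IsSplit.forall fun x : ι => x.2.not
    simpa using this
  · intro h hs v hv
    exact (Finset.mem_filter.1 hv).2 ⟨h, hs⟩

variable [Fintype W] [Fintype K] [Fintype V]

open Classical in
/-- The sum over the diagrams with given vertices in the vacuum components factorises. -/
theorem sum_isCore (E : Momentum I → ℝ) (B : ColouredGraph D W K) (X : W → Momentum I)
    (δ : W → Fin D → ℝ) (U : Finset V) :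
    ∑ Γ ∈ (Finset.univ : Finset (Diagram D W K V)).filter (fun Γ => Γ.IsCore U ∧ Γ.HasBdry B),
      Γ.amplitude E X δ =
    bdrySum (V := {v // v ∈ U}) NoVac E B X δ *
    ∑ Γ : Diagram D Empty Empty {v // v ∉ U}, Γ.amplitude E Empty.elim Empty.elim := by
  set eW : W ⊕ Empty ≃ W := Equiv.sumEmpty W Empty with heW
  set eK : K ⊕ Empty ≃ K := Equiv.sumEmpty K Empty with heK
  set eV := Equiv.sumCompl fun v : V => v ∈ U with heV
  have hW : ∀ w, (eW.symm w).isLeft := by simp [heW]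
  have hK : ∀ w, (eK.symm w).isLeft := by simp [heK]
  have hV : ∀ w, (eV.symm w).isLeft ↔ w ∈ U := by
    intro w
    by_cases h : w ∈ U <;> simp [heV, h]
  have hsum := sum_isSplit eW eK eV (D := D)
    fun Γ => if Γ.IsCore U ∧ Γ.HasBdry B then Γ.amplitude E X δ else 0
  simp only [hW, hK, hV] at hsum
  rw [← Finset.sum_filter, Finset.filter_filter] at hsum
  have hcomp : ∀ Γ : Diagram D W K V, (Γ.IsSplit (fun _ => True) (fun _ => True)
      (fun v => v ∈ U) ∧ Γ.IsCore U ∧ Γ.HasBdry B) ↔ Γ.IsCore U ∧ Γ.HasBdry B :=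
    fun Γ => ⟨fun h => h.2, fun h => ⟨h.1.1, h⟩⟩
  simp only [hcomp] at hsum
  rw [hsum, bdrySum, Finset.sum_filter, Finset.sum_mul]
  refine Finset.sum_congr rfl fun Γ₁ _ => ?_
  have hB : B = ColouredGraph.union eW eK B (⟨fun _ => Equiv.refl Empty⟩) := by
    ext a v
    simp [ColouredGraph.union, heW, heK]
  have hcore : ∀ Γ₂, ((union eW eK eV Γ₁ Γ₂).IsCore U ∧ (union eW eK eV Γ₁ Γ₂).HasBdry B) ↔
      Γ₁.NoVac ∧ Γ₁.HasBdry B := by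
    intro Γ₂
    refine and_congr ?_ ?_
    · have hs : (union eW eK eV Γ₁ Γ₂).IsSplit (fun _ => True) (fun _ => True)
          (fun v => v ∈ U) := by
        simpa only [hW, hK, hV] using union_isSplit_isLeft eW eK eV Γ₁ Γ₂
      rw [IsCore, and_iff_right hs]
      constructor
      · intro H h hh v
        have h2 : Γ₂.IsSplit (fun _ => False) (fun _ => False) (fun _ => False) := by
          intro u
          cases u <;> cases hu : Γ₂.propagator _ <;> simp
        have := H (fun v => Sum.elim h (fun _ => False) (eV.symm v))
          ((union_isSplit eW eK eV Γ₁ Γ₂ _ _ _).2 (by simpa using ⟨hh, h2⟩)) (eV (Sum.inl v))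
          v.2
        simpa using this
      · intro H h hh v hv
        exact H _ ((union_isSplit eW eK eV Γ₁ Γ₂ _ _ _).1 hh).1 ⟨v, hv⟩
    · conv_lhs => rw [hB]
      rw [union_hasBdry, and_iff_left]
      exact fun _ v => v.elim
  by_cases hc : Γ₁.NoVac ∧ Γ₁.HasBdry B
  · rw [if_pos hc, Finset.mul_sum]
    refine Finset.sum_congr rfl fun Γ₂ _ => ?_
    rw [if_pos ((hcore Γ₂).2 hc), union_amplitude]
    congr 2 <;> exact funext fun x => x.elim
  · rw [if_neg hc, zero_mul, Finset.sum_eq_zero]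
    intro Γ₂ _
    rw [if_neg (mt (hcore Γ₂).1 hc)]

end Diagram

section VacuumFactorization

variable {D : ℕ} {I : Fin D → Finset ℤ} {W K : Type} [Fintype W] [Fintype K]

theorem vacuum_eq_expSeries (E : Momentum I → ℝ) :
    vacuum E = expSeries fun n =>
      ∑ Γ : Diagram D Empty Empty (Fin n), Γ.amplitude E Empty.elim Empty.elim := by
  have h := sourceDeriv_partitionFunction (W := Empty) (K := Empty) E Empty.elim Empty.elim
  have h1 : sourceDeriv (partitionFunction E) (Empty.elim : Empty → Momentum I)
      (Empty.elim : Empty → Momentum I) = vacuum E := by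
    simp [sourceDeriv, vacuum]
  rw [← h1, h]
  congr 1
  funext n
  refine Finset.sum_congr rfl fun Γ _ => ?_
  rw [Diagram.weight_eq_ite, if_pos (Subsingleton.elim _ _)]
  congr 1
  exact funext fun x => x.elim

theorem sum_amplitude_empty {V V' : Type} [Fintype V] [Fintype V'] (eV : V ≃ V')
    (E : Momentum I → ℝ) :
    ∑ Γ : Diagram D Empty Empty V, Γ.amplitude E Empty.elim Empty.elim =
      ∑ Γ : Diagram D Empty Empty V', Γ.amplitude E Empty.elim Empty.elim := by
  refine Finset.sum_equiv (Diagram.relabelEquiv (Equiv.refl Empty) (Equiv.refl Empty) eV)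
    (by simp) fun Γ _ => ?_
  have h1 := Diagram.relabel_amplitude (Equiv.refl Empty) (Equiv.refl Empty) eV Γ E
    Empty.elim Empty.elim
  have h2 : (Empty.elim : Empty → Momentum I) ∘ Equiv.refl Empty = Empty.elim :=
    Subsingleton.elim _ _
  have h3 : (Empty.elim : Empty → Fin D → ℝ) ∘ Equiv.refl Empty = Empty.elim :=
    Subsingleton.elim _ _
  rw [h2, h3] at h1
  exact h1.symm

/-- The vacuum components cancel against the normalisation of the partition function. -/
theorem partitionCorrShift_eq_noVac [DecidableEq W] (E : Momentum I → ℝ)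
    (B : ColouredGraph D W K) (X : W → Momentum I) (δ : W → Fin D → ℝ) :
    partitionCorrShift E B X δ =
      expSeries fun n => Diagram.bdrySum (V := Fin n) Diagram.NoVac E B X δ := by
  classical
  rw [partitionCorrShift_eq_expSeries]
  suffices h : (expSeries fun n => Diagram.bdrySum (V := Fin n) (fun _ => True) E B X δ) =
      (expSeries fun n => Diagram.bdrySum (V := Fin n) Diagram.NoVac E B X δ) * vacuum E by
    rw [h, mul_left_comm, inv_vacuum_mul_vacuum, mul_one]
  rw [vacuum_eq_expSeries, expSeries_mul]
  congr 1
  funext n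
  have h1 : ∀ Γ : Diagram D W K (Fin n), Γ.amplitude E X δ =
      ∑ U : Finset (Fin n), if Γ.IsCore U then Γ.amplitude E X δ else 0 := by
    intro Γ
    obtain ⟨U, h⟩ := Γ.exists_isCore
    rw [Finset.sum_eq_single U, if_pos h]
    · intro U' _ hne
      rw [if_neg fun h' => hne (h'.unique h)]
    · simp
  rw [Diagram.bdrySum, Finset.sum_congr rfl fun Γ _ => h1 Γ, Finset.sum_comm]
  refine Finset.sum_congr rfl fun U _ => ?_
  rw [← Finset.sum_filter, Finset.filter_filter]
  have h2 := Diagram.sum_isCore E B X δ U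
  have hcard : Fintype.card {v // v ∉ U} = n - U.card := by
    rw [Fintype.card_subtype_compl]
    simp
  refine Eq.trans ?_ (h2.trans ?_)
  · refine Finset.sum_congr (Finset.ext fun Γ => ?_) fun _ _ => rfl
    simp [and_comm]
  · congr 1
    · exact Diagram.bdrySum_vertices U.equivFin (Diagram.relabel_noVac _ _ _) E B X δ
    · convert sum_amplitude_empty (Fintype.equivFinOfCardEq hcard) E

theorem corrShift_eq_noVac [DecidableEq W] [Nonempty W] (hD : 2 ≤ D) (E : Momentum I → ℝ)
    {B : ColouredGraph D W K} (hB : B.Connected) (X : W → Momentum I) (δ : W → Fin D → ℝ) :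
    corrShift E B X δ =
      expSeries fun n => Diagram.bdrySum (V := Fin n) Diagram.NoVac E B X δ := by
  classical
  rw [corrShift_eq_expSeries hD]
  congr 1
  funext n
  unfold Diagram.bdrySum
  refine Finset.sum_congr (Finset.filter_congr fun Γ _ => ?_) fun _ _ => rfl
  exact and_congr_left fun h => (h.noVac_iff_conn hB).symm

end VacuumFactorization

/-! ### Removing the vertex at a leg -/

theorem Equiv.removeNone_iff {W K : Type*} {P : Option W → Prop} {G : Option K → Prop}
    (e : Option W ≃ Option K) (h : ∀ x, P x ↔ G (e x)) (h0 : P none ↔ G none) (v : W) :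
    P (some v) ↔ G (some (e.removeNone v)) := by
  rw [h]
  rcases hv : e (some v) with _ | w
  · rw [Equiv.removeNone_none e hv, ← h0, h]
  · rw [Equiv.removeNone_some e ⟨w, hv⟩, hv]

theorem Equiv.optionCongr_removeNone {W K : Type*} (e : Option W ≃ Option K) (h : e none = none) :
    e.removeNone.optionCongr = e := by
  ext1 x
  rcases x with _ | v
  · simp [h]
  · have hv : ∃ w, e (some v) = some w := by
      rw [← Option.ne_none_iff_exists']
      intro hv
      have := e.injective (hv.trans h.symm)
      simp at this
    simpa using Equiv.removeNone_some e hv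

namespace ColouredGraph

variable {D : ℕ} {W K : Type} [DecidableEq K]

/-- The graph obtained by removing a white vertex `none` and a black vertex `none` after the
`a`-coloured edges at the black vertices `none` and `α` have been swapped; broken edges of the same
colour are glued. -/
def glue (C : ColouredGraph D (Option W) (Option K)) (a : Fin D) (α : K) :
    ColouredGraph D W K :=
  ⟨fun c => ((C.swapEdges a none (some α)).edge c).removeNone⟩

end ColouredGraph

namespace Diagram

variable {D : ℕ} {W K V : Type} {I : Fin D → Finset ℤ}

/-- The starting points of the propagators of a diagram with an additional vertex `none`: one of
the two fields `φ̄` of this vertex is singled out, the other one replaces a leg `none`. -/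
def sourceEquiv (W V : Type) (ε : Bool) : W ⊕ Option V × Bool ≃ Option (Option W ⊕ V × Bool) where
  toFun := Sum.elim (fun v => some (Sum.inl (some v)))
    fun h => h.1.elim (if h.2 = ε then none else some (Sum.inl none))
      fun j => some (Sum.inr (j, h.2))
  invFun x := x.elim (Sum.inr (none, ε))
    (Sum.elim (fun v => v.elim (Sum.inr (none, !ε)) Sum.inl) fun h => Sum.inr (some h.1, h.2))
  left_inv := by
    rintro (v | ⟨_ | j, b⟩)
    · rfl
    · by_cases hb : b = ε
      · simp [hb]
      · have : b = !ε := Bool.eq_not.2 hb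
        simp [this]
    · rfl
  right_inv := by
    rintro (_ | (_ | v) | ⟨j, b⟩) <;> simp

/-- The end points of the propagators of a diagram with an additional vertex `none`, of which the
fields `φ` replace the leg `α` and a leg `none`. -/
def targetEquiv (V : Type) [DecidableEq K] (α : K) (ε : Bool) :
    K ⊕ Option V × Bool ≃ Option (Option K ⊕ V × Bool) where
  toFun := Sum.elim (fun w => if w = α then none else some (Sum.inl (some w)))
    fun h => h.1.elim (if h.2 = ε then some (Sum.inl (some α)) else some (Sum.inl none))
      fun j => some (Sum.inr (j, h.2))
  invFun x := x.elim (Sum.inl α)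
    (Sum.elim (fun w => w.elim (Sum.inr (none, !ε))
      fun w => if w = α then Sum.inr (none, ε) else Sum.inl w) fun h => Sum.inr (some h.1, h.2))
  left_inv := by
    rintro (w | ⟨_ | j, b⟩)
    · by_cases hw : w = α <;> simp [hw]
    · by_cases hb : b = ε
      · simp [hb]
      · have : b = !ε := Bool.eq_not.2 hb
        simp [this]
    · rfl
  right_inv := by
    rintro (_ | (_ | w) | ⟨j, b⟩)
    · simp
    · simp
    · by_cases hw : w = α <;> simp [hw]
    · simp

/-- The starting points of the propagators, after the insertion of a vertex. -/
def lift (ε : Bool) (x : Option W ⊕ V × Bool) : W ⊕ Option V × Bool :=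
  (sourceEquiv W V ε).symm (some x)

@[simp] theorem lift_inl_none (ε : Bool) :
    (lift ε (Sum.inl none) : W ⊕ Option V × Bool) = Sum.inr (none, !ε) := rfl

variable [DecidableEq K]

/-- Attach a vertex `none` of colour `a` to the legs `none` and `α`: the field `φ̄` labelled `ε` is
joined to the new leg `α`, the other field `φ̄` replaces the `J`-leg `none`; the field `φ` labelled
`ε` replaces the old leg `α`, the other field `φ` replaces the `J̄`-leg `none`. -/
def insertVertex (α : K) (ε : Bool) (a : Fin D) (Γ : Diagram D (Option W) (Option K) V) :
    Diagram D W K (Option V) where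
  colour i := i.elim a Γ.colour
  propagator := (sourceEquiv W V ε).trans
    (Γ.propagator.optionCongr.trans (targetEquiv V α ε).symm)

section InsertVertex

variable (α : K) (ε : Bool) (a : Fin D) (Γ : Diagram D (Option W) (Option K) V)

@[simp] theorem insertVertex_propagator_symm_inl_self :
    (insertVertex α ε a Γ).propagator.symm (Sum.inl α) = Sum.inr (none, ε) := by
  simp [insertVertex, targetEquiv, sourceEquiv, ← Equiv.optionCongr_symm]

theorem insertVertex_propagator_symm_inl {w : K} (hw : w ≠ α) :
    (insertVertex α ε a Γ).propagator.symm (Sum.inl w) =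
      lift ε (Γ.propagator.symm (Sum.inl (some w))) := by
  simp [insertVertex, targetEquiv, hw, lift, ← Equiv.optionCongr_symm]

@[simp] theorem insertVertex_propagator_symm_inr_self :
    (insertVertex α ε a Γ).propagator.symm (Sum.inr (none, ε)) =
      lift ε (Γ.propagator.symm (Sum.inl (some α))) := by
  simp [insertVertex, targetEquiv, lift, ← Equiv.optionCongr_symm]

@[simp] theorem insertVertex_propagator_symm_inr_not :
    (insertVertex α ε a Γ).propagator.symm (Sum.inr (none, !ε)) =
      lift ε (Γ.propagator.symm (Sum.inl none)) := by
  simp [insertVertex, targetEquiv, lift, ← Equiv.optionCongr_symm]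

@[simp] theorem insertVertex_propagator_symm_inr_some (j : V) (b : Bool) :
    (insertVertex α ε a Γ).propagator.symm (Sum.inr (some j, b)) =
      lift ε (Γ.propagator.symm (Sum.inr (j, b))) := by
  simp [insertVertex, targetEquiv, lift, ← Equiv.optionCongr_symm]

theorem insertVertex_respects (R : Fin D → W ⊕ Option V × Bool → W ⊕ Option V × Bool → Prop) :
    (insertVertex α ε a Γ).Respects R ↔
      Γ.Respects (fun c x y => R c (lift ε x) (lift ε y)) ∧ ∀ c,
        R c (lift ε (Γ.propagator.symm (Sum.inl (some α))))
          (if c = a then lift ε (Sum.inl none) else Sum.inr (none, ε)) ∧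
        R c (lift ε (Γ.propagator.symm (Sum.inl none)))
          (if c = a then Sum.inr (none, ε) else lift ε (Sum.inl none)) := by
  have h1 : ∀ c, Sum.inr ((insertVertex α ε a Γ).vertexEdge c (none, ε)) =
      (if c = a then lift ε (Sum.inl none) else Sum.inr (none, ε) : W ⊕ Option V × Bool) := by
    intro c
    by_cases hc : c = a <;> simp [vertexEdge, insertVertex, hc]
  have h2 : ∀ c, Sum.inr ((insertVertex α ε a Γ).vertexEdge c (none, !ε)) =
      (if c = a then Sum.inr (none, ε) else lift ε (Sum.inl none) : W ⊕ Option V × Bool) := by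
    intro c
    by_cases hc : c = a <;> simp [vertexEdge, insertVertex, hc]
  constructor
  · intro H
    refine ⟨fun h c => ?_, fun c => ⟨?_, ?_⟩⟩
    · have h3 := H (some h.1, h.2) c
      rw [insertVertex_propagator_symm_inr_some] at h3
      exact h3
    · simpa only [h1, insertVertex_propagator_symm_inr_self] using H (none, ε) c
    · simpa only [h2, insertVertex_propagator_symm_inr_not] using H (none, !ε) c
  · rintro ⟨H1, H2⟩ ⟨_ | j, b⟩ c
    · by_cases hb : b = ε
      · subst hb
        rw [h1, insertVertex_propagator_symm_inr_self]
        exact (H2 c).1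
      · obtain rfl : b = !ε := Bool.eq_not.2 hb
        rw [h2, insertVertex_propagator_symm_inr_not]
        exact (H2 c).2
    · rw [insertVertex_propagator_symm_inr_some]
      exact H1 (j, b) c

theorem insertVertex_isSplit (f : W → Prop) (g : K → Prop) (h : Option V → Prop) :
    (insertVertex α ε a Γ).IsSplit f g h ↔ (h none ↔ g α) ∧
      Γ.IsSplit (fun v => v.elim (h none) f) (fun w => w.elim (h none) g)
        (fun j => h (some j)) := by
  unfold IsSplit
  rw [← (sourceEquiv W V ε).symm.forall_congr_right, Option.forall]
  have h1 : ∀ x : Option W ⊕ V × Bool,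
      Sum.elim f (fun x => h x.1) ((sourceEquiv W V ε).symm (some x)) ↔
      Sum.elim (fun v => v.elim (h none) f) (fun x => h (some x.1)) x := by
    rintro ((_ | v) | x) <;> rfl
  have h0 : Sum.elim f (fun x => h x.1) ((sourceEquiv W V ε).symm none) ↔ h none := Iff.rfl
  have h3 : (insertVertex α ε a Γ).propagator ((sourceEquiv W V ε).symm none) = Sum.inl α := by
    simp [insertVertex, targetEquiv]
  have h4 : ∀ x, (insertVertex α ε a Γ).propagator ((sourceEquiv W V ε).symm (some x)) =
      (targetEquiv V α ε).symm (some (Γ.propagator x)) := by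
    intro x
    simp [insertVertex]
  rw [h3, h0, Sum.elim_inl]
  refine and_congr_right fun h0α => forall_congr' fun x => ?_
  have h2 : ∀ x : Option K ⊕ V × Bool,
      Sum.elim g (fun x => h x.1) ((targetEquiv V α ε).symm (some x)) ↔
      Sum.elim (fun w => w.elim (h none) g) (fun x => h (some x.1)) x := by
    rintro ((_ | w) | x)
    · rfl
    · by_cases hw : w = α
      · subst hw
        simpa [targetEquiv] using h0α
      · simp [targetEquiv, hw]
    · rfl
  rw [h1, h4, h2]

theorem insertVertex_noVac : (insertVertex α ε a Γ).NoVac ↔ Γ.NoVac := by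
  have hcW : (fun v : Option W => v.elim False fun _ => False) = fun _ => False := by
    funext v; cases v <;> rfl
  have hcK : (fun v : Option K => v.elim False fun _ => False) = fun _ => False := by
    funext v; cases v <;> rfl
  constructor
  · intro H h hs v
    refine H (fun o => o.elim False h) ?_ (some v)
    rw [insertVertex_isSplit]
    simpa [hcW, hcK] using hs
  · intro H h hs
    rw [insertVertex_isSplit] at hs
    have h0 : h none = False := by simpa using hs.1
    rw [h0, hcW, hcK] at hs
    rintro (_ | v)
    · simp [h0]
    · exact H _ hs.2 v

theorem insertVertex_hasBdry {C : ColouredGraph D (Option W) (Option K)} (hC : Γ.HasBdry C) :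
    (insertVertex α ε a Γ).HasBdry (C.glue a α) := by
  intro c v f hf
  obtain ⟨hf1, hf2⟩ := (insertVertex_respects α ε a Γ _).1 hf
  have hC' : ∀ x, f (lift ε (Sum.inl x)) ↔ f (lift ε (Γ.propagator.symm (Sum.inl (C.edge c x)))) :=
    fun x => hC c x (fun y => f (lift ε y)) hf1
  obtain ⟨ht, hu⟩ := hf2 c
  replace ht := ht rfl
  replace hu := hu rfl
  have hα := insertVertex_propagator_symm_inl_self α ε a Γ
  change f (lift ε (Sum.inl (some v))) ↔
    f ((insertVertex α ε a Γ).propagator.symm (Sum.inl ((C.glue a α).edge c v)))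
  refine Equiv.removeNone_iff (P := fun x => f (lift ε (Sum.inl x)))
    (G := fun y => y.elim (f (lift ε (Sum.inl none)))
      fun w => f ((insertVertex α ε a Γ).propagator.symm (Sum.inl w)))
    ((C.swapEdges a none (some α)).edge c) (fun x => ?_) Iff.rfl v
  rw [hC']
  have hne : ∀ w, w ≠ α → (f (lift ε (Γ.propagator.symm (Sum.inl (some w)))) ↔
      f ((insertVertex α ε a Γ).propagator.symm (Sum.inl w))) := by
    intro w hw
    rw [insertVertex_propagator_symm_inl α ε a Γ hw]
  by_cases hc : c = a
  · rw [if_pos hc] at ht hu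
    have hx : (C.swapEdges a none (some α)).edge c x =
        Equiv.swap none (some α) (C.edge c x) := by
      simp [ColouredGraph.swapEdges, hc]
    rw [hx]
    rcases C.edge c x with _ | w
    · rw [Equiv.swap_apply_left, hu]
      simp [hα]
    · by_cases hw : w = α
      · subst hw
        rw [Equiv.swap_apply_right, ht]
        simp
      · rw [Equiv.swap_apply_of_ne_of_ne (by simp) (by simpa using hw)]
        exact hne w hw
  · rw [if_neg hc] at ht hu
    have hx : (C.swapEdges a none (some α)).edge c x = C.edge c x := by
      simp [ColouredGraph.swapEdges, hc]
    rw [hx]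
    rcases C.edge c x with _ | w
    · rw [hu]
      simp
    · by_cases hw : w = α
      · subst hw
        rw [ht]
        simp [hα]
      · exact hne w hw

theorem insertVertex_injective {a a' : Fin D} {Γ Γ' : Diagram D (Option W) (Option K) V}
    (h : insertVertex α ε a Γ = insertVertex α ε a' Γ') : a = a' ∧ Γ = Γ' := by
  have hc : ∀ i, (insertVertex α ε a Γ).colour i = (insertVertex α ε a' Γ').colour i := by simp [h]
  have hp : ∀ u, (insertVertex α ε a Γ).propagator.symm u =
      (insertVertex α ε a' Γ').propagator.symm u := by simp [h]
  refine ⟨hc none, Diagram.ext (funext fun i => hc (some i)) ?_⟩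
  rw [← Equiv.symm_bijective.injective.eq_iff]
  ext1 u
  have := hp ((targetEquiv V α ε).symm (some u))
  simpa [insertVertex, ← Equiv.optionCongr_symm] using this

theorem exists_eq_insertVertex {Γ : Diagram D W K (Option V)}
    (h : Γ.propagator.symm (Sum.inl α) = Sum.inr (none, ε)) :
    ∃ a Γ', Γ = insertVertex α ε a Γ' := by
  set e := (sourceEquiv W V ε).symm.trans (Γ.propagator.trans (targetEquiv V α ε)) with he
  have h0 : e none = none := by
    have h1 : (sourceEquiv W V ε).symm none = Γ.propagator.symm (Sum.inl α) := h.symm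
    simp only [he, Equiv.trans_apply, h1, Equiv.apply_symm_apply]
    simp [targetEquiv]
  refine ⟨Γ.colour none, ⟨fun i => Γ.colour (some i), e.removeNone⟩, Diagram.ext ?_ ?_⟩
  · funext i
    cases i <;> rfl
  · simp only [insertVertex]
    rw [e.optionCongr_removeNone h0]
    ext; simp [he]

end InsertVertex

/-- The conditions on the momentum `z` of the leg `none` that express the conservation of momenta
at an inserted vertex of colour `a`, if the leg `α` has the momentum `s`. -/
def Conserves (C : ColouredGraph D (Option W) (Option K)) (a : Fin D) (α : K) (s : Momentum I)
    (X : W → Momentum I) (z : Momentum I) : Prop :=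
  ∀ c, C.target (fun v => v.elim z X) (some α) c = (if c = a then z c else s c) ∧
    C.target (fun v => v.elim z X) none c = if c = a then s c else z c

open Classical in
/-- The amplitude after the insertion of a vertex: the propagator at the leg `α` is split off, and
the momentum of the leg `none` is summed over. -/
theorem insertVertex_amplitude [Fintype W] [Fintype V] (α : K) (ε : Bool) (a : Fin D)
    {Γ : Diagram D (Option W) (Option K) V} {C : ColouredGraph D (Option W) (Option K)}
    (hC : Γ.HasBdry C) (E : Momentum I → ℝ) (X : W → Momentum I) :
    (insertVertex α ε a Γ).amplitude E X 0 = (E ((C.glue a α).target X α))⁻¹ *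
      ∑ z ∈ (Finset.univ : Finset (Momentum I)).filter
          (Conserves C a α ((C.glue a α).target X α) X),
        Γ.amplitude E (fun v => v.elim z X) 0 := by
  set s := (C.glue a α).target X α with hs
  -- a flow consists of the momentum `s` at the leg `α` and of a flow on the smaller diagram
  have hflow : ∀ (q : Option W ⊕ V × Bool → Momentum I),
      (∀ v, q (Sum.inl (some v)) = X v) →
      ((insertVertex α ε a Γ).IsFlow (fun u => (sourceEquiv W V ε u).elim s q) ↔
        Γ.IsFlow q ∧ Conserves C a α s X (q (Sum.inl none))) := by
    intro q hq
    have hlift : ∀ x, (sourceEquiv W V ε (lift ε x)).elim s q = q x := by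
      intro x
      simp [lift]
    have hnone : (sourceEquiv W V ε (Sum.inr (none, ε))).elim s q = s := by
      simp [sourceEquiv]
    have hX : (fun v : Option W => q (Sum.inl v)) = fun v => v.elim (q (Sum.inl none)) X := by
      funext v
      rcases v with _ | v
      · rfl
      · exact hq v
    rw [IsFlow, insertVertex_respects]
    simp only [hlift]
    refine and_congr_right fun hfl => forall_congr' fun c => ?_
    have h1 := hC.flow_eq (p := q) hfl
    rw [hX] at h1
    rw [h1, h1]
    by_cases hc : c = a
    · simp only [if_pos hc, hnone, hlift]
    · simp only [if_neg hc, hnone, hlift]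
  have hnone : ∀ p : W ⊕ Option V × Bool → Momentum I, (∀ v, p (Sum.inl v) = X v) →
      (insertVertex α ε a Γ).IsFlow p → p (Sum.inr (none, ε)) = s := by
    intro p hp hfl
    have h1 := (insertVertex_hasBdry α ε a Γ hC).flow_eq hfl α
    rw [insertVertex_propagator_symm_inl_self, funext hp] at h1
    exact h1
  rw [Finset.mul_sum]
  simp only [amplitude, Finset.mul_sum]
  rw [Finset.sum_sigma']
  refine (Finset.sum_bij' (fun x _ u => (sourceEquiv W V ε u).elim s x.2)
    (fun p _ => ⟨p (lift ε (Sum.inl none)), fun x => p (lift ε x)⟩) ?_ ?_ ?_ ?_ ?_).symm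
  · rintro ⟨z, q⟩ hx
    simp only [Finset.mem_sigma, Finset.mem_filter, Finset.mem_univ, true_and] at hx ⊢
    obtain ⟨hz, hq, hfl⟩ := hx
    refine ⟨fun v => ?_, (hflow q fun v => hq (some v)).2 ⟨hfl, ?_⟩⟩
    · exact hq (some v)
    · rw [hq none]
      exact hz
  · intro p hp
    simp only [Finset.mem_sigma, Finset.mem_filter, Finset.mem_univ, true_and] at hp ⊢
    have h1 : (fun u => (sourceEquiv W V ε u).elim s fun x => p (lift ε x)) = p := by
      funext u
      obtain ⟨x, rfl⟩ := (sourceEquiv W V ε).symm.surjective u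
      rcases x with _ | x
      · rw [Equiv.apply_symm_apply]
        exact (hnone p hp.1 hp.2).symm
      · simp [lift]
    have h2 := hflow (fun x => p (lift ε x)) hp.1
    rw [h1] at h2
    obtain ⟨h3, h4⟩ := h2.1 hp.2
    refine ⟨h4, ?_, h3⟩
    rintro (_ | v)
    · rfl
    · exact hp.1 v
  · rintro ⟨z, q⟩ hx
    simp only [Finset.mem_sigma, Finset.mem_filter, Finset.mem_univ, true_and] at hx
    have h1 : (fun x => (sourceEquiv W V ε (lift ε x)).elim s q) = q := by
      funext x
      simp [lift]
    have h2 : (sourceEquiv W V ε (lift ε (Sum.inl none))).elim s q = z := by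
      rw [congrFun h1]
      exact hx.2.1 none
    simp only [h1, h2]
  · intro p hp
    simp only [Finset.mem_filter, Finset.mem_univ, true_and] at hp
    funext u
    obtain ⟨x, rfl⟩ := (sourceEquiv W V ε).symm.surjective u
    rcases x with _ | x
    · rw [Equiv.apply_symm_apply]
      exact (hnone p hp.1 hp.2).symm
    · simp [lift]
  · rintro ⟨z, q⟩ hx
    rw [← (sourceEquiv W V ε).symm.prod_comp, Fintype.prod_option]
    simp

end Diagram

/-! ### The recursion in the number of vertices -/

namespace Diagram

variable {D : ℕ} {W K V : Type} {I : Fin D → Finset ℤ}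
variable [Fintype W] [Fintype K] [Fintype V]

open Classical in
/-- The sum over the diagrams from which a diagram with boundary `B` arises by the insertion of a
vertex of colour `a` at the leg `α`. -/
noncomputable def insertionSum [DecidableEq K] (V : Type) [Fintype V] (E : Momentum I → ℝ)
    (B : ColouredGraph D W K) (X : W → Momentum I) (α : K) (a : Fin D) : ℝ :=
  ∑ C ∈ (Finset.univ : Finset (ColouredGraph D (Option W) (Option K))).filter
      (fun C => C.glue a α = B),
    ∑ z ∈ (Finset.univ : Finset (Momentum I)).filter (Conserves C a α (B.target X α) X),
      bdrySum (V := V) NoVac E C (fun v => v.elim z X) 0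

open Classical in
/-- The diagrams whose leg `α` is joined to the field `ε` of the vertex `none` are exactly those
that arise by the insertion of a vertex. -/
theorem sum_insertVertex [DecidableEq K] (E : Momentum I → ℝ) (B : ColouredGraph D W K)
    (X : W → Momentum I) (α : K) (ε : Bool) :
    ∑ Γ ∈ (Finset.univ : Finset (Diagram D W K (Option V))).filter (fun Γ =>
      (Γ.NoVac ∧ Γ.HasBdry B) ∧ Γ.propagator.symm (Sum.inl α) = Sum.inr (none, ε)),
      Γ.amplitude E X 0 = (E (B.target X α))⁻¹ * ∑ a, insertionSum V E B X α a := by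
  have h1 : ∑ Γ ∈ (Finset.univ : Finset (Diagram D W K (Option V))).filter (fun Γ =>
      (Γ.NoVac ∧ Γ.HasBdry B) ∧ Γ.propagator.symm (Sum.inl α) = Sum.inr (none, ε)),
      Γ.amplitude E X 0 = ∑ a : Fin D,
        ∑ Γ ∈ (Finset.univ : Finset (Diagram D (Option W) (Option K) V)).filter
          (fun Γ => Γ.NoVac ∧ Γ.bdry.glue a α = B), (insertVertex α ε a Γ).amplitude E X 0 := by
    rw [Finset.sum_sigma']
    refine (Finset.sum_bij (fun x _ => insertVertex α ε x.1 x.2) ?_ ?_ ?_ ?_).symm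
    · rintro ⟨a, Γ⟩ hx
      simp only [Finset.mem_sigma, Finset.mem_filter, Finset.mem_univ, true_and] at hx ⊢
      refine ⟨⟨(insertVertex_noVac α ε a Γ).2 hx.1, ?_⟩,
        insertVertex_propagator_symm_inl_self α ε a Γ⟩
      rw [← hx.2]
      exact insertVertex_hasBdry α ε a Γ Γ.hasBdry_bdry
    · rintro ⟨a, Γ⟩ _ ⟨a', Γ'⟩ _ h
      obtain ⟨rfl, rfl⟩ := insertVertex_injective α ε h
      rfl
    · intro Γ hΓ
      simp only [Finset.mem_filter, Finset.mem_univ, true_and] at hΓ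
      obtain ⟨a, Γ', rfl⟩ := exists_eq_insertVertex α ε hΓ.2
      refine ⟨⟨a, Γ'⟩, ?_, rfl⟩
      simp only [Finset.mem_sigma, Finset.mem_filter, Finset.mem_univ, true_and]
      refine ⟨(insertVertex_noVac α ε a Γ').1 hΓ.1.1, ?_⟩
      rw [← hasBdry_iff.1 (insertVertex_hasBdry α ε a Γ' Γ'.hasBdry_bdry)]
      exact hasBdry_iff.1 hΓ.1.2
    · simp
  rw [h1, Finset.mul_sum]
  refine Finset.sum_congr rfl fun a _ => ?_
  have h2 : ∀ Γ ∈ (Finset.univ : Finset (Diagram D (Option W) (Option K) V)).filter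
      (fun Γ => Γ.NoVac ∧ Γ.bdry.glue a α = B), (insertVertex α ε a Γ).amplitude E X 0 =
      ∑ C ∈ (Finset.univ : Finset (ColouredGraph D (Option W) (Option K))).filter
        (fun C => C.glue a α = B), if Γ.HasBdry C then (E (B.target X α))⁻¹ *
          ∑ z ∈ (Finset.univ : Finset (Momentum I)).filter (Conserves C a α (B.target X α) X),
            Γ.amplitude E (fun v => v.elim z X) 0 else 0 := by
    intro Γ hΓ
    simp only [Finset.mem_filter, Finset.mem_univ, true_and] at hΓ
    rw [Finset.sum_eq_single Γ.bdry, if_pos Γ.hasBdry_bdry,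
      insertVertex_amplitude α ε a Γ.hasBdry_bdry, hΓ.2]
    · intro C _ hne
      rw [if_neg fun h => hne (hasBdry_iff.1 h).symm]
    · intro h
      simp [hΓ.2] at h
  rw [Finset.sum_congr rfl h2, Finset.sum_comm, insertionSum, Finset.mul_sum]
  refine Finset.sum_congr rfl fun C hC => ?_
  have hC' : C.glue a α = B := by simpa using hC
  unfold bdrySum
  rw [← Finset.sum_filter, Finset.filter_filter, Finset.sum_comm, Finset.mul_sum]
  refine Finset.sum_congr (Finset.ext fun Γ => ?_) fun Γ _ => ?_
  · simp only [Finset.mem_filter, Finset.mem_univ, true_and]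
    constructor
    · rintro ⟨⟨h1, -⟩, h2⟩
      exact ⟨h1, h2⟩
    · rintro ⟨h1, h2⟩
      exact ⟨⟨h1, by rw [hasBdry_iff.1 h2, hC']⟩, h2⟩
  · rfl

open Classical in
/-- In a connected diagram with at least one vertex, every leg is attached to a vertex; summing over
this vertex and its field gives `2 (|V| + 1)` equal contributions. -/
theorem bdrySum_option [DecidableEq K] [Nonempty W] (E : Momentum I → ℝ)
    {B : ColouredGraph D W K} (hB : B.Connected) (X : W → Momentum I) (α : K) :
    bdrySum (V := Option V) NoVac E B X 0 = (2 * (Fintype.card V + 1) : ℕ) *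
      ((E (B.target X α))⁻¹ * ∑ a, insertionSum V E B X α a) := by
  have h1 : ∀ Γ ∈ (Finset.univ : Finset (Diagram D W K (Option V))).filter
      (fun Γ => Γ.NoVac ∧ Γ.HasBdry B), Γ.amplitude E X 0 =
      ∑ h : Option V × Bool, if Γ.propagator.symm (Sum.inl α) = Sum.inr h then
        Γ.amplitude E X 0 else 0 := by
    intro Γ hΓ
    simp only [Finset.mem_filter, Finset.mem_univ, true_and] at hΓ
    rcases hα : Γ.propagator.symm (Sum.inl α) with v | h
    · -- a propagator joining two legs would be a component without vertices
      have hconn := (hΓ.2.noVac_iff_conn hB).1 hΓ.1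
      have hπ : Γ.propagator (Sum.inl v) = Sum.inl α := by rw [← hα]; simp
      rcases hconn.2 (fun w => w = v) (fun k => k = α) (fun _ => False) (by
        intro u
        by_cases hu : u = Sum.inl v
        · rw [hu, hπ]; simp
        · have hu' : Γ.propagator u ≠ Sum.inl α := by
            rw [← hπ]
            simpa using hu
          rcases u with u | u <;> rcases hx : Γ.propagator _ with x | x <;>
            simp_all) with ⟨-, -, h⟩ | ⟨h, -⟩
      · exact (h none).elim
      · exact (h v rfl).elim
    · rw [Finset.sum_eq_single h]
      · simp
      · intro h' _ hne
        rw [if_neg]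
        simpa using hne.symm
      · simp
  rw [bdrySum, Finset.sum_congr rfl h1, Finset.sum_comm]
  have h2 : ∀ h : Option V × Bool,
      ∑ Γ ∈ (Finset.univ : Finset (Diagram D W K (Option V))).filter
        (fun Γ => Γ.NoVac ∧ Γ.HasBdry B), (if Γ.propagator.symm (Sum.inl α) = Sum.inr h then
          Γ.amplitude E X 0 else 0) =
      (E (B.target X α))⁻¹ * ∑ a, insertionSum V E B X α a := by
    rintro ⟨i, ε⟩
    rw [← sum_insertVertex E B X α ε, ← Finset.sum_filter, Finset.filter_filter]
    refine Finset.sum_equiv (relabelEquiv (Equiv.refl W) (Equiv.refl K) (Equiv.swap i none))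
      ?_ ?_
    · intro Γ
      simp only [Finset.mem_filter, Finset.mem_univ, true_and]
      refine and_congr (and_congr ?_ ?_) ?_
      · exact (relabel_noVac _ _ _ Γ).symm
      · exact (relabel_hasBdry (Equiv.refl W) (Equiv.refl K) (Equiv.swap i none) Γ B).symm
      · have h3 : (relabelEquiv (Equiv.refl W) (Equiv.refl K) (Equiv.swap i none)
            Γ).propagator.symm (Sum.inl α) = halfEquiv (Equiv.refl W) (Equiv.swap i none)
              (Γ.propagator.symm (Sum.inl α)) := rfl
        have h4 : (Sum.inr (none, ε) : W ⊕ Option V × Bool) =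
            halfEquiv (Equiv.refl W) (Equiv.swap i none) (Sum.inr (i, ε)) := by simp
        rw [h3, h4, Equiv.apply_eq_iff_eq]
    · intro Γ _
      exact (relabel_amplitude (Equiv.refl W) (Equiv.refl K) (Equiv.swap i none) Γ E X 0).symm
  rw [Finset.sum_congr rfl fun h _ => h2 h, Finset.sum_const, nsmul_eq_mul, Finset.card_univ,
    Fintype.card_prod, Fintype.card_option, Fintype.card_bool, mul_comm 2]

/-- A diagram without vertices whose boundary graph is connected is a single propagator. -/
theorem bdrySum_isEmpty [IsEmpty V] (hD : 0 < D) (E : Momentum I → ℝ)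
    {B : ColouredGraph D W K} (hB : B.Connected) (X : W → Momentum I) (α : K) :
    bdrySum (V := V) NoVac E B X 0 =
      if Fintype.card W = 1 then (E (B.target X α))⁻¹ else 0 := by
  classical
  unfold bdrySum
  set a : Fin D := ⟨0, hD⟩
  split_ifs with hW
  · obtain ⟨v, hv⟩ := Fintype.card_eq_one_iff.1 hW
    have : Subsingleton W := ⟨fun x y => (hv x).trans (hv y).symm⟩
    have : Subsingleton K := (B.edge a).symm.subsingleton
    have : Subsingleton (Diagram D W K V) := ⟨fun Γ Γ' =>
      Diagram.ext (Subsingleton.elim _ _) (Equiv.ext fun u => by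
        rcases Γ.propagator u with k | k
        · rcases Γ'.propagator u with k' | k'
          · rw [Subsingleton.elim k k']
          · exact isEmptyElim k'.1
        · exact isEmptyElim k.1)⟩
    let Γ : Diagram D W K V := ⟨fun i => isEmptyElim i,
      (Equiv.sumEmpty W (V × Bool)).trans ((B.edge a).trans (Equiv.sumEmpty K (V × Bool)).symm)⟩
    have hΓ : Γ.HasBdry B := by
      intro c w f _
      rcases Γ.propagator.symm (Sum.inl (B.edge c w)) with x | x
      · rw [Subsingleton.elim w x]
      · exact isEmptyElim x.1
    rw [Finset.sum_eq_single Γ]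
    · have hX : ∀ w, X w = B.target X α := by
        intro w
        funext c
        rw [ColouredGraph.target, Subsingleton.elim w]
      rw [amplitude, Finset.sum_eq_single (fun _ => B.target X α)]
      · rw [Fintype.prod_sum_type, Fintype.prod_subsingleton _ v, Fintype.prod_empty]
        simp
      · intro p hp hne
        refine (hne ?_).elim
        funext u
        rcases u with u | u
        · rw [← hX u]
          exact (Finset.mem_filter.1 hp).2.1 u
        · exact isEmptyElim u.1
      · intro h
        refine (h ?_).elim
        simp only [Finset.mem_filter, Finset.mem_univ, true_and]
        exact ⟨fun w => (hX w).symm, fun h => isEmptyElim h.1⟩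
    · intro Γ' _ hne
      exact (hne (Subsingleton.elim _ _)).elim
    · intro h
      refine (h ?_).elim
      simp only [Finset.mem_filter, Finset.mem_univ, true_and]
      exact ⟨fun _ _ v => isEmptyElim v, hΓ⟩
  · refine Finset.sum_eq_zero fun Γ hΓ => (hW ?_).elim
    simp only [Finset.mem_filter, Finset.mem_univ, true_and] at hΓ
    set v := (B.edge a).symm α
    have : Nonempty W := ⟨v⟩
    have hconn := (hΓ.2.noVac_iff_conn hB).1 hΓ.1
    rcases hα : Γ.propagator (Sum.inl v) with k | x
    · rcases hconn.2 (fun w => w = v) (fun w => w = k) (fun _ => False) (by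
        intro u
        by_cases hu : u = Sum.inl v
        · rw [hu, hα]; simp
        · have hu' : Γ.propagator u ≠ Sum.inl k := by
            rw [← hα]
            simpa using hu
          rcases u with u | u <;> rcases hx : Γ.propagator _ with x | x <;>
            simp_all) with ⟨h, -⟩ | ⟨h, -⟩
      · exact Fintype.card_eq_one_iff.2 ⟨v, h⟩
      · exact (h v rfl).elim
    · exact isEmptyElim x.1

end Diagram

section Recursion

variable {D : ℕ} {W K : Type} {I : Fin D → Finset ℤ} [Fintype W] [Fintype K]

/-- The field equation: the propagator ending at the leg `α` of a connected diagram either is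
the whole diagram or starts at a vertex. -/
theorem corr_eq_insertion [DecidableEq W] [DecidableEq K] (hD : 2 ≤ D) (E : Momentum I → ℝ)
    {B : ColouredGraph D W K} (hB : B.Connected) (X : W → Momentum I) (α : K) :
    corr E B X = PowerSeries.C (if Fintype.card W = 1 then 1 / E (B.target X α) else 0) +
      PowerSeries.C (-2 / E (B.target X α)) * PowerSeries.X *
        ∑ a, expSeries fun n => Diagram.insertionSum (Fin n) E B X α a := by
  have : Nonempty W := ⟨(B.edge ⟨0, by omega⟩).symm α⟩
  rw [corr, corrShift_eq_noVac hD E hB]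
  ext n
  rcases n with _ | n
  · rw [map_add, mul_assoc, PowerSeries.coeff_C_mul, PowerSeries.coeff_zero_X_mul, mul_zero,
      add_zero, PowerSeries.coeff_zero_C, expSeries, PowerSeries.coeff_mk,
      Diagram.bdrySum_isEmpty (by omega) E hB X α]
    simp
  · have h1 : Diagram.bdrySum (V := Fin (n + 1)) Diagram.NoVac E B X 0 =
        Diagram.bdrySum (V := Option (Fin n)) Diagram.NoVac E B X 0 :=
      Diagram.bdrySum_vertices (finSuccEquiv n) (Diagram.relabel_noVac _ _ _) E B X 0
    rw [map_add, mul_assoc, PowerSeries.coeff_C_mul, PowerSeries.coeff_succ_X_mul, map_sum,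
      PowerSeries.coeff_C, if_neg (Nat.succ_ne_zero n), zero_add]
    simp only [expSeries, PowerSeries.coeff_mk]
    rw [h1, Diagram.bdrySum_option E hB X α, Fintype.card_fin, ← Finset.mul_sum,
      Nat.factorial_succ, pow_succ]
    have h2 : (n.factorial : ℝ) ≠ 0 := by exact_mod_cast n.factorial_ne_zero
    have h3 : (n + 1 : ℝ) ≠ 0 := by exact_mod_cast n.succ_ne_zero
    push_cast
    by_cases hE : E (B.target X α) = 0
    · simp [hE]
    · field_simp

end Recursion

/-! ### Cutting a propagator -/

theorem Equiv.removeNone_trans_swap {W K : Type*} [DecidableEq K] (e : Option W ≃ Option K)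
    {ρ : K} (h : e none = some ρ) (α : K) :
    (e.trans (Equiv.swap none (some α))).removeNone = e.removeNone.trans (Equiv.swap α ρ) := by
  set e' := e.trans (Equiv.swap none (some α)) with he'
  apply Equiv.ext
  intro v
  have hρ : e (some v) ≠ some ρ := by
    rw [← h]
    simp
  have hswap : ∀ w, w ≠ α → Equiv.swap (none : Option K) (some α) (some w) = some w := fun w hw =>
    Equiv.swap_apply_of_ne_of_ne (by simp) (by simpa using hw)
  rcases hv : e (some v) with _ | w
  · have h1 : some (e.removeNone v) = some ρ := by rw [Equiv.removeNone_none e hv, h]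
    have h2 : e' (some v) = some α := by simp [he', hv]
    have h3 := Equiv.removeNone_some e' ⟨α, h2⟩
    rw [h2] at h3
    apply Option.some_injective
    rw [h3, Equiv.trans_apply, Option.some_injective _ h1, Equiv.swap_apply_right]
  · have h1 : some (e.removeNone v) = some w := by rw [Equiv.removeNone_some e ⟨w, hv⟩, hv]
    have hwρ : w ≠ ρ := by
      rintro rfl
      exact hρ hv
    apply Option.some_injective
    rw [Equiv.trans_apply, Option.some_injective _ h1]
    by_cases hw : w = α
    · subst hw
      have h2 : e' (some v) = none := by simp [he', hv]
      rw [Equiv.removeNone_none e' h2, Equiv.swap_apply_left]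
      simp only [he', Equiv.trans_apply, h]
      exact hswap ρ hwρ.symm
    · have h2 : e' (some v) = some w := by
        simp only [he', Equiv.trans_apply, hv]
        exact hswap w hw
      rw [Equiv.removeNone_some e' ⟨w, h2⟩, h2, Equiv.swap_apply_of_ne_of_ne hw hwρ]

namespace ColouredGraph

variable {D : ℕ} {W K : Type} {I : Fin D → Finset ℤ}

/-- The graph obtained by removing a white vertex `none` and a black vertex `none`; broken edges of
the same colour are glued. -/
def removeNone (C : ColouredGraph D (Option W) (Option K)) : ColouredGraph D W K :=
  ⟨fun c => (C.edge c).removeNone⟩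

variable [DecidableEq K]

theorem swapEdges_swapEdges (B : ColouredGraph D W K) (a : Fin D) (w w' : K) :
    (B.swapEdges a w w').swapEdges a w w' = B := by
  ext c v
  by_cases hc : c = a <;> simp [swapEdges, hc]

theorem glue_eq_swapEdges {C : ColouredGraph D (Option W) (Option K)} {a : Fin D} {ρ : K}
    (h : C.edge a none = some ρ) (α : K) : C.glue a α = C.removeNone.swapEdges a α ρ := by
  ext c v
  by_cases hc : c = a
  · subst hc
    simp [glue, removeNone, swapEdges, Equiv.removeNone_trans_swap _ h]
  · simp [glue, removeNone, swapEdges, hc]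

/-- The graphs that glue to `B`, and in which the `a`-coloured edge at the white vertex `none` ends
at `ρ`, arise from `ς_a(B; α, ρ)` by breaking the `a`-coloured edge at the white vertex joined to
`α` in `B`. -/
theorem glue_iff (C : ColouredGraph D (Option W) (Option K)) (B : ColouredGraph D W K)
    (a : Fin D) (α ρ : K) :
    C.edge a none = some ρ ∧ C.glue a α = B ↔
      C.removeNone = B.swapEdges a α ρ ∧ C.edge a (some ((B.edge a).symm α)) = none := by
  constructor
  · rintro ⟨h, rfl⟩
    refine ⟨?_, ?_⟩
    · rw [glue_eq_swapEdges h, swapEdges_swapEdges]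
    · obtain ⟨v, hv⟩ : ∃ v, C.edge a (some v) = none := by
        obtain ⟨x, hx⟩ := (C.edge a).surjective none
        rcases x with _ | v
        · simp [h] at hx
        · exact ⟨v, hx⟩
      have h1 : (C.glue a α).edge a v = α := by
        have h2 := Equiv.removeNone_none (C.edge a) hv
        rw [h] at h2
        rw [glue_eq_swapEdges h]
        simp [swapEdges, removeNone, Option.some_injective _ h2]
      rw [(Equiv.symm_apply_eq _).2 h1.symm, hv]
  · rintro ⟨h, hγ⟩
    have h1 := Equiv.removeNone_none (C.edge a) hγ
    have h2 : (C.edge a).removeNone = (B.swapEdges a α ρ).edge a := by rw [← h]; rfl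
    rw [h2] at h1
    have h3 : C.edge a none = some ρ := by
      rw [← h1]
      simp [swapEdges]
    exact ⟨h3, by rw [glue_eq_swapEdges h3, h, swapEdges_swapEdges]⟩

end ColouredGraph

namespace Diagram

variable {D : ℕ} {W K V : Type} {I : Fin D → Finset ℤ}

/-- `Option` commutes with sums on the left. -/
def optionSum (W H : Type) : Option W ⊕ H ≃ Option (W ⊕ H) where
  toFun := Sum.elim (Option.map Sum.inl) fun h => some (Sum.inr h)
  invFun x := x.elim (Sum.inl none) (Sum.map some id)
  left_inv := by rintro ((_ | v) | h) <;> rfl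
  right_inv := by rintro (_ | (v | h)) <;> rfl

open Classical in
/-- Cut the propagator `j` and attach new legs `none` to its two ends. -/
noncomputable def cut (j : W ⊕ V × Bool) (Γ : Diagram D W K V) :
    Diagram D (Option W) (Option K) V where
  colour := Γ.colour
  propagator := (optionSum W _).trans ((Equiv.swap none (some j)).trans
    (Γ.propagator.optionCongr.trans (optionSum K _).symm))

open Classical in
/-- The starting point, in the diagram with the propagator `j` cut, of the propagator that ends
where `x` ended. -/
noncomputable def cutStart (j x : W ⊕ V × Bool) : Option W ⊕ V × Bool :=
  if x = j then Sum.inl none else Sum.map some id x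

section Cut

variable (j : W ⊕ V × Bool) (Γ : Diagram D W K V)

theorem cut_propagator_symm_inl_none :
    (cut j Γ).propagator.symm (Sum.inl none) = Sum.map some id j := by
  simp [cut, optionSum, ← Equiv.optionCongr_symm]

theorem cut_propagator_symm (y : K ⊕ V × Bool) :
    (cut j Γ).propagator.symm (Sum.map some id y) = cutStart j (Γ.propagator.symm y) := by
  classical
  have h1 : optionSum K _ (Sum.map some id y) = some y := by rcases y with y | y <;> rfl
  simp only [cut, Equiv.symm_trans_apply, Equiv.symm_symm, h1, ← Equiv.optionCongr_symm,
    Equiv.optionCongr_apply, Option.map_some, Equiv.symm_swap, cutStart]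
  split_ifs with h
  · rw [h, Equiv.swap_apply_right]
    rfl
  · rw [Equiv.swap_apply_of_ne_of_ne (by simp) (by simpa using h)]
    rfl

theorem cut_respects (R : Fin D → Option W ⊕ V × Bool → Option W ⊕ V × Bool → Prop) :
    (cut j Γ).Respects R ↔ Γ.Respects fun c x y => R c (cutStart j x) (Sum.map some id y) := by
  refine forall_congr' fun h => forall_congr' fun c => ?_
  have h1 := cut_propagator_symm j Γ (Sum.inr h)
  simp only [Sum.map_inr, id] at h1 ⊢
  rw [h1]
  rfl

theorem isSplit_iff_symm {f : W → Prop} {g : K → Prop} {h : V → Prop} :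
    Γ.IsSplit f g h ↔ ∀ y, Sum.elim f (fun x => h x.1) (Γ.propagator.symm y) ↔
      Sum.elim g (fun x => h x.1) y := by
  unfold IsSplit
  rw [← Γ.propagator.symm.forall_congr_right]
  simp

theorem cut_isSplit_false (h : V → Prop) :
    (cut j Γ).IsSplit (fun _ => False) (fun _ => False) h ↔
      ¬ Sum.elim (fun _ => False) (fun x => h x.1) j ∧
        Γ.IsSplit (fun _ => False) (fun _ => False) h := by
  have hs : ∀ x : W ⊕ V × Bool, Sum.elim (fun _ : Option W => False) (fun x => h x.1)
      (Sum.map some id x) ↔ Sum.elim (fun _ => False) (fun x => h x.1) x := by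
    rintro (x | x) <;> rfl
  have ht : ∀ x : K ⊕ V × Bool, Sum.elim (fun _ : Option K => False) (fun x => h x.1)
      (Sum.map some id x) ↔ Sum.elim (fun _ => False) (fun x => h x.1) x := by
    rintro (x | x) <;> rfl
  rw [isSplit_iff_symm, isSplit_iff_symm]
  constructor
  · intro H
    have h1 := H (Sum.inl none)
    rw [cut_propagator_symm_inl_none, hs] at h1
    have h2 : ¬ Sum.elim (fun _ => False) (fun x => h x.1) j := h1.1
    refine ⟨h2, fun y => ?_⟩
    have h3 := H (Sum.map some id y)
    rw [cut_propagator_symm, ht, cutStart] at h3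
    split_ifs at h3 with hy
    · rw [hy, ← h3]
      exact ⟨h2, False.elim⟩
    · rwa [hs] at h3
  · rintro ⟨h1, h2⟩
    have key : ∀ y, Sum.elim (fun _ : Option W => False) (fun x => h x.1)
        ((cut j Γ).propagator.symm (Sum.map some id y)) ↔
        Sum.elim (fun _ : Option K => False) (fun x => h x.1) (Sum.map some id y) := by
      intro y
      rw [cut_propagator_symm, ht, ← h2 y, cutStart]
      split_ifs with hy
      · rw [hy]
        exact ⟨False.elim, h1⟩
      · rw [hs]
    rintro ((_ | w) | x)
    · rw [cut_propagator_symm_inl_none, hs]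
      exact ⟨h1, False.elim⟩
    · exact key (Sum.inl w)
    · exact key (Sum.inr x)

theorem IsSplit.faceInv {Γ : Diagram D W K V} {f : W → Prop} {g : K → Prop} {h : V → Prop}
    (H : Γ.IsSplit f g h) (a : Fin D) : Γ.FaceInv a (Sum.elim f fun x => h x.1) := by
  intro x c _
  have := H (Γ.propagator.symm (Sum.inr x))
  simpa [vertexEdge] using this

/-- Cutting a propagator of an external face creates no vacuum component, since both pieces of this
face still end at a leg. -/
theorem cut_noVac {v : W} {a : Fin D} (hj : Γ.OnFace v a j) : (cut j Γ).NoVac ↔ Γ.NoVac := by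
  unfold NoVac
  refine forall_congr' fun h => ?_
  rw [cut_isSplit_false]
  refine imp_congr_left (and_iff_right_of_imp fun hs => ?_)
  exact (hj _ (hs.faceInv a)).not.1 id

/-- Gluing the two ends of the cut propagator turns the boundary graph of the cut diagram into that
of the original one. -/
theorem cut_hasBdry {C : ColouredGraph D (Option W) (Option K)} (hC : (cut j Γ).HasBdry C) :
    Γ.HasBdry C.removeNone := by
  intro c v f hf
  set f' : Option W ⊕ V × Bool → Prop :=
    Sum.elim (fun w => w.elim (f j) fun w => f (Sum.inl w)) fun h => f (Sum.inr h) with hf'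
  have h1 : ∀ x, f' (Sum.map some id x) ↔ f x := by rintro (x | x) <;> rfl
  have h2 : ∀ x, f' (cutStart j x) ↔ f x := by
    intro x
    unfold cutStart
    split_ifs with h
    · rw [h]
      rfl
    · exact h1 x
  have hinv : (cut j Γ).FaceInv c f' := by
    rw [FaceInv, cut_respects]
    simp only [h1, h2]
    exact hf
  have h3 := Equiv.removeNone_iff (P := fun x => f' (Sum.inl x))
    (G := fun y => f' ((cut j Γ).propagator.symm (Sum.inl y))) (C.edge c)
    (fun x => hC c x f' hinv) (by
      rw [cut_propagator_symm_inl_none, h1]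
      rfl) v
  refine h3.trans ?_
  have h4 := cut_propagator_symm j Γ (Sum.inl (C.removeNone.edge c v))
  simp only [Sum.map_inl] at h4
  rw [← h2, ← h4]
  rfl

theorem onFace_of_cut {v : W} {a : Fin D}
    (h : (cut j Γ).OnFace (some v) a (Sum.map some id j)) : Γ.OnFace v a j := by
  intro f hf
  set f' : Option W ⊕ V × Bool → Prop :=
    Sum.elim (fun w => w.elim (f j) fun w => f (Sum.inl w)) fun h => f (Sum.inr h) with hf'
  have h1 : ∀ x, f' (Sum.map some id x) ↔ f x := by rintro (x | x) <;> rfl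
  have h2 : ∀ x, f' (cutStart j x) ↔ f x := by
    intro x
    unfold cutStart
    split_ifs with h
    · rw [h]
      rfl
    · exact h1 x
  have hinv : (cut j Γ).FaceInv a f' := by
    rw [FaceInv, cut_respects]
    simp only [h1, h2]
    exact hf
  rw [← h1 j]
  exact h f' hinv

/-- The propagator `j` lies on the external face `(v, a)` if and only if after cutting it this
face ends at the new leg. -/
theorem onFace_iff_cut [Finite W] [Finite K] [Finite V] {v : W} {a : Fin D}
    {C : ColouredGraph D (Option W) (Option K)} (hC : (cut j Γ).HasBdry C) :
    Γ.OnFace v a j ↔ C.edge a (some v) = none := by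
  rw [hasBdry_iff] at hC
  have hface : ∀ x, C.edge a x = none ↔ (cut j Γ).OnFace x a (Sum.map some id j) := by
    intro x
    rw [← cut_propagator_symm_inl_none j Γ, onFace_symm_inl_iff, hC]
  constructor
  · intro h
    obtain ⟨x, hx⟩ := (C.edge a).surjective none
    rcases x with _ | v'
    · -- otherwise `j` lies on a closed face
      rw [hface] at hx
      have h1 := (h (fun x => (cut j Γ).OnFace none a (Sum.map some id x)) ?_).2 hx
      · have := OnFace.eq h1 ((cut j Γ).onFace_self (some v) a)
        simp at this
      · have h2 := (cut_respects j Γ _).1 ((cut j Γ).faceInv_onFace none a)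
        intro x c hc
        have h3 := h2 x c hc
        beta_reduce at h3 ⊢
        rw [← h3, cutStart]
        split_ifs with hxj
        · rw [hxj]
          exact iff_of_true hx ((cut j Γ).onFace_self none a)
        · rfl
    · have h1 : Γ.OnFace v' a j := onFace_of_cut j Γ ((hface _).1 hx)
      rw [h.eq h1, hx]
  · intro h
    exact onFace_of_cut j Γ ((hface _).1 h)

theorem cut_injective {j j' : W ⊕ V × Bool} {Γ Γ' : Diagram D W K V} (h : cut j Γ = cut j' Γ') :
    j = j' ∧ Γ = Γ' := by
  have hp : ∀ y, (cut j Γ).propagator.symm y = (cut j' Γ').propagator.symm y := by simp [h]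
  have hinj : Function.Injective (Sum.map some id : W ⊕ V × Bool → Option W ⊕ V × Bool) :=
    Sum.map_injective.2 ⟨Option.some_injective _, Function.injective_id⟩
  have hj : j = j' := by
    have h1 := hp (Sum.inl none)
    rw [cut_propagator_symm_inl_none, cut_propagator_symm_inl_none] at h1
    exact hinj h1
  subst hj
  have hcs : Function.Injective (cutStart j) := by
    intro x y hxy
    unfold cutStart at hxy
    have hne : ∀ z : W ⊕ V × Bool, Sum.map some id z ≠ (Sum.inl none : Option W ⊕ V × Bool) := by
      rintro (z | z) <;> simp
    split_ifs at hxy with hx hy hy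
    · rw [hx, hy]
    · exact (hne _ hxy.symm).elim
    · exact (hne _ hxy).elim
    · exact hinj hxy
  have hcol : ∀ i, (cut j Γ).colour i = (cut j Γ').colour i := by rw [h]; simp
  refine ⟨rfl, Diagram.ext (funext hcol) ?_⟩
  rw [← Equiv.symm_bijective.injective.eq_iff]
  ext1 y
  apply hcs
  rw [← cut_propagator_symm, ← cut_propagator_symm]
  exact hp _

theorem exists_eq_cut (Γ : Diagram D (Option W) (Option K) V)
    (h : Γ.propagator (Sum.inl none) ≠ Sum.inl none) : ∃ j Γ', Γ = cut j Γ' := by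
  classical
  set e := (optionSum W _).symm.trans (Γ.propagator.trans (optionSum K _)) with he
  have h0 : e.symm none ≠ none := by
    intro h1
    rw [Equiv.symm_apply_eq] at h1
    apply h
    apply (optionSum K _).injective
    exact h1.symm
  obtain ⟨j, hj⟩ := Option.ne_none_iff_exists'.1 h0
  have h2 : ((Equiv.swap none (some j)).trans e) none = none := by
    rw [Equiv.trans_apply, Equiv.swap_apply_left, ← hj, Equiv.apply_symm_apply]
  refine ⟨j, ⟨Γ.colour, ((Equiv.swap none (some j)).trans e).removeNone⟩, Diagram.ext rfl ?_⟩
  simp only [cut]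
  rw [Equiv.optionCongr_removeNone _ h2]
  apply Equiv.ext
  intro x
  have h3 : ∀ y, Equiv.swap (none : Option (W ⊕ V × Bool)) (some j) (Equiv.swap none (some j) y) =
      y := fun y => Equiv.swap_apply_self _ _ y
  simp only [Equiv.trans_apply]
  convert (congrArg (optionSum K (V × Bool)).symm (congrArg e (h3 (optionSum W _ x)))).symm using 1
  simp [he]

end Cut

end Diagram

/-! ### The Ward identity for amplitudes -/

/-- A telescoping sum: the difference of two products of propagators, with energies differing by
a constant `d`, is the sum over all ways to place one additional propagator. -/
theorem mul_sum_inv_sub_mul_prod {m : ℕ} (d : ℝ) (e : Fin m → ℝ) (he : ∀ i, e i ≠ 0)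
    (hed : ∀ i, e i - d ≠ 0) :
    d * ∑ l, (e l - d)⁻¹ * ∏ i, (if l < i then e i - d else e i)⁻¹ =
      ∏ i, (e i - d)⁻¹ - ∏ i, (e i)⁻¹ := by
  induction m with
  | zero => simp
  | succ m ih =>
    have h1 := ih (fun i => e i.succ) (fun i => he _) (fun i => hed _)
    have h0 := he 0
    have h0' := hed 0
    simp only [Fin.sum_univ_succ, Fin.prod_univ_succ, if_false,
      Fin.succ_pos, if_true, Fin.not_lt_zero, Fin.succ_lt_succ_iff]
    have h2 : ∑ l : Fin m, (e l.succ - d)⁻¹ * ((e 0)⁻¹ *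
        ∏ i : Fin m, (if l < i then e i.succ - d else e i.succ)⁻¹) =
        (e 0)⁻¹ * ∑ l : Fin m, (e l.succ - d)⁻¹ *
          ∏ i : Fin m, (if l < i then e i.succ - d else e i.succ)⁻¹ := by
      rw [Finset.mul_sum]
      exact Finset.sum_congr rfl fun l _ => by ring
    rw [h2, mul_add, mul_left_comm d (e 0)⁻¹, h1]
    field_simp
    ring

/-- The derivative of a product of propagators with respect to a common shift of the energies
doubles one propagator after the other. -/
theorem hasDerivAt_prod_inv_add {m : ℕ} (e : Fin m → ℝ) (he : ∀ i, e i ≠ 0) :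
    HasDerivAt (fun t => ∏ i, (e i + t)⁻¹) (-∑ l, (e l)⁻¹ * ∏ i, (e i)⁻¹) 0 := by
  induction m with
  | zero => simpa using hasDerivAt_const (0 : ℝ) (1 : ℝ)
  | succ m ih =>
    have h1 := ih (fun i => e i.succ) fun i => he _
    have h0 : HasDerivAt (fun t => (e 0 + t)⁻¹) (-1 / (e 0 + 0) ^ 2) 0 :=
      ((hasDerivAt_id (0 : ℝ)).const_add (e 0)).inv (by simpa using he 0)
    have h2 := h0.mul h1
    simp only [Fin.sum_univ_succ, Fin.prod_univ_succ]
    refine h2.congr_deriv ?_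
    have := he 0
    simp only [add_zero]
    rw [← Finset.sum_mul, ← Finset.sum_mul]
    field_simp
    ring

namespace Diagram

variable {D : ℕ} {W K V : Type} {I : Fin D → Finset ℤ}

open Classical in
/-- Replace the momentum coordinate `a` by `b` for the propagators in `S`. -/
noncomputable def updateOn {A : Type*} (S : A → Prop) (a : Fin D) (b : I a)
    (q : A → Momentum I) : A → Momentum I :=
  fun x => if S x then Function.update (q x) a b else q x

section UpdateOn

variable {A : Type*} {S : A → Prop} {a : Fin D} {b : I a} {q : A → Momentum I} {x : A}

theorem updateOn_apply_of_ne {c : Fin D} (hc : c ≠ a) : updateOn S a b q x c = q x c := by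
  unfold updateOn
  split_ifs <;> simp [hc]

theorem updateOn_of_mem (hx : S x) : updateOn S a b q x = Function.update (q x) a b := if_pos hx

theorem updateOn_of_notMem (hx : ¬ S x) : updateOn S a b q x = q x := if_neg hx

theorem updateOn_updateOn {b' : I a} (h : ∀ x, S x → q x a = b') :
    updateOn S a b' (updateOn S a b q) = q := by
  funext x
  by_cases hx : S x
  · rw [updateOn_of_mem hx, updateOn_of_mem hx, ← h x hx]
    simp
  · rw [updateOn_of_notMem hx, updateOn_of_notMem hx]

end UpdateOn

theorem IsFlow.updateOn {Γ : Diagram D W K V} {q : W ⊕ V × Bool → Momentum I} (hq : Γ.IsFlow q)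
    {a : Fin D} {S : W ⊕ V × Bool → Prop} (hS : Γ.FaceInv a S) (b : I a) :
    Γ.IsFlow (updateOn S a b q) := by
  intro h c
  have h1 := hq h c
  beta_reduce at h1 ⊢
  by_cases hc : c = a
  · subst hc
    by_cases hx : S (Γ.propagator.symm (Sum.inr h))
    · rw [updateOn_of_mem hx, updateOn_of_mem ((hS h c rfl).1 hx)]
      simp
    · rw [updateOn_of_notMem hx, updateOn_of_notMem (mt (hS h c rfl).2 hx), h1]
  · rw [updateOn_apply_of_ne hc, updateOn_apply_of_ne hc, h1]

/-- A flow on the diagram with the propagator `u l` cut carries the momentum coordinate of the old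
leg up to the cut, and that of the new leg behind it. -/
theorem IsFacePath.flow_cut {Γ : Diagram D W K V} {a : Fin D} {γ : W} {w : K} {m : ℕ}
    {u : Fin (m + 1) → W ⊕ V × Bool} (hu : Γ.IsFacePath a γ w u) (l : Fin (m + 1))
    {p : Option W ⊕ V × Bool → Momentum I} (hp : (cut (u l) Γ).IsFlow p) (i : Fin (m + 1)) :
    p (Sum.map some id (u i)) a =
      if l < i then p (Sum.inl none) a else p (Sum.inl (some γ)) a := by
  rw [IsFlow, cut_respects] at hp
  induction i using Fin.induction with
  | zero => simp [hu.zero]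
  | succ i ih =>
    obtain ⟨h, h1, h2⟩ := hu.step i
    have h3 := hp h a
    beta_reduce at h3
    rw [← h2, ← h1, Equiv.symm_apply_apply, cutStart] at h3
    rw [← h3]
    split_ifs with hi hl hl
    · rfl
    · exact (hl (by rw [← hu.injective hi]; exact i.castSucc_lt_succ)).elim
    · rw [ih, if_pos]
      have hne : i.castSucc ≠ l := fun h => hi (by rw [h])
      simp only [Fin.lt_def, Fin.val_succ, Fin.val_castSucc, ne_eq, Fin.ext_iff] at hl hne ⊢
      omega
    · rw [ih, if_neg]
      simp only [Fin.lt_def, Fin.val_succ, Fin.val_castSucc] at hl ⊢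
      omega

section Amplitude

variable [Fintype W] [Fintype V] {Γ : Diagram D W K V} {a : Fin D} {γ : W} {w : K} {m : ℕ}
  {u : Fin (m + 1) → W ⊕ V × Bool}

open Classical in
/-- Replacing an external coordinate amounts to replacing it on all propagators of its face. -/
theorem IsFacePath.amplitude_replaceCoord (hu : Γ.IsFacePath a γ w u) (E : Momentum I → ℝ)
    (X : W → Momentum I) (b : I a) :
    Γ.amplitude E (replaceCoord X γ a b) 0 =
      ∑ q ∈ (Finset.univ : Finset (W ⊕ V × Bool → Momentum I)).filter
        (fun p => (∀ v, p (Sum.inl v) = X v) ∧ Γ.IsFlow p),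
        ∏ x, (E (updateOn (Γ.OnFace γ a) a b q x))⁻¹ := by
  have hinv := Γ.faceInv_onFace γ a
  have hself := Γ.onFace_self γ a
  unfold amplitude
  refine (Finset.sum_bij' (fun q _ => updateOn (Γ.OnFace γ a) a b q)
    (fun p _ => updateOn (Γ.OnFace γ a) a (X γ a) p) ?_ ?_ ?_ ?_ ?_).symm
  · intro q hq
    simp only [Finset.mem_filter, Finset.mem_univ, true_and] at hq ⊢
    refine ⟨fun v => ?_, hq.2.updateOn hinv b⟩
    by_cases hv : γ = v
    · subst hv
      rw [updateOn_of_mem hself, hq.1]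
      simp [replaceCoord]
    · rw [updateOn_of_notMem (mt (hu.onFace_inl_iff v).1 hv), hq.1, replaceCoord,
        Function.update_of_ne (Ne.symm hv)]
  · intro p hp
    simp only [Finset.mem_filter, Finset.mem_univ, true_and] at hp ⊢
    refine ⟨fun v => ?_, hp.2.updateOn hinv _⟩
    by_cases hv : γ = v
    · subst hv
      rw [updateOn_of_mem hself, hp.1]
      simp [replaceCoord]
    · rw [updateOn_of_notMem (mt (hu.onFace_inl_iff v).1 hv), hp.1, replaceCoord,
        Function.update_of_ne (Ne.symm hv)]
  · intro q hq
    simp only [Finset.mem_filter, Finset.mem_univ, true_and] at hq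
    refine updateOn_updateOn fun x hx => ?_
    rw [hq.2.eq_of_onFace hx, hq.1]
  · intro p hp
    simp only [Finset.mem_filter, Finset.mem_univ, true_and] at hp
    refine updateOn_updateOn fun x hx => ?_
    rw [hp.2.eq_of_onFace hx, hp.1]
    simp [replaceCoord]
  · intro q _
    simp

open Classical in
/-- The sum over the flows on the diagram with the propagator `j` cut, such that the momenta of the
new legs agree except for the coordinate `a`, which has the value `b` at the new `J`-leg. -/
noncomputable def cutSum (Γ : Diagram D W K V) (E : Momentum I → ℝ) (X : W → Momentum I)
    (a : Fin D) (b : I a) (j : W ⊕ V × Bool) : ℝ :=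
  ∑ p ∈ (Finset.univ : Finset (Option W ⊕ V × Bool → Momentum I)).filter (fun p =>
    (∀ v, p (Sum.inl (some v)) = X v) ∧ p (Sum.inl none) a = b ∧
      (∀ c, c ≠ a → p (Sum.inl none) c = p (Sum.map some id j) c) ∧ (cut j Γ).IsFlow p),
    ∏ x, (E (p x))⁻¹

open Classical in
/-- After the cut, the coordinate on the remainder of the face has the value `b`, and the cut
propagator appears twice, once with each value. -/
theorem IsFacePath.cutSum_eq (hu : Γ.IsFacePath a γ w u) (E : Momentum I → ℝ)
    (X : W → Momentum I) (b : I a) (l : Fin (m + 1)) :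
    Γ.cutSum E X a b (u l) = ∑ q ∈ (Finset.univ : Finset (W ⊕ V × Bool → Momentum I)).filter
        (fun p => (∀ v, p (Sum.inl v) = X v) ∧ Γ.IsFlow p),
        (E (Function.update (q (u l)) a b))⁻¹ *
          ∏ x, (E (updateOn (fun x => ∃ i, l < i ∧ u i = x) a b q x))⁻¹ := by
  set S : W ⊕ V × Bool → Prop := fun x => ∃ i, l < i ∧ u i = x with hS
  set S' : W ⊕ V × Bool → Prop := fun x => ∃ i, l ≤ i ∧ u i = x with hS'
  have hSl : ¬ S (u l) := by
    rintro ⟨i, hi, h⟩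
    exact hi.ne' (hu.injective h)
  have hS'l : S' (u l) := ⟨l, le_rfl, rfl⟩
  have hSS' : ∀ x, x ≠ u l → (S' x ↔ S x) := by
    intro x hx
    refine exists_congr fun i => and_congr_left fun hi => ?_
    have : l ≠ i := by
      rintro rfl
      exact hx hi.symm
    exact ⟨fun h => lt_of_le_of_ne h this, le_of_lt⟩
  have hstep : ∀ h, S' (Γ.propagator.symm (Sum.inr h)) ↔ S (Sum.inr (Γ.vertexEdge a h)) := by
    intro h
    constructor
    · rintro ⟨i, hi, hx⟩
      obtain ⟨k, rfl, hk⟩ := (hu.propagator_symm_mem_iff h i).1 hx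
      exact ⟨k.succ, lt_of_le_of_lt hi k.castSucc_lt_succ, hk⟩
    · rintro ⟨i, hi, hx⟩
      obtain ⟨k, rfl, hk⟩ := (hu.inr_vertexEdge_mem_iff h i).1 hx
      exact ⟨k.castSucc, Fin.le_castSucc_iff.2 hi, hk⟩
  have hleg : ∀ v, ¬ S (Sum.inl v) := by
    rintro v ⟨i, hi, hx⟩
    obtain ⟨k, rfl⟩ := Fin.exists_succ_eq.2 (Fin.pos_iff_ne_zero.1 ((Fin.zero_le l).trans_lt hi))
    obtain ⟨h, -, h2⟩ := hu.step k
    rw [h2] at hx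
    simp at hx
  unfold cutSum
  let toCut : (W ⊕ V × Bool → Momentum I) → Option W ⊕ V × Bool → Momentum I := fun q y =>
    (optionSum W _ y).elim (Function.update (q (u l)) a b) (updateOn S a b q)
  have htoCut : ∀ q x, toCut q (Sum.map some id x) = updateOn S a b q x := by
    intro q x
    rcases x with x | x <;> rfl
  have htoCut_start : ∀ q x, toCut q (cutStart (u l) x) = updateOn S' a b q x := by
    intro q x
    unfold cutStart
    split_ifs with hx
    · rw [hx, updateOn_of_mem hS'l]
      rfl
    · rw [htoCut]
      by_cases h : S x
      · rw [updateOn_of_mem h, updateOn_of_mem ((hSS' x hx).2 h)]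
      · rw [updateOn_of_notMem h, updateOn_of_notMem (mt (hSS' x hx).1 h)]
  refine (Finset.sum_bij' (fun q _ => toCut q)
    (fun p _ => updateOn S a (X γ a) fun x => p (Sum.map some id x)) ?_ ?_ ?_ ?_ ?_).symm
  · intro q hq
    simp only [Finset.mem_filter, Finset.mem_univ, true_and] at hq ⊢
    refine ⟨fun v => ?_, ?_, fun c hc => ?_, ?_⟩
    · refine (htoCut q (Sum.inl v)).trans ?_
      rw [updateOn_of_notMem (hleg v), hq.1]
    · simp [toCut, optionSum]
    · rw [htoCut, updateOn_of_notMem hSl]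
      simp [toCut, optionSum, hc]
    · rw [IsFlow, cut_respects]
      intro h c
      rw [htoCut, htoCut_start]
      have h1 := hq.2 h c
      beta_reduce at h1
      by_cases hc : c = a
      · subst hc
        by_cases hx : S' (Γ.propagator.symm (Sum.inr h))
        · rw [updateOn_of_mem hx, updateOn_of_mem ((hstep h).1 hx)]
          simp
        · rw [updateOn_of_notMem hx, updateOn_of_notMem (mt (hstep h).2 hx), h1]
      · rw [updateOn_apply_of_ne hc, updateOn_apply_of_ne hc, h1]
  · intro p hp
    simp only [Finset.mem_filter, Finset.mem_univ, true_and] at hp ⊢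
    obtain ⟨hp1, hp2, hp3, hp4⟩ := hp
    refine ⟨fun v => ?_, fun h c => ?_⟩
    · rw [updateOn_of_notMem (hleg v)]
      exact hp1 v
    · have hpath := hu.flow_cut l hp4
      rw [IsFlow, cut_respects] at hp4
      have h1 := hp4 h c
      beta_reduce at h1 ⊢
      set x := Γ.propagator.symm (Sum.inr h) with hx
      by_cases hc : c = a
      · subst hc
        by_cases hxS : S' x
        · rw [updateOn_of_mem ((hstep h).1 hxS), Function.update_self]
          by_cases hxS' : S x
          · rw [updateOn_of_mem hxS', Function.update_self]
          · have hxl : x = u l := by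
              by_contra hne
              exact hxS' ((hSS' x hne).1 hxS)
            rw [updateOn_of_notMem hxS', hxl, hpath l, if_neg (lt_irrefl l), hp1]
        · have hxl : x ≠ u l := fun h => hxS (h ▸ hS'l)
          rw [updateOn_of_notMem (mt (hstep h).2 hxS),
            updateOn_of_notMem (mt (hSS' x hxl).2 hxS), ← h1, cutStart, if_neg hxl]
      · rw [updateOn_apply_of_ne hc, updateOn_apply_of_ne hc, ← h1, cutStart]
        split_ifs with hxl
        · rw [hxl, hp3 c hc]
        · rfl
  · intro q hq
    simp only [Finset.mem_filter, Finset.mem_univ, true_and] at hq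
    simp only [htoCut]
    refine updateOn_updateOn fun x hx => ?_
    obtain ⟨i, -, rfl⟩ := hx
    rw [hq.2.eq_of_onFace (hu.onFace i), hq.1]
  · intro p hp
    simp only [Finset.mem_filter, Finset.mem_univ, true_and] at hp
    obtain ⟨hp1, hp2, hp3, hp4⟩ := hp
    have hpath := hu.flow_cut l hp4
    funext y
    obtain ⟨x, rfl⟩ := (optionSum W _).symm.surjective y
    rcases x with _ | x
    · funext c
      simp only [toCut, Equiv.apply_symm_apply, Option.elim_none]
      by_cases hc : c = a
      · subst hc
        rw [Function.update_self]
        exact hp2.symm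
      · rw [Function.update_of_ne hc, updateOn_apply_of_ne hc]
        exact (hp3 c hc).symm
    · refine (htoCut _ x).trans ?_
      rw [updateOn_updateOn]
      · rfl
      · rintro _ ⟨i, hi, rfl⟩
        rw [hpath i, if_pos hi, hp2]
  · intro q _
    rw [← (optionSum W _).symm.prod_comp, Fintype.prod_option]
    simp [toCut]

theorem prod_eq_prod_compl_mul_prod {A : Type*} [Fintype A] [DecidableEq A] {n : ℕ} {u : Fin n → A}
    (hu : Function.Injective u) (F : A → ℝ) :
    ∏ x, F x = (∏ x ∈ (Finset.univ.image u)ᶜ, F x) * ∏ i, F (u i) := by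
  rw [← Finset.prod_compl_mul_prod (Finset.univ.image u), Finset.prod_image hu.injOn]

/-- The effect of a shift of the energies on an external face, as a difference quotient. -/
noncomputable def amplitudeQuot [DecidableEq W] (Γ : Diagram D W K V) (E : Momentum I → ℝ)
    (Ediff : (a : Fin D) → I a → I a → ℝ) (X : W → Momentum I) (γ : W) (a : Fin D) (b : I a) : ℝ :=
  if Ediff a (X γ a) b = 0 then
    deriv (fun t : ℝ => Γ.amplitude E X (Pi.single γ (Pi.single a t))) 0
  else (Ediff a (X γ a) b)⁻¹ * (Γ.amplitude E X 0 - Γ.amplitude E (replaceCoord X γ a b) 0)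

open Classical in
theorem IsFacePath.hasDerivAt_amplitude (hu : Γ.IsFacePath a γ w u) (E : Momentum I → ℝ)
    (hE : ∀ p, 0 < E p) (X : W → Momentum I) :
    HasDerivAt (fun t : ℝ => Γ.amplitude E X (Pi.single γ (Pi.single a t)))
      (-∑ q ∈ (Finset.univ : Finset (W ⊕ V × Bool → Momentum I)).filter
        (fun p => (∀ v, p (Sum.inl v) = X v) ∧ Γ.IsFlow p),
        ∑ l, (E (q (u l)))⁻¹ * ∏ x, (E (q x))⁻¹) 0 := by
  have hshift : ∀ (t : ℝ) x, (∑ v, ∑ c, if Γ.OnFace v c x then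
      (Pi.single γ (Pi.single a t) : W → Fin D → ℝ) v c else 0) =
      if Γ.OnFace γ a x then t else 0 := by
    intro t x
    rw [Finset.sum_eq_single γ, Finset.sum_eq_single a]
    · simp
    · intro c _ hc
      simp [hc]
    · simp
    · intro v _ hv
      simp [hv]
    · simp
  unfold amplitude
  simp only [hshift]
  rw [← Finset.sum_neg_distrib]
  refine HasDerivAt.fun_sum fun q _ => ?_
  have h1 : ∀ t : ℝ, ∏ x, (E (q x) + if Γ.OnFace γ a x then t else 0)⁻¹ =
      (∏ x ∈ (Finset.univ.image u)ᶜ, (E (q x))⁻¹) * ∏ i, (E (q (u i)) + t)⁻¹ := by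
    intro t
    rw [prod_eq_prod_compl_mul_prod hu.injective]
    congr 1
    · refine Finset.prod_congr rfl fun x hx => ?_
      rw [if_neg, add_zero]
      intro h
      obtain ⟨i, rfl⟩ := (hu.onFace_iff x).1 h
      simp at hx
    · refine Finset.prod_congr rfl fun i _ => ?_
      rw [if_pos (hu.onFace i)]
  simp only [h1]
  refine ((hasDerivAt_prod_inv_add (fun i => E (q (u i))) fun i => (hE _).ne').const_mul
    _).congr_deriv ?_
  rw [prod_eq_prod_compl_mul_prod hu.injective, mul_neg, Finset.mul_sum]
  congr 1
  exact Finset.sum_congr rfl fun l _ => by ring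

open Classical in
/-- The Ward identity: cutting the propagators of an external face one after the other, with a
new momentum coordinate behind the cut, gives a difference quotient of the amplitude. -/
theorem sum_cutSum (Γ : Diagram D W K V) (E : Momentum I → ℝ) (hE : ∀ p, 0 < E p)
    (Ediff : (a : Fin D) → I a → I a → ℝ)
    (hEdiff : ∀ a (p : Momentum I) (t s : I a),
      E (Function.update p a t) - E (Function.update p a s) = Ediff a t s)
    (X : W → Momentum I) (γ : W) (a : Fin D) (b : I a) :
    ∑ j ∈ Finset.univ.filter (Γ.OnFace γ a), Γ.cutSum E X a b j =
      -Γ.amplitudeQuot E Ediff X γ a b := by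
  obtain ⟨w, m, u, hu⟩ := Γ.exists_isFacePath a γ
  have himage : Finset.univ.filter (Γ.OnFace γ a) = Finset.univ.image u := by
    ext x
    simp [hu.onFace_iff]
  rw [himage, Finset.sum_image hu.injective.injOn]
  simp only [hu.cutSum_eq]
  set d := Ediff a (X γ a) b with hd
  set Q := (Finset.univ : Finset (W ⊕ V × Bool → Momentum I)).filter
    (fun p => (∀ v, p (Sum.inl v) = X v) ∧ Γ.IsFlow p) with hQ
  -- replacing the coordinate on the face changes all its energies by `d`
  have hupd : ∀ q ∈ Q, ∀ i, E (Function.update (q (u i)) a b) = E (q (u i)) - d := by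
    intro q hq i
    have hq' := (Finset.mem_filter.1 hq).2
    have h1 := hEdiff a (q (u i)) (X γ a) b
    have h2 : q (u i) a = X γ a := by rw [hq'.2.eq_of_onFace (hu.onFace i), hq'.1]
    rw [← h2, Function.update_eq_self, h2] at h1
    linarith
  have hcut : ∀ q ∈ Q, ∀ l, (E (Function.update (q (u l)) a b))⁻¹ *
      ∏ x, (E (updateOn (fun x => ∃ i, l < i ∧ u i = x) a b q x))⁻¹ =
      (∏ x ∈ (Finset.univ.image u)ᶜ, (E (q x))⁻¹) * ((E (q (u l)) - d)⁻¹ *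
        ∏ i, (if l < i then E (q (u i)) - d else E (q (u i)))⁻¹) := by
    intro q hq l
    rw [prod_eq_prod_compl_mul_prod hu.injective, hupd q hq, mul_left_comm]
    congr 1
    · refine Finset.prod_congr rfl fun x hx => ?_
      rw [updateOn_of_notMem]
      rintro ⟨i, -, rfl⟩
      simp at hx
    · congr 1
      refine Finset.prod_congr rfl fun i _ => ?_
      split_ifs with hi
      · rw [updateOn_of_mem ⟨i, hi, rfl⟩, hupd q hq]
      · rw [updateOn_of_notMem]
        rintro ⟨i', hi', h⟩
        exact hi (hu.injective h ▸ hi')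
  have hne : ∀ q ∈ Q, ∀ i, E (q (u i)) - d ≠ 0 := by
    intro q hq i
    rw [← hupd q hq]
    exact (hE _).ne'
  rw [Finset.sum_comm, Finset.sum_congr rfl fun q hq => Finset.sum_congr rfl fun l _ => hcut q hq l]
  unfold amplitudeQuot
  rw [← hd]
  split_ifs with h0
  · rw [(hu.hasDerivAt_amplitude E hE X).deriv, neg_neg]
    refine Finset.sum_congr rfl fun q _ => Finset.sum_congr rfl fun l _ => ?_
    rw [prod_eq_prod_compl_mul_prod hu.injective, mul_left_comm]
    simp [h0]
  · have h1 : Γ.amplitude E X 0 = ∑ q ∈ Q, (∏ x ∈ (Finset.univ.image u)ᶜ, (E (q x))⁻¹) *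
        ∏ i, (E (q (u i)))⁻¹ := by
      unfold amplitude
      refine Finset.sum_congr rfl fun q _ => ?_
      rw [← prod_eq_prod_compl_mul_prod hu.injective]
      simp
    have h2 : Γ.amplitude E (replaceCoord X γ a b) 0 =
        ∑ q ∈ Q, (∏ x ∈ (Finset.univ.image u)ᶜ, (E (q x))⁻¹) *
          ∏ i, (E (q (u i)) - d)⁻¹ := by
      rw [hu.amplitude_replaceCoord]
      refine Finset.sum_congr rfl fun q hq => ?_
      rw [prod_eq_prod_compl_mul_prod hu.injective]
      congr 1
      · refine Finset.prod_congr rfl fun x hx => ?_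
        rw [updateOn_of_notMem]
        intro h
        obtain ⟨i, rfl⟩ := (hu.onFace_iff x).1 h
        simp at hx
      · refine Finset.prod_congr rfl fun i _ => ?_
        rw [updateOn_of_mem (hu.onFace i), hupd q hq]
    rw [h1, h2, ← Finset.sum_sub_distrib, Finset.mul_sum, ← Finset.sum_neg_distrib]
    refine Finset.sum_congr rfl fun q hq => ?_
    have h3 := mul_sum_inv_sub_mul_prod d (fun i => E (q (u i))) (fun i => (hE _).ne') (hne q hq)
    rw [← Finset.mul_sum, ← mul_sub, eq_comm, ← mul_neg, ← mul_neg, neg_sub, ← h3]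
    field_simp

end Amplitude

end Diagram

/-! ### The terms with a difference quotient -/

namespace ColouredGraph

variable {D : ℕ} {W K : Type} {I : Fin D → Finset ℤ} [DecidableEq K]

theorem glue_edge_of_ne (C : ColouredGraph D (Option W) (Option K)) {a c : Fin D} (hc : c ≠ a)
    (α : K) : (C.glue a α).edge c = (C.edge c).removeNone := by
  simp [glue, swapEdges, hc]

/-- For the colours that are not swapped, conservation of momentum at one end of the inserted vertex
implies it at the other. -/
theorem target_some_eq_of_target_none {C : ColouredGraph D (Option W) (Option K)} {a c : Fin D}
    (hc : c ≠ a) (α : K) {X : W → Momentum I} {z : Momentum I}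
    (hz : C.target (fun v => v.elim z X) none c = z c) :
    C.target (fun v => v.elim z X) (some α) c = (C.glue a α).target X α c := by
  set v := ((C.glue a α).edge c).symm α with hv
  have h1 : (C.edge c).removeNone v = α := by
    rw [← glue_edge_of_ne C hc α, hv, Equiv.apply_symm_apply]
  change Option.elim ((C.edge c).symm (some α)) z X c = X v c
  change Option.elim ((C.edge c).symm none) z X c = z c at hz
  rcases hw : C.edge c (some v) with _ | w
  · have h2 := Equiv.removeNone_none _ hw
    rw [h1] at h2
    rw [← hw, Equiv.symm_apply_apply] at hz
    rw [h2, Equiv.symm_apply_apply]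
    exact hz.symm
  · have h2 := Equiv.removeNone_some _ ⟨w, hw⟩
    rw [h1] at h2
    rw [h2, Equiv.symm_apply_apply]
    rfl

end ColouredGraph

namespace Diagram

variable {D : ℕ} {W K V : Type} {I : Fin D → Finset ℤ}

/-- If the `a`-coloured face starting at the new leg ends at the leg `ρ`, conservation leaves the
coordinate `a` of the new leg free for `ρ = α` and fixes it otherwise. -/
theorem conserves_iff_of_edge_eq_some [DecidableEq K]
    {C : ColouredGraph D (Option W) (Option K)} {B : ColouredGraph D W K} {a : Fin D} {α ρ : K}
    (hρ : C.edge a none = some ρ) (hB : C.glue a α = B) (X : W → Momentum I) (z : Momentum I) :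
    Conserves C a α (B.target X α) X z ↔
      (∀ c, c ≠ a → C.target (fun v => v.elim z X) none c = z c) ∧
        (ρ ≠ α → z a = B.target X ρ a) := by
  obtain ⟨hC, hγ⟩ := (C.glue_iff B a α ρ).1 ⟨hρ, hB⟩
  have hsymm : (C.edge a).symm (some ρ) = none := by rw [← hρ, Equiv.symm_apply_apply]
  have hne : ρ ≠ α → C.target (fun v => v.elim z X) (some α) a = B.target X ρ a := by
    intro hρα
    obtain ⟨v, hv⟩ : ∃ v, C.edge a (some v) = some α := by
      obtain ⟨x, hx⟩ := (C.edge a).surjective (some α)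
      rcases x with _ | v
      · rw [hρ] at hx
        exact (hρα (Option.some_injective _ hx)).elim
      · exact ⟨v, hx⟩
    have h1 : B.edge a v = ρ := by
      rw [← hB, ColouredGraph.glue_eq_swapEdges hρ]
      have h2 := Equiv.removeNone_some _ ⟨α, hv⟩
      rw [hv] at h2
      simp [ColouredGraph.swapEdges, ColouredGraph.removeNone, Option.some_injective _ h2]
    have h2 : (C.edge a).symm (some α) = some v := by rw [← hv, Equiv.symm_apply_apply]
    have h3 : (B.edge a).symm ρ = v := by rw [← h1, Equiv.symm_apply_apply]
    simp [ColouredGraph.target, h2, h3]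
  constructor
  · intro H
    refine ⟨fun c hc => ?_, fun hρα => ?_⟩
    · have := (H c).2
      rwa [if_neg hc] at this
    · have := (H a).1
      rw [if_pos rfl, hne hρα] at this
      exact this.symm
  · rintro ⟨H1, H2⟩ c
    by_cases hc : c = a
    · subst hc
      simp only [if_true]
      refine ⟨?_, ?_⟩
      · by_cases hρα : ρ = α
        · subst hρα
          simp [ColouredGraph.target, hsymm]
        · rw [hne hρα, H2 hρα]
      · have h1 : (C.edge c).symm none = some ((B.edge c).symm α) := by
          rw [← hγ, Equiv.symm_apply_apply]
        simp [ColouredGraph.target, h1]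
    · rw [if_neg hc, if_neg hc]
      refine ⟨?_, H1 c hc⟩
      rw [C.target_some_eq_of_target_none hc α (H1 c hc), hB]

variable [Fintype W] [Fintype V]

open Classical in
/-- The sum over the momentum of the new leg, expressed on the diagram with the propagator `j`
restored. -/
theorem sum_conserves_amplitude_cut [DecidableEq K] {Γ : Diagram D W K V} {j : W ⊕ V × Bool}
    {C : ColouredGraph D (Option W) (Option K)} {B : ColouredGraph D W K} {a : Fin D} {α ρ : K}
    (hC : (cut j Γ).HasBdry C) (hρ : C.edge a none = some ρ) (hB : C.glue a α = B)
    (E : Momentum I → ℝ) (X : W → Momentum I) :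
    ∑ z ∈ (Finset.univ : Finset (Momentum I)).filter (Conserves C a α (B.target X α) X),
      (cut j Γ).amplitude E (fun v => v.elim z X) 0 =
    ∑ b ∈ (Finset.univ : Finset (I a)).filter (fun b => ρ ≠ α → b = B.target X ρ a),
      Γ.cutSum E X a b j := by
  unfold amplitude cutSum
  rw [Finset.sum_sigma', Finset.sum_sigma']
  have hj : ∀ (p : Option W ⊕ V × Bool → Momentum I) (z : Momentum I),
      (∀ v : Option W, p (Sum.inl v) = v.elim z X) → (cut j Γ).IsFlow p →
      C.target (fun v => v.elim z X) none = p (Sum.map some id j) := by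
    intro p z hp hfl
    rw [← cut_propagator_symm_inl_none j Γ, hC.flow_eq hfl, funext hp]
  refine Finset.sum_bij' (fun x _ => ⟨x.1 a, x.2⟩) (fun x _ => ⟨x.2 (Sum.inl none), x.2⟩)
    ?_ ?_ ?_ ?_ ?_
  · rintro ⟨z, p⟩ hx
    simp only [Finset.mem_sigma, Finset.mem_filter, Finset.mem_univ, true_and,
      conserves_iff_of_edge_eq_some hρ hB] at hx ⊢
    obtain ⟨⟨h1, h2⟩, h3, h4⟩ := hx
    refine ⟨h2, fun v => h3 (some v), ?_, fun c hc => ?_, h4⟩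
    · rw [h3 none]
      rfl
    · rw [← hj p z h3 h4, h1 c hc, h3 none]
      rfl
  · rintro ⟨b, p⟩ hx
    simp only [Finset.mem_sigma, Finset.mem_filter, Finset.mem_univ, true_and,
      conserves_iff_of_edge_eq_some hρ hB] at hx ⊢
    obtain ⟨h1, h2, h3, h4, h5⟩ := hx
    have h6 : ∀ v : Option W, p (Sum.inl v) = v.elim (p (Sum.inl none)) X := by
      rintro (_ | v)
      · rfl
      · exact h2 v
    refine ⟨⟨fun c hc => ?_, fun hne => ?_⟩, h6, h5⟩
    · rw [hj p _ h6 h5, h4 c hc]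
    · rw [h3, h1 hne]
  · rintro ⟨z, p⟩ hx
    simp only [Finset.mem_sigma, Finset.mem_filter, Finset.mem_univ, true_and] at hx
    simp [hx.2.1 none]
  · rintro ⟨b, p⟩ hx
    simp only [Finset.mem_sigma, Finset.mem_filter, Finset.mem_univ, true_and] at hx
    simp [hx.2.2.1]
  · rintro ⟨z, p⟩ _
    simp

variable [Fintype K]

open Classical in
/-- The contribution to the insertions of a vertex of those diagrams in which the `a`-coloured face
starting at the `J`-leg `none` does not end at the `J̄`-leg `none`. -/
theorem sum_edge_ne_none [hW : DecidableEq W] [DecidableEq K] (E : Momentum I → ℝ)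
    (hE : ∀ p, 0 < E p)
    (Ediff : (a : Fin D) → I a → I a → ℝ)
    (hEdiff : ∀ a (p : Momentum I) (t s : I a),
      E (Function.update p a t) - E (Function.update p a s) = Ediff a t s)
    (B : ColouredGraph D W K) (X : W → Momentum I) (α : K) (a : Fin D) :
    ∑ C ∈ (Finset.univ : Finset (ColouredGraph D (Option W) (Option K))).filter
        (fun C => C.glue a α = B ∧ C.edge a none ≠ none),
      ∑ z ∈ (Finset.univ : Finset (Momentum I)).filter (Conserves C a α (B.target X α) X),
        bdrySum (V := V) NoVac E C (fun v => v.elim z X) 0 =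
    -∑ ρ, ∑ b ∈ (Finset.univ : Finset (I a)).filter (fun b => ρ ≠ α → b = B.target X ρ a),
      ∑ Γ ∈ (Finset.univ : Finset (Diagram D W K V)).filter
        (fun Γ => Γ.NoVac ∧ Γ.HasBdry (B.swapEdges a α ρ)),
        Γ.amplitudeQuot E Ediff X ((B.edge a).symm α) a b := by
  have hρ : ∀ (F : ColouredGraph D (Option W) (Option K) → ℝ),
      ∑ C ∈ (Finset.univ : Finset (ColouredGraph D (Option W) (Option K))).filter
        (fun C => C.glue a α = B ∧ C.edge a none ≠ none), F C =
      ∑ ρ, ∑ C ∈ (Finset.univ : Finset (ColouredGraph D (Option W) (Option K))).filter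
        (fun C => C.edge a none = some ρ ∧ C.glue a α = B), F C := by
    intro F
    simp only [Finset.sum_filter]
    rw [Finset.sum_comm]
    refine Finset.sum_congr rfl fun C _ => ?_
    rcases hC : C.edge a none with _ | ρ
    · simp
    · simp [ite_and, eq_comm]
  rw [hρ, ← Finset.sum_neg_distrib]
  refine Finset.sum_congr rfl fun ρ _ => ?_
  set γ := (B.edge a).symm α with hγ
  -- the sum over the diagrams with new legs, and their boundary graphs
  have h1 : ∑ C ∈ (Finset.univ : Finset (ColouredGraph D (Option W) (Option K))).filter
        (fun C => C.edge a none = some ρ ∧ C.glue a α = B),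
      ∑ z ∈ (Finset.univ : Finset (Momentum I)).filter (Conserves C a α (B.target X α) X),
        bdrySum (V := V) NoVac E C (fun v => v.elim z X) 0 =
      ∑ Γ ∈ (Finset.univ : Finset (Diagram D (Option W) (Option K) V)).filter
        (fun Γ => Γ.NoVac ∧ Γ.bdry.edge a none = some ρ ∧ Γ.bdry.glue a α = B),
        ∑ z ∈ (Finset.univ : Finset (Momentum I)).filter (Conserves Γ.bdry a α (B.target X α) X),
          Γ.amplitude E (fun v => v.elim z X) 0 := by
    unfold bdrySum
    rw [Finset.sum_congr rfl fun C _ => Finset.sum_comm, Finset.sum_sigma']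
    refine Finset.sum_bij (fun x _ => x.2) ?_ ?_ ?_ ?_
    · rintro ⟨C, Γ⟩ hx
      simp only [Finset.mem_sigma, Finset.mem_filter, Finset.mem_univ, true_and,
        hasBdry_iff] at hx ⊢
      obtain ⟨h1, h2, rfl⟩ := hx
      exact ⟨h2, h1⟩
    · rintro ⟨C, Γ⟩ hx ⟨C', Γ'⟩ hx' h
      simp only [Finset.mem_sigma, Finset.mem_filter, Finset.mem_univ, true_and,
        hasBdry_iff] at hx hx'
      obtain rfl : Γ = Γ' := h
      obtain rfl := hx.2.2
      obtain rfl := hx'.2.2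
      rfl
    · intro Γ hΓ
      simp only [Finset.mem_filter, Finset.mem_univ, true_and] at hΓ
      exact ⟨⟨Γ.bdry, Γ⟩, by simpa [hasBdry_iff] using ⟨hΓ.2, hΓ.1⟩, rfl⟩
    · rintro ⟨C, Γ⟩ hx
      simp only [Finset.mem_sigma, Finset.mem_filter, Finset.mem_univ, true_and, hasBdry_iff] at hx
      obtain rfl := hx.2.2
      rfl
  -- these diagrams arise by cutting a propagator of an external face
  have h2 : ∑ Γ ∈ (Finset.univ : Finset (Diagram D (Option W) (Option K) V)).filter
        (fun Γ => Γ.NoVac ∧ Γ.bdry.edge a none = some ρ ∧ Γ.bdry.glue a α = B),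
        ∑ z ∈ (Finset.univ : Finset (Momentum I)).filter (Conserves Γ.bdry a α (B.target X α) X),
          Γ.amplitude E (fun v => v.elim z X) 0 =
      ∑ Γ ∈ (Finset.univ : Finset (Diagram D W K V)).filter
        (fun Γ => Γ.NoVac ∧ Γ.HasBdry (B.swapEdges a α ρ)),
        ∑ j ∈ Finset.univ.filter (Γ.OnFace γ a),
          ∑ b ∈ (Finset.univ : Finset (I a)).filter (fun b => ρ ≠ α → b = B.target X ρ a),
            Γ.cutSum E X a b j := by
    have hmem : ∀ (Γ : Diagram D W K V) (j : W ⊕ V × Bool),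
        ((Γ.NoVac ∧ Γ.HasBdry (B.swapEdges a α ρ)) ∧ Γ.OnFace γ a j) ↔
        (cut j Γ).NoVac ∧ (cut j Γ).bdry.edge a none = some ρ ∧
          (cut j Γ).bdry.glue a α = B := by
      intro Γ j
      have hC := (cut j Γ).hasBdry_bdry
      rw [ColouredGraph.glue_iff, ← hγ, ← onFace_iff_cut j Γ hC, hasBdry_iff,
        hasBdry_iff.1 (cut_hasBdry j Γ hC), and_assoc]
      constructor
      · rintro ⟨h1, h2, h3⟩
        exact ⟨(cut_noVac j Γ h3).2 h1, h2, h3⟩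
      · rintro ⟨h1, h2, h3⟩
        exact ⟨(cut_noVac j Γ h3).1 h1, h2, h3⟩
    refine Eq.symm ?_
    rw [Finset.sum_sigma']
    refine Finset.sum_bij (fun x _ => cut x.2 x.1) ?_ ?_ ?_ ?_
    · rintro ⟨Γ, j⟩ hx
      simp only [Finset.mem_sigma, Finset.mem_filter, Finset.mem_univ, true_and] at hx ⊢
      exact (hmem Γ j).1 hx
    · rintro ⟨Γ, j⟩ _ ⟨Γ', j'⟩ _ h
      obtain ⟨rfl, rfl⟩ := cut_injective h
      rfl
    · intro Γ hΓ
      simp only [Finset.mem_filter, Finset.mem_univ, true_and] at hΓ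
      obtain ⟨j, Γ', rfl⟩ := exists_eq_cut Γ (by
        intro h
        have h3 : Γ.propagator.symm (Sum.inl none) = Sum.inl none := by rw [← h]; simp
        have h4 := (Γ.onFace_symm_inl_iff none a none).1 (by
          rw [h3]
          exact Γ.onFace_self none a)
        rw [hΓ.2.1] at h4
        simp at h4)
      refine ⟨⟨Γ', j⟩, ?_, rfl⟩
      simp only [Finset.mem_sigma, Finset.mem_filter, Finset.mem_univ, true_and]
      exact (hmem Γ' j).2 hΓ
    · rintro ⟨Γ, j⟩ hx
      simp only [Finset.mem_sigma, Finset.mem_filter, Finset.mem_univ, true_and] at hx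
      obtain ⟨-, h3, h4⟩ := (hmem Γ j).1 hx
      exact (sum_conserves_amplitude_cut (cut j Γ).hasBdry_bdry h3 h4 E X).symm
  rw [h1, h2, ← Finset.sum_neg_distrib, Finset.sum_congr rfl fun Γ _ => Finset.sum_comm,
    Finset.sum_comm]
  refine Finset.sum_congr rfl fun b _ => ?_
  rw [← Finset.sum_neg_distrib]
  refine Finset.sum_congr rfl fun Γ _ => ?_
  -- the statement used next decides equality of legs classically
  obtain rfl : hW = fun v v' => Classical.propDecidable (v = v') := Subsingleton.elim _ _
  exact sum_cutSum Γ E hE Ediff hEdiff X γ a b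

end Diagram

section DifferenceQuotient

variable {D : ℕ} {W K : Type} {I : Fin D → Finset ℤ} [Fintype W] [Fintype K] [hW : DecidableEq W]

open Classical in
/-- The difference quotient of a correlation function, diagram by diagram. -/
theorem diffQuot_expSeries (E : Momentum I → ℝ) (hE : ∀ p, 0 < E p)
    (Ediff : (a : Fin D) → I a → I a → ℝ) (B : ColouredGraph D W K)
    (Φ : (W → Momentum I) → (W → Fin D → ℝ) → ℝ⟦X⟧)
    (hΦ : ∀ X δ, Φ X δ = expSeries fun n =>
      Diagram.bdrySum (V := Fin n) Diagram.NoVac E B X δ)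
    (X : W → Momentum I) (γ : W) (a : Fin D) (b : I a) :
    diffQuot Ediff Φ X γ a b = expSeries fun n =>
      ∑ Γ ∈ (Finset.univ : Finset (Diagram D W K (Fin n))).filter
        (fun Γ => Γ.NoVac ∧ Γ.HasBdry B), Γ.amplitudeQuot E Ediff X γ a b := by
  unfold diffQuot Diagram.amplitudeQuot
  ext n
  simp only [hΦ]
  split_ifs with h
  · simp only [expSeries, PowerSeries.coeff_mk, Diagram.bdrySum]
    have hd : ∀ Γ : Diagram D W K (Fin n), DifferentiableAt ℝ
        (fun t : ℝ => Γ.amplitude E X (Pi.single γ (Pi.single a t))) 0 := by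
      intro Γ
      obtain ⟨w, m, u, hu⟩ := Γ.exists_isFacePath a γ
      -- the statement used next decides equality of legs classically
      obtain rfl : hW = fun v v' => Classical.propDecidable (v = v') := Subsingleton.elim _ _
      exact (hu.hasDerivAt_amplitude E hE X).differentiableAt
    rw [deriv_const_mul, deriv_fun_sum]
    · exact fun Γ _ => hd Γ
    · exact DifferentiableAt.fun_sum fun Γ _ => hd Γ
  · rw [PowerSeries.coeff_smul, map_sub]
    simp only [expSeries, PowerSeries.coeff_mk, Diagram.bdrySum, ← Finset.mul_sum,
      Finset.sum_sub_distrib, smul_eq_mul]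
    ring

end DifferenceQuotient

/-! ### The terms without a difference quotient -/

namespace ColouredGraph

variable {D : ℕ} {W K : Type}

theorem connected_of_forall_or [Nonempty W] {B : ColouredGraph D W K}
    (h : ∀ (f : W → Prop) (g : K → Prop), (∀ a v, f v ↔ g (B.edge a v)) →
      ((∀ v, f v) ∧ ∀ w, g w) ∨ ((∀ v, ¬ f v) ∧ ∀ w, ¬ g w)) : B.Connected := by
  rw [Connected, SimpleGraph.connected_iff]
  refine ⟨fun x y => (SimpleGraph.fromRel_reachable_iff _ x y).2 fun F hF => ?_, inferInstance⟩
  rcases h (fun v => F (Sum.inl v)) (fun w => F (Sum.inr w))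
    (fun a v => hF _ _ ⟨a, v, rfl, rfl⟩) with ⟨h1, h2⟩ | ⟨h1, h2⟩
  · have hall : ∀ x, F x := by
      rintro (x | x)
      exacts [h1 x, h2 x]
    exact iff_of_true (hall x) (hall y)
  · have hall : ∀ x, ¬ F x := by
      rintro (x | x)
      exacts [h1 x, h2 x]
    exact iff_of_false (hall x) (hall y)

theorem melon_connected (hD : 0 < D) : (melon D).Connected := by
  refine connected_of_forall_or fun f g h => ?_
  have h1 := h ⟨0, hD⟩ 0
  simp only [Fin.forall_fin_one]
  change f 0 ↔ g 0 at h1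
  tauto

/-- The disjoint union of a graph and the graph with two vertices. -/
def addMelon (B : ColouredGraph D W K) : ColouredGraph D (Option W) (Option K) :=
  ⟨fun c => (B.edge c).optionCongr⟩

theorem removeNone_addMelon (B : ColouredGraph D W K) : B.addMelon.removeNone = B := by
  ext c v
  simp [addMelon, removeNone]

theorem eq_addMelon {C : ColouredGraph D (Option W) (Option K)}
    (h : ∀ c, C.edge c none = none) : C = C.removeNone.addMelon := by
  refine ColouredGraph.ext (funext fun c => ?_)
  exact (Equiv.optionCongr_removeNone _ (h c)).symm

theorem glue_eq_removeNone [DecidableEq K] {C : ColouredGraph D (Option W) (Option K)} {a : Fin D}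
    (h : C.edge a none = none) (α : K) : C.glue a α = C.removeNone := by
  refine ColouredGraph.ext (funext fun c => ?_)
  by_cases hc : c = a
  · subst hc
    apply Equiv.ext
    intro v
    obtain ⟨w, hw⟩ : ∃ w, C.edge c (some v) = some w := by
      rw [← Option.ne_none_iff_exists']
      intro hv
      have := (C.edge c).injective (hv.trans h.symm)
      simp at this
    have h1 : (C.removeNone.edge c) v = w := by
      have := Equiv.removeNone_some _ ⟨w, hw⟩
      rw [hw] at this
      exact Option.some_injective _ this
    have h2 : (C.swapEdges c none (some α)).edge c =
        (C.edge c).trans (Equiv.swap none (some α)) := by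
      simp [swapEdges]
    rw [h1]
    apply Option.some_injective
    simp only [glue, h2]
    by_cases hwα : w = α
    · subst hwα
      rw [Equiv.removeNone_none _ (by simp [hw])]
      simp [h]
    · have h3 : ((C.edge c).trans (Equiv.swap none (some α))) (some v) = some w := by
        rw [Equiv.trans_apply, hw, Equiv.swap_apply_of_ne_of_ne (by simp) (by simpa using hwα)]
      rw [Equiv.removeNone_some _ ⟨w, h3⟩, h3]
  · exact glue_edge_of_ne C hc α

/-- If the new vertices are not a component by themselves, they are joined to the graph, since their
edges are not all edges between the two of them. -/
theorem connected_of_removeNone [Nonempty W] {B : ColouredGraph D W K} (hB : B.Connected)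
    {C : ColouredGraph D (Option W) (Option K)} (hC : C.removeNone = B) {a : Fin D}
    (ha : C.edge a none = none) (hne : C ≠ B.addMelon) : C.Connected := by
  obtain ⟨c, hc⟩ : ∃ c, C.edge c none ≠ none := by
    by_contra! h
    exact hne (by rw [← hC]; exact eq_addMelon h)
  obtain ⟨w, hw⟩ := Option.ne_none_iff_exists'.1 hc
  refine connected_of_forall_or fun f g h => ?_
  have hnone : f none ↔ g none := by rw [h a, ha]
  have h1 := hB.forall_or (f := fun v => f (some v)) (g := fun w => g (some w)) fun i v => by
    rw [← hC]
    exact Equiv.removeNone_iff (C.edge i) (h i) hnone v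
  have h2 : f none ↔ g (some w) := by rw [h c, hw]
  rcases h1 with ⟨h3, h4⟩ | ⟨h3, h4⟩
  · refine Or.inl ⟨?_, ?_⟩
    · rintro (_ | v)
      exacts [h2.2 (h4 w), h3 v]
    · rintro (_ | v)
      exacts [hnone.1 (h2.2 (h4 w)), h4 v]
  · refine Or.inr ⟨?_, ?_⟩
    · rintro (_ | v)
      exacts [fun h => h4 w (h2.1 h), h3 v]
    · rintro (_ | v)
      exacts [fun h => h4 w (h2.1 (hnone.2 h)), h4 v]

end ColouredGraph

namespace Diagram

variable {D : ℕ} {W K V : Type} {I : Fin D → Finset ℤ}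

/-- The conditions on the momentum `z` of the leg `none` if the `a`-coloured faces at the legs
`none` coincide. -/
def LegConserves (C : ColouredGraph D (Option W) (Option K)) (a : Fin D) (t : I a)
    (X : W → Momentum I) (z : Momentum I) : Prop :=
  z a = t ∧ ∀ c v, C.edge c (some v) = none → z c = X v c

/-- The face joining the two new legs carries the coordinate of the leg `α`; the other coordinates
of the new leg are fixed by the faces that end at the black vertex `none`. -/
theorem conserves_iff_of_edge_eq_none [DecidableEq K]
    {C : ColouredGraph D (Option W) (Option K)} {B : ColouredGraph D W K} {a : Fin D} {α : K}
    (ha : C.edge a none = none) (hB : C.glue a α = B) (X : W → Momentum I) (z : Momentum I) :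
    Conserves C a α (B.target X α) X z ↔ LegConserves C a (B.target X α a) X z := by
  have hsymm : (C.edge a).symm none = none := by
    conv_lhs => rw [← ha, Equiv.symm_apply_apply]
  have htgt : ∀ c, C.target (fun v => v.elim z X) none c = z c ↔
      ∀ v, C.edge c (some v) = none → z c = X v c := by
    intro c
    rcases hx : (C.edge c).symm none with _ | v
    · have h1 : C.edge c none = none := ((C.edge c).symm_apply_eq.1 hx).symm
      refine iff_of_true (by simp [ColouredGraph.target, hx]) fun v hv => ?_
      rw [← h1] at hv
      simp at hv
    · have h1 : C.edge c (some v) = none := by rw [← hx, Equiv.apply_symm_apply]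
      simp only [ColouredGraph.target, hx, Option.elim_some]
      constructor
      · intro h v' hv'
        rw [← h1] at hv'
        obtain rfl : v' = v := by simpa using hv'
        exact h.symm
      · intro h
        exact (h v h1).symm
  have hα : C.target (fun v => v.elim z X) (some α) a = B.target X α a := by
    rw [← hB, ColouredGraph.glue_eq_removeNone ha]
    obtain ⟨v, hv⟩ : ∃ v, C.edge a (some v) = some α := by
      obtain ⟨x, hx⟩ := (C.edge a).surjective (some α)
      rcases x with _ | v
      · simp [ha] at hx
      · exact ⟨v, hx⟩
    have h1 := Equiv.removeNone_some _ ⟨α, hv⟩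
    rw [hv] at h1
    have h2 : (C.removeNone.edge a).symm α = v := by
      rw [Equiv.symm_apply_eq]
      exact (Option.some_injective _ h1).symm
    have h3 : (C.edge a).symm (some α) = some v := by rw [← hv, Equiv.symm_apply_apply]
    simp [ColouredGraph.target, h2, h3]
  constructor
  · intro H
    have h1 := (H a).1
    rw [if_pos rfl, hα] at h1
    refine ⟨h1.symm, fun c => ?_⟩
    by_cases hc : c = a
    · subst hc
      intro v hv
      rw [← ha] at hv
      simp at hv
    · have h2 := (H c).2
      rw [if_neg hc] at h2
      exact (htgt c).1 h2
  · rintro ⟨h1, h2⟩ c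
    by_cases hc : c = a
    · subst hc
      rw [if_pos rfl, if_pos rfl]
      refine ⟨by rw [hα, h1], ?_⟩
      rw [← h1]
      exact (htgt c).2 (h2 c)
    · rw [if_neg hc, if_neg hc]
      have h3 := (htgt c).2 (h2 c)
      exact ⟨by rw [C.target_some_eq_of_target_none hc α h3, hB], h3⟩

/-- Attach a label in front of a type of legs. -/
def consEquiv (W : Type) : Fin 1 ⊕ W ≃ Option W where
  toFun := Sum.elim (fun _ => none) some
  invFun x := x.elim (Sum.inl 0) Sum.inr
  left_inv := by
    rintro (x | x)
    · simp [Subsingleton.elim x 0]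
    · rfl
  right_inv := by rintro (_ | x) <;> rfl

theorem addMelon_eq_union (B : ColouredGraph D W K) :
    B.addMelon = ColouredGraph.union (consEquiv W) (consEquiv K) (ColouredGraph.melon D) B := by
  ext c x
  rcases x with _ | v <;> simp [ColouredGraph.addMelon, ColouredGraph.union, consEquiv]

theorem union_noVac {W₁ K₁ V₁ W₂ K₂ V₂ : Type} (eW : W₁ ⊕ W₂ ≃ W) (eK : K₁ ⊕ K₂ ≃ K)
    (eV : V₁ ⊕ V₂ ≃ V) (Γ₁ : Diagram D W₁ K₁ V₁) (Γ₂ : Diagram D W₂ K₂ V₂) :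
    (union eW eK eV Γ₁ Γ₂).NoVac ↔ Γ₁.NoVac ∧ Γ₂.NoVac := by
  have h0 : ∀ {W K V : Type} (Γ : Diagram D W K V),
      Γ.IsSplit (fun _ => False) (fun _ => False) (fun _ => False) := by
    intro W K V Γ u
    cases u <;> cases hu : Γ.propagator _ <;> simp
  constructor
  · intro H
    refine ⟨fun h hs v => ?_, fun h hs v => ?_⟩
    · have := H (fun v => Sum.elim h (fun _ => False) (eV.symm v))
        ((union_isSplit eW eK eV Γ₁ Γ₂ _ _ _).2 (by simpa using ⟨hs, h0 Γ₂⟩)) (eV (Sum.inl v))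
      simpa using this
    · have := H (fun v => Sum.elim (fun _ => False) h (eV.symm v))
        ((union_isSplit eW eK eV Γ₁ Γ₂ _ _ _).2 (by simpa using ⟨h0 Γ₁, hs⟩)) (eV (Sum.inr v))
      simpa using this
  · rintro ⟨H1, H2⟩ h hs v
    obtain ⟨v, rfl⟩ := eV.surjective v
    have hs' := (union_isSplit eW eK eV Γ₁ Γ₂ _ _ _).1 hs
    rcases v with v | v
    · exact H1 _ hs'.1 v
    · exact H2 _ hs'.2 v

/-- The legs `none` and the vertices in `U` form a component. -/
def IsMelonPart (Γ : Diagram D (Option W) (Option K) V) (U : Finset V) : Prop :=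
  Γ.IsSplit (fun w => w = none) (fun k => k = none) (fun v => v ∈ U)

theorem IsMelonPart.unique {Γ : Diagram D (Option W) (Option K) V} (hΓ : Γ.NoVac)
    {U U' : Finset V} (h : Γ.IsMelonPart U) (h' : Γ.IsMelonPart U') : U = U' := by
  have key : ∀ {U U' : Finset V}, Γ.IsMelonPart U → Γ.IsMelonPart U' → U ⊆ U' := by
    intro U U' h h' v hv
    by_contra hv'
    have h1 := IsSplit.and h h'.not
    simp only [and_not_self] at h1
    exact hΓ _ h1 v ⟨hv, hv'⟩
  exact (key h h').antisymm (key h' h)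

theorem exists_isMelonPart_iff [Fintype V] [Nonempty W] {B : ColouredGraph D W K}
    (hB : B.Connected) {Γ : Diagram D (Option W) (Option K) V} (hΓ : Γ.NoVac)
    (hbdry : Γ.HasBdry B.addMelon) (hD : 0 < D) : (∃ U, Γ.IsMelonPart U) ↔ ¬ Γ.Conn := by
  classical
  constructor
  · rintro ⟨U, hU⟩ hconn
    rcases hconn.2 _ _ _ hU with ⟨h1, -⟩ | ⟨h1, -⟩
    · simpa using h1 (some (Classical.arbitrary W))
    · exact h1 none rfl
  · intro hconn
    by_contra hno
    refine hconn ⟨Or.inl inferInstance, fun f g h hs => ?_⟩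
    have hvac : ∀ (f : Option W → Prop) (g : Option K → Prop) (h : V → Prop), Γ.IsSplit f g h →
        (∀ v, ¬ f v) → (∀ w, ¬ g w) → ∀ v, ¬ h v := by
      intro f g h hs hf hg
      have h1 : f = fun _ => False := funext fun v => by simpa using hf v
      have h2 : g = fun _ => False := funext fun v => by simpa using hg v
      subst h1 h2
      exact hΓ h hs
    have hpart : ∀ (f : Option W → Prop) (g : Option K → Prop) (h : V → Prop), Γ.IsSplit f g h →
        f none → g none → (∀ v, ¬ f (some v)) → (∀ w, ¬ g (some w)) → False := by
      intro f g h hs hf hg hf' hg'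
      refine hno ⟨Finset.univ.filter h, ?_⟩
      have h1 : f = fun w => w = none := by
        funext w
        cases w <;> simp_all
      have h2 : g = fun w => w = none := by
        funext w
        cases w <;> simp_all
      subst h1 h2
      simpa [IsMelonPart] using hs
    have hedge := hbdry.isSplit hs
    have hnone : f none ↔ g none := hedge ⟨0, hD⟩ none
    rcases hB.forall_or (f := fun v => f (some v)) (g := fun w => g (some w))
      (fun i v => hedge i (some v)) with ⟨h1, h2⟩ | ⟨h1, h2⟩
    · by_cases hf : f none
      · have hf' : ∀ v, f v := by rintro (_ | v); exacts [hf, h1 v]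
        have hg' : ∀ v, g v := by rintro (_ | v); exacts [hnone.1 hf, h2 v]
        refine Or.inl ⟨hf', hg', ?_⟩
        simpa using hvac _ _ _ hs.not (by simpa using hf') (by simpa using hg')
      · exact (hpart _ _ _ hs.not hf (mt hnone.2 hf) (by simpa using h1) (by simpa using h2)).elim
    · by_cases hf : f none
      · exact (hpart _ _ _ hs hf (hnone.1 hf) h1 h2).elim
      · have hf' : ∀ v, ¬ f v := by rintro (_ | v); exacts [hf, h1 v]
        have hg' : ∀ v, ¬ g v := by rintro (_ | v); exacts [mt hnone.2 hf, h2 v]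
        exact Or.inr ⟨hf', hg', hvac _ _ _ hs hf' hg'⟩

variable [Fintype W] [Fintype K] [Fintype V]

open Classical in
/-- The sum over the diagrams whose legs `none` form a separate component with vertices `U`
factorises. -/
theorem sum_isMelonPart (hD : 0 < D) (E : Momentum I → ℝ) (B : ColouredGraph D W K)
    (X : W → Momentum I) (z : Momentum I) (U : Finset V) :
    ∑ Γ ∈ (Finset.univ : Finset (Diagram D (Option W) (Option K) V)).filter
        (fun Γ => Γ.IsMelonPart U ∧ Γ.NoVac ∧ Γ.HasBdry B.addMelon),
      Γ.amplitude E (fun v => v.elim z X) 0 =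
    bdrySum (V := {v // v ∈ U}) Conn E (ColouredGraph.melon D) (fun _ => z) 0 *
      bdrySum (V := {v // v ∉ U}) NoVac E B X 0 := by
  set eW := consEquiv W with heW
  set eK := consEquiv K with heK
  set eV := Equiv.sumCompl fun v : V => v ∈ U with heV
  have hW : ∀ w, (eW.symm w).isLeft ↔ w = none := by rintro (_ | w) <;> simp [heW, consEquiv]
  have hK : ∀ w, (eK.symm w).isLeft ↔ w = none := by rintro (_ | w) <;> simp [heK, consEquiv]
  have hV : ∀ w, (eV.symm w).isLeft ↔ w ∈ U := by
    intro w
    by_cases h : w ∈ U <;> simp [heV, h]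
  have hsum := sum_isSplit eW eK eV (D := D) fun Γ => if Γ.NoVac ∧ Γ.HasBdry B.addMelon then
    Γ.amplitude E (fun v => v.elim z X) 0 else 0
  simp only [hW, hK, hV] at hsum
  rw [← Finset.sum_filter, Finset.filter_filter] at hsum
  refine hsum.trans ?_
  have hprop : ∀ (Γ₁ : Diagram D (Fin 1) (Fin 1) {v // v ∈ U}) (Γ₂ : Diagram D W K {v // v ∉ U}),
      ((union eW eK eV Γ₁ Γ₂).NoVac ∧ (union eW eK eV Γ₁ Γ₂).HasBdry B.addMelon) ↔
      (Γ₁.Conn ∧ Γ₁.HasBdry (ColouredGraph.melon D)) ∧ Γ₂.NoVac ∧ Γ₂.HasBdry B := by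
    intro Γ₁ Γ₂
    rw [addMelon_eq_union, union_hasBdry, union_noVac]
    constructor
    · rintro ⟨⟨h1, h2⟩, h3, h4⟩
      exact ⟨⟨(h3.noVac_iff_conn (ColouredGraph.melon_connected hD)).1 h1, h3⟩, h2, h4⟩
    · rintro ⟨⟨h1, h2⟩, h3, h4⟩
      exact ⟨⟨(h2.noVac_iff_conn (ColouredGraph.melon_connected hD)).2 h1, h3⟩, h2, h4⟩
  unfold bdrySum
  rw [Finset.sum_mul_sum, Finset.sum_filter]
  refine Finset.sum_congr rfl fun Γ₁ _ => ?_
  by_cases h1 : Γ₁.Conn ∧ Γ₁.HasBdry (ColouredGraph.melon D)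
  · rw [if_pos h1, Finset.sum_filter]
    refine Finset.sum_congr rfl fun Γ₂ _ => ?_
    rw [union_amplitude]
    exact ite_eq_ite_of_iff ((hprop Γ₁ Γ₂).trans (and_iff_right h1)) _ _
  · rw [if_neg h1]
    refine Finset.sum_eq_zero fun Γ₂ _ => ?_
    rw [if_neg fun h => h1 ((hprop Γ₁ Γ₂).1 h).1]

end Diagram

section MelonPart

variable {D : ℕ} {W K : Type} {I : Fin D → Finset ℤ} [Fintype W] [Fintype K]

/-- A diagram without vacuum components whose boundary is the disjoint union of `B` and a melon is
either connected or a disjoint union of two connected diagrams. -/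
theorem expSeries_noVac_addMelon [DecidableEq W] [Nonempty W] (hD : 2 ≤ D) (E : Momentum I → ℝ)
    {B : ColouredGraph D W K} (hB : B.Connected) (X : W → Momentum I) (z : Momentum I) :
    (expSeries fun n => Diagram.bdrySum (V := Fin n) Diagram.NoVac E B.addMelon
      (fun v => v.elim z X) 0) = corr E B.addMelon (fun v => v.elim z X) +
        corr E (ColouredGraph.melon D) (fun _ => z) * corr E B X := by
  classical
  have hcorr : corr E B X = expSeries fun n =>
      Diagram.bdrySum (V := Fin n) Diagram.NoVac E B X 0 := corrShift_eq_noVac hD E hB X 0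
  rw [hcorr, corr, corr, corrShift_eq_expSeries hD, corrShift_eq_expSeries hD, expSeries_mul]
  rw [← expSeries_add]
  congr 1
  funext n
  have h1 : ∀ Γ ∈ (Finset.univ : Finset (Diagram D (Option W) (Option K) (Fin n))).filter
      (fun Γ => Γ.NoVac ∧ Γ.HasBdry B.addMelon), Γ.amplitude E (fun v => v.elim z X) 0 =
      (if Γ.Conn then Γ.amplitude E (fun v => v.elim z X) 0 else 0) +
        ∑ U : Finset (Fin n),
          if Γ.IsMelonPart U then Γ.amplitude E (fun v => v.elim z X) 0 else 0 := by
    intro Γ hΓ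
    simp only [Finset.mem_filter, Finset.mem_univ, true_and] at hΓ
    have hiff := Diagram.exists_isMelonPart_iff hB hΓ.1 hΓ.2 (by omega)
    by_cases hc : Γ.Conn
    · rw [if_pos hc, Finset.sum_eq_zero, add_zero]
      intro U _
      rw [if_neg fun hU => hiff.1 ⟨U, hU⟩ hc]
    · obtain ⟨U, hU⟩ := hiff.2 hc
      rw [if_neg hc, zero_add, Finset.sum_eq_single U, if_pos hU]
      · intro U' _ hne
        rw [if_neg fun h => hne (h.unique hΓ.1 hU)]
      · simp
  conv_lhs => rw [Diagram.bdrySum]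
  have h2 : ∀ Γ : Diagram D (Option W) (Option K) (Fin n), ((Γ.NoVac ∧ Γ.HasBdry B.addMelon) ∧
      Γ.Conn) ↔ Γ.Conn ∧ Γ.HasBdry B.addMelon := by
    intro Γ
    constructor
    · rintro ⟨⟨-, h⟩, h'⟩
      exact ⟨h', h⟩
    · rintro ⟨h, h'⟩
      exact ⟨⟨h.noVac, h'⟩, h⟩
  rw [Finset.sum_congr rfl h1, Finset.sum_add_distrib, Finset.sum_comm]
  congr 1
  · rw [← Finset.sum_filter, Finset.filter_filter, Diagram.bdrySum]
    simp only [h2]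
  · refine Finset.sum_congr rfl fun U _ => ?_
    have hcard : Fintype.card {v // v ∉ U} = n - U.card := by
      rw [Fintype.card_subtype_compl]
      simp
    rw [← Finset.sum_filter, Finset.filter_filter]
    have h3 := Diagram.sum_isMelonPart (by omega) E B X z U
    refine Eq.trans ?_ (h3.trans ?_)
    · refine Finset.sum_congr (Finset.ext fun Γ => ?_) fun _ _ => rfl
      simp only [Finset.mem_filter, Finset.mem_univ, true_and]
      exact and_comm
    · congr 1
      · exact Diagram.bdrySum_vertices U.equivFin (Diagram.relabel_conn _ _ _) E _ _ 0
      · convert Diagram.bdrySum_vertices (Fintype.equivFinOfCardEq hcard)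
          (Diagram.relabel_noVac _ _ _) E B X 0

open Classical in
/-- The contribution to the insertions of a vertex of those diagrams in which the `a`-coloured face
starting at the `J`-leg `none` ends at the `J̄`-leg `none`. -/
theorem sum_edge_eq_none [DecidableEq W] [DecidableEq K] (hD : 2 ≤ D)
    (E : Momentum I → ℝ) {B : ColouredGraph D W K} (hB : B.Connected) (X : W → Momentum I) (α : K)
    (a : Fin D) :
    (∑ C ∈ (Finset.univ : Finset (ColouredGraph D (Option W) (Option K))).filter
        (fun C => C.glue a α = B ∧ C.edge a none = none),
      ∑ z ∈ (Finset.univ : Finset (Momentum I)).filter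
        (Diagram.Conserves C a α (B.target X α) X),
        expSeries fun n => Diagram.bdrySum (V := Fin n) Diagram.NoVac E C
          (fun v => v.elim z X) 0) =
    (∑ C ∈ (Finset.univ : Finset (ColouredGraph D (Option W) (Option K))).filter
        (fun C => C.removeNone = B ∧ C.edge a none = none),
      ∑ z ∈ (Finset.univ : Finset (Momentum I)).filter
        (Diagram.LegConserves C a (B.target X α a) X), corr E C (fun v => v.elim z X)) +
    (∑ q : Momentum I, if q a = B.target X α a then
      corr E (ColouredGraph.melon D) (fun _ => q) else 0) * corr E B X := by
  have : Nonempty W := ⟨(B.edge a).symm α⟩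
  have h1 : ∀ C ∈ (Finset.univ : Finset (ColouredGraph D (Option W) (Option K))).filter
        (fun C => C.glue a α = B ∧ C.edge a none = none),
      (∑ z ∈ (Finset.univ : Finset (Momentum I)).filter
        (Diagram.Conserves C a α (B.target X α) X),
        expSeries fun n => Diagram.bdrySum (V := Fin n) Diagram.NoVac E C
          (fun v => v.elim z X) 0) =
      (∑ z ∈ (Finset.univ : Finset (Momentum I)).filter
        (Diagram.LegConserves C a (B.target X α a) X), corr E C (fun v => v.elim z X)) +
        if C = B.addMelon then (∑ q : Momentum I, if q a = B.target X α a then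
          corr E (ColouredGraph.melon D) (fun _ => q) else 0) * corr E B X else 0 := by
    intro C hC
    simp only [Finset.mem_filter, Finset.mem_univ, true_and] at hC
    have hfilter : (Finset.univ : Finset (Momentum I)).filter
        (Diagram.Conserves C a α (B.target X α) X) = Finset.univ.filter
        (Diagram.LegConserves C a (B.target X α a) X) := by
      ext z
      simp only [Finset.mem_filter, Finset.mem_univ, true_and]
      exact Diagram.conserves_iff_of_edge_eq_none hC.2 hC.1 X z
    rw [hfilter]
    by_cases hne : C = B.addMelon
    · rw [if_pos hne, hne, Finset.sum_mul, ← Finset.sum_filter_add_sum_filter_not Finset.univ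
        (fun q : Momentum I => q a = B.target X α a)
        (fun q => (if q a = B.target X α a then
          corr E (ColouredGraph.melon D) (fun _ => q) else 0) * corr E B X)]
      have hleg : ∀ z : Momentum I, Diagram.LegConserves B.addMelon a (B.target X α a) X z ↔
          z a = B.target X α a := by
        intro z
        simp [Diagram.LegConserves, ColouredGraph.addMelon]
      have hzero : ∑ q ∈ (Finset.univ : Finset (Momentum I)).filter
          (fun q => ¬ q a = B.target X α a), (if q a = B.target X α a then
            corr E (ColouredGraph.melon D) (fun _ => q) else 0) * corr E B X = 0 := by
        refine Finset.sum_eq_zero fun q hq => ?_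
        rw [if_neg (Finset.mem_filter.1 hq).2, zero_mul]
      rw [hzero, add_zero]
      simp only [hleg]
      rw [← Finset.sum_add_distrib]
      refine Finset.sum_congr rfl fun z hz => ?_
      rw [if_pos (Finset.mem_filter.1 hz).2, expSeries_noVac_addMelon hD E hB X z]
    · rw [if_neg hne, add_zero]
      refine Finset.sum_congr rfl fun z _ => ?_
      have hconn := ColouredGraph.connected_of_removeNone hB
        ((ColouredGraph.glue_eq_removeNone hC.2 α).symm.trans hC.1) hC.2 hne
      exact (corrShift_eq_noVac hD E hconn _ 0).symm
  have h2 : ∀ C : ColouredGraph D (Option W) (Option K),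
      (C.glue a α = B ∧ C.edge a none = none) ↔ (C.removeNone = B ∧ C.edge a none = none) :=
    fun C => and_congr_left fun h => by rw [ColouredGraph.glue_eq_removeNone h]
  rw [Finset.sum_congr rfl h1, Finset.sum_add_distrib]
  congr 1
  · simp only [h2]
  · rw [Finset.sum_ite_eq', if_pos]
    simp only [Finset.mem_filter, Finset.mem_univ, true_and, h2]
    exact ⟨B.removeNone_addMelon, by simp [ColouredGraph.addMelon]⟩

end MelonPart

/-! ### Orbit counting -/

theorem Equiv.some_removeNone {W K : Type*} [DecidableEq K] (e : Option W ≃ Option K) (v : W) :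
    some (e.removeNone v) = Equiv.swap (e none) none (e (some v)) := by
  rcases hv : e (some v) with _ | w
  · rw [Equiv.removeNone_none e hv, Equiv.swap_apply_right]
  · rw [Equiv.removeNone_some e ⟨w, hv⟩, hv, Equiv.swap_apply_of_ne_of_ne _ (by simp)]
    rw [← hv]
    simp

namespace ColouredGraph

variable {D : ℕ} {W K W' K' : Type}

/-- The graph structure pulled back along bijections of the vertices. -/
def pullback (G : ColouredGraph D W' K') (e : W ≃ W') (f : K ≃ K') : ColouredGraph D W K :=
  ⟨fun c => e.trans ((G.edge c).trans f.symm)⟩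

theorem isIso_iff_eq_pullback {C : ColouredGraph D W K} {G : ColouredGraph D W' K'}
    {η : (W ≃ W') × (K ≃ K')} : IsIso C G η ↔ C = G.pullback η.1 η.2 := by
  constructor
  · intro h
    ext c v
    simp [pullback, h c v]
  · rintro rfl c v
    simp [pullback]

/-- Isomorphisms onto a contracted graph correspond to bijections of the vertices
of the full graph such that `B` arises from the pulled back graph by removing the vertices
`none`. -/
theorem isIso_contract_iff [DecidableEq K'] (B : ColouredGraph D W K) (G : ColouredGraph D W' K')
    (a : Fin D) (r : W') (e : Option W ≃ W') (f : Option K ≃ K')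
    (θ : (W ≃ {v : W' // v ≠ r}) × (K ≃ {w : K' // w ≠ G.edge a r}))
    (he : e none = r) (hf : f none = G.edge a r) (he' : ∀ v, e (some v) = θ.1 v)
    (hf' : ∀ w, f (some w) = θ.2 w) :
    IsIso B (G.contract a r) θ ↔ (G.pullback e f).removeNone = B := by
  classical
  have key : ∀ c v, (((G.contract a r).edge c (θ.1 v) : {w : K' // w ≠ G.edge a r}) : K') =
      f (some (((G.pullback e f).removeNone).edge c v)) := by
    intro c v
    have h1 : some (((G.pullback e f).removeNone).edge c v) =
        Equiv.swap (f.symm (G.edge c r)) (f.symm (G.edge a r)) (f.symm (G.edge c (θ.1 v))) := by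
      have h2 : f.symm (G.edge a r) = none := by rw [← hf, Equiv.symm_apply_apply]
      have h3 : (G.pullback e f).edge c none = f.symm (G.edge c r) := by simp [pullback, he]
      have h4 : (G.pullback e f).edge c (some v) = f.symm (G.edge c (θ.1 v)) := by
        simp [pullback, he']
      have h5 := Equiv.some_removeNone ((G.pullback e f).edge c) v
      rw [h3, h4] at h5
      rw [h2]
      exact h5
    rw [h1, f.injective.map_swap]
    simp [contract]
  constructor
  · intro h
    ext c v
    have h1 := congrArg Subtype.val (h c v)
    rw [key, ← hf', f.injective.eq_iff] at h1
    exact Option.some_injective _ h1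
  · intro h c v
    apply Subtype.ext
    rw [key, ← hf', h]

variable [Fintype W] [Fintype K] [Fintype W'] [Fintype K']

theorem mem_isos {B : ColouredGraph D W K} {B' : ColouredGraph D W' K'}
    {θ : (W ≃ W') × (K ≃ K')} : θ ∈ B.isos B' ↔ IsIso B B' θ := by
  simp [isos]

/-- Composition with an isomorphism permutes the isomorphisms onto a given graph. -/
theorem sum_isos_comp {M : Type*} [AddCommMonoid M] {W₁ K₁ : Type} [Fintype W₁] [Fintype K₁]
    {B₁ : ColouredGraph D W₁ K₁} {B : ColouredGraph D W K}
    {B' : ColouredGraph D W' K'} {σ : (W₁ ≃ W) × (K₁ ≃ K)} (hσ : IsIso B₁ B σ)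
    (H : (W₁ ≃ W') × (K₁ ≃ K') → M) :
    ∑ θ ∈ B.isos B', H (σ.1.trans θ.1, σ.2.trans θ.2) = ∑ θ ∈ B₁.isos B', H θ := by
  refine Finset.sum_bij' (fun θ _ => (σ.1.trans θ.1, σ.2.trans θ.2))
    (fun θ _ => (σ.1.symm.trans θ.1, σ.2.symm.trans θ.2)) ?_ ?_ ?_ ?_ ?_
  · intro θ hθ
    rw [mem_isos] at hθ ⊢
    intro c v
    simp [hθ c (σ.1 v), hσ c v]
  · intro θ hθ
    rw [mem_isos] at hθ ⊢
    intro c v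
    have h := hσ c (σ.1.symm v)
    simp only [Equiv.apply_symm_apply] at h
    simp [hθ c (σ.1.symm v), h]
  · intro θ _
    apply Prod.ext <;> ext <;> simp
  · intro θ _
    apply Prod.ext <;> ext <;> simp
  · intro θ _
    rfl

theorem card_aut_ne_zero (B : ColouredGraph D W K) : (B.aut.card : ℝ) ≠ 0 := by
  have h : (Equiv.refl W, Equiv.refl K) ∈ B.aut := mem_isos.2 fun _ _ => rfl
  exact_mod_cast (Finset.card_pos.2 ⟨_, h⟩).ne'

/-- Every graph is isomorphic to the representative of exactly one isomorphism class, with as many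
isomorphisms as that representative has automorphisms. -/
theorem sum_inv_card_aut_mul_card_isos {n : ℕ} (eW : W ≃ Fin n) (eK : K ≃ Fin n)
    (C : ColouredGraph D W K) :
    ∑ q : Quotient (isoSetoid D n), (q.out.aut.card : ℝ)⁻¹ * (C.isos q.out).card = 1 := by
  classical
  set G : ColouredGraph D (Fin n) (Fin n) := C.pullback eW.symm eK.symm with hG
  have hCG : IsIso C G (eW, eK) := by
    intro c v
    simp [hG, pullback]
  have hcard : ∀ {q : ColouredGraph D (Fin n) (Fin n)}, (G.isos q).card = (C.isos q).card := by
    intro q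
    have h := sum_isos_comp (B' := q) hCG (fun _ => 1)
    simpa using h
  rw [Finset.sum_eq_single ⟦G⟧]
  · obtain ⟨θ, hθ⟩ : (isoSetoid D n).r G (Quotient.out ⟦G⟧) :=
      (isoSetoid D n).symm (Quotient.mk_out (s := isoSetoid D n) G)
    have h := sum_isos_comp (B' := (⟦G⟧ : Quotient (isoSetoid D n)).out) hθ (fun _ => 1)
    have h' : (aut (⟦G⟧ : Quotient (isoSetoid D n)).out).card =
        (G.isos (⟦G⟧ : Quotient (isoSetoid D n)).out).card := by
      simpa [aut] using h
    rw [← hcard, ← h', inv_mul_cancel₀ (card_aut_ne_zero _)]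
  · intro q _ hq
    have hempty : G.isos q.out = ∅ := by
      refine Finset.eq_empty_of_forall_notMem fun θ hθ => hq ?_
      rw [← Quotient.out_eq q]
      exact Quotient.sound ((isoSetoid D n).symm ⟨θ, mem_isos.1 hθ⟩)
    rw [← hcard, hempty]
    simp
  · simp

end ColouredGraph

section EdgeRemoval

variable {D : ℕ} {W K W' K' : Type} {I : Fin D → Finset ℤ}
variable [Fintype W] [Fintype K] [Fintype W'] [Fintype K']

open Classical in
/-- The sum over the momentum of a white vertex `none` that is removed together with
its `a`-coloured edge, which carries the momentum `t`. -/
noncomputable def legSum [DecidableEq W] (E : Momentum I → ℝ) (a : Fin D) (t : I a)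
    (X : W → Momentum I) (C : ColouredGraph D (Option W) (Option K)) : ℝ⟦X⟧ :=
  ∑ z ∈ (Finset.univ : Finset (Momentum I)).filter (Diagram.LegConserves C a t X),
    corr E C (fun v => v.elim z X)

/-- The momentum inserted at the removed vertex `r` becomes the momentum of the vertex `none` of the
pulled back graph. -/
theorem edgeRemoval_eq_legSum [DecidableEq W] [DecidableEq W'] (hD : 2 ≤ D) (E : Momentum I → ℝ)
    (G : ColouredGraph D W' K') (a : Fin D) (t : I a) (r : W') (X : W → Momentum I)
    (e : Option W ≃ W') (f : Option K ≃ K') (θ : W ≃ {v : W' // v ≠ r})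
    (he : e none = r) (hf : f none = G.edge a r) (he' : ∀ v, e (some v) = θ v) :
    edgeRemoval E G a t r (fun v => X (θ.symm v)) = legSum E a t X (G.pullback e f) := by
  unfold edgeRemoval legSum
  refine Finset.sum_congr (Finset.ext fun z => ?_) fun z _ => ?_
  · simp only [Finset.mem_filter, Finset.mem_univ, true_and]
    refine and_congr_right fun _ => forall_congr' fun i => ?_
    rw [← θ.forall_congr_right]
    refine forall_congr' fun v => ?_
    rw [Equiv.symm_apply_apply]
    have h : (G.pullback e f).edge i (some v) = none ↔ G.edge i (θ v) = G.edge a r := by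
      rw [← hf, ← he']
      simp [ColouredGraph.pullback, Equiv.symm_apply_eq]
    rw [h]
  · refine (corr_relabel hD e f E G _).symm.trans ?_
    change corr E (G.pullback e f) _ = _
    congr 1
    funext v
    rcases v with _ | v
    · simp [he]
    · have h : e (some v) ≠ r := by
        rw [← he]
        simp
      simp only [Function.comp_apply, dif_neg h, Option.elim_some]
      congr 1
      rw [Equiv.symm_apply_eq]
      exact Subtype.ext (he' v)

open Classical in
/-- A vertex `r` together with an isomorphism from `B` to the contracted graph is the same as a
graph that gives `B` by removal of the vertices `none`, together with an isomorphism onto `G`. -/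
theorem sum_edgeRemoval [DecidableEq W] [hW : DecidableEq W'] [hK : DecidableEq K'] (hD : 2 ≤ D)
    (E : Momentum I → ℝ) (B : ColouredGraph D W K) (G : ColouredGraph D W' K') (a : Fin D)
    (t : I a) (X : W → Momentum I) :
    ∑ r, ∑ θ ∈ B.isos (G.contract a r), edgeRemoval E G a t r (fun v => X (θ.1.symm v)) =
      ∑ C ∈ (Finset.univ : Finset (ColouredGraph D (Option W) (Option K))).filter
        (fun C => C.removeNone = B ∧ C.edge a none = none),
        ∑ _η ∈ C.isos G, legSum E a t X C := by
  have hR : ∑ C ∈ (Finset.univ : Finset (ColouredGraph D (Option W) (Option K))).filter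
        (fun C => C.removeNone = B ∧ C.edge a none = none),
        ∑ _η ∈ C.isos G, legSum E a t X C =
      ∑ η : (Option W ≃ W') × (Option K ≃ K'),
        if (G.pullback η.1 η.2).removeNone = B ∧ (G.pullback η.1 η.2).edge a none = none then
          legSum E a t X (G.pullback η.1 η.2) else 0 := by
    rw [Finset.sum_filter]
    have h1 : ∀ C : ColouredGraph D (Option W) (Option K),
        (if C.removeNone = B ∧ C.edge a none = none then ∑ _η ∈ C.isos G, legSum E a t X C else 0) =
        ∑ η : (Option W ≃ W') × (Option K ≃ K'), if C = G.pullback η.1 η.2 then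
          (if C.removeNone = B ∧ C.edge a none = none then legSum E a t X C else 0) else 0 := by
      intro C
      rw [ColouredGraph.isos, Finset.sum_filter]
      simp only [ColouredGraph.isIso_iff_eq_pullback]
      by_cases h : C.removeNone = B ∧ C.edge a none = none
      · simp only [if_pos h]
        convert rfl
      · simp only [if_neg h, ite_self, Finset.sum_const_zero]
    simp only [h1]
    rw [Finset.sum_comm]
    refine Finset.sum_congr rfl fun η _ => ?_
    rw [Finset.sum_ite_eq', if_pos (Finset.mem_univ _)]
  rw [hR, ← Finset.sum_filter, Finset.sum_sigma']
  have hrel : ∀ (r : W') (e : Option W ≃ W') (f : Option K ≃ K'), e none = r →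
      (((G.pullback e f).edge a none = none) ↔ f none = G.edge a r) := by
    rintro r e f rfl
    change f.symm (G.edge a (e none)) = none ↔ _
    rw [Equiv.symm_apply_eq, eq_comm]
  refine Finset.sum_bij (fun x _ => (((Equiv.optionSubtype x.1).symm x.2.1).1,
    ((Equiv.optionSubtype (G.edge a x.1)).symm x.2.2).1)) ?_ ?_ ?_ ?_
  · rintro ⟨r, θ⟩ hx
    simp only [Finset.mem_sigma, Finset.mem_univ, true_and, Finset.mem_filter] at hx ⊢
    rw [ColouredGraph.mem_isos] at hx
    refine ⟨(ColouredGraph.isIso_contract_iff B G a r _ _ θ ?_ ?_ ?_ ?_).1 hx,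
      (hrel r _ _ ?_).2 ?_⟩ <;> simp
  · rintro ⟨r, θ⟩ _ ⟨r', θ'⟩ _ h
    obtain ⟨h1, h2⟩ := Prod.ext_iff.1 h
    have hr : r = r' := by
      have h3 := Equiv.congr_fun h1 none
      simpa using h3
    subst hr
    have h3 := (Equiv.optionSubtype r).symm.injective (Subtype.ext h1)
    have h4 := (Equiv.optionSubtype (G.edge a r)).symm.injective (Subtype.ext h2)
    exact congrArg (Sigma.mk r) (Prod.ext h3 h4)
  · rintro ⟨e, f⟩ hx
    simp only [Finset.mem_filter, Finset.mem_univ, true_and] at hx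
    have hf := (hrel _ e f rfl).1 hx.2
    refine ⟨⟨e none, Equiv.optionSubtype (e none) ⟨e, rfl⟩,
      Equiv.optionSubtype (G.edge a (e none)) ⟨f, hf⟩⟩, ?_, ?_⟩
    · simp only [Finset.mem_sigma, Finset.mem_univ, true_and]
      rw [ColouredGraph.mem_isos]
      exact (ColouredGraph.isIso_contract_iff B G a _ e f _ rfl hf (fun _ => rfl)
        (fun _ => rfl)).2 hx.1
    · simp
  · rintro ⟨r, θ⟩ _
    refine edgeRemoval_eq_legSum hD E G a t r X _ _ θ.1 ?_ ?_ ?_ <;> simp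

end EdgeRemoval

section WardCoefficients

variable {D k : ℕ} {I : Fin D → Finset ℤ}

open Classical in
/-- The sum of the Ward coefficients over the automorphisms of `B` counts every graph that gives `B`
by the removal of two vertices joined by an `a`-coloured edge exactly once. -/
theorem sum_wardCoeff (hD : 2 ≤ D) (E : Momentum I → ℝ) (B : ColouredGraph D (Fin k) (Fin k))
    (a : Fin D) (t : I a) (X : Fin k → Momentum I) :
    ∑ σ ∈ B.aut, wardCoeff E B a t (fun v => X (σ.1.symm v)) =
      ∑ C ∈ (Finset.univ : Finset (ColouredGraph D (Option (Fin k)) (Option (Fin k)))).filter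
        (fun C => C.removeNone = B ∧ C.edge a none = none), legSum E a t X C := by
  have hq : ∀ q : Quotient (ColouredGraph.isoSetoid D (k + 1)),
      ∑ σ ∈ B.aut, ∑ r, (B.aut.card : ℝ)⁻¹ • ∑ θ ∈ B.isos (q.out.contract a r),
        edgeRemoval E q.out a t r (fun v => X (σ.1.symm (θ.1.symm v))) =
      ∑ C ∈ (Finset.univ : Finset (ColouredGraph D (Option (Fin k)) (Option (Fin k)))).filter
        (fun C => C.removeNone = B ∧ C.edge a none = none),
        ((C.isos q.out).card : ℝ) • legSum E a t X C := by
    intro q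
    have hσ : ∀ σ ∈ B.aut, ∑ r, (B.aut.card : ℝ)⁻¹ • ∑ θ ∈ B.isos (q.out.contract a r),
        edgeRemoval E q.out a t r (fun v => X (σ.1.symm (θ.1.symm v))) =
        (B.aut.card : ℝ)⁻¹ • ∑ r, ∑ θ ∈ B.isos (q.out.contract a r),
          edgeRemoval E q.out a t r (fun v => X (θ.1.symm v)) := by
      intro σ hσ
      rw [← Finset.smul_sum]
      refine congrArg _ (Finset.sum_congr rfl fun r _ => ?_)
      have h := ColouredGraph.sum_isos_comp (B' := q.out.contract a r)
        (ColouredGraph.mem_isos.1 hσ) fun θ => edgeRemoval E q.out a t r (fun v => X (θ.1.symm v))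
      simp only [Equiv.symm_trans_apply] at h
      exact h
    rw [Finset.sum_congr rfl hσ, Finset.sum_const, ← Nat.cast_smul_eq_nsmul ℝ, smul_smul,
      mul_inv_cancel₀ (ColouredGraph.card_aut_ne_zero B), one_smul, sum_edgeRemoval hD]
    simp only [Finset.sum_const, Nat.cast_smul_eq_nsmul]
  unfold wardCoeff
  rw [Finset.sum_comm]
  have hq' : ∀ q : Quotient (ColouredGraph.isoSetoid D (k + 1)),
      ∑ σ ∈ B.aut, (q.out.aut.card : ℝ)⁻¹ • ∑ r, (B.aut.card : ℝ)⁻¹ •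
        ∑ θ ∈ B.isos (q.out.contract a r),
          edgeRemoval E q.out a t r (fun v => X (σ.1.symm (θ.1.symm v))) =
      ∑ C ∈ (Finset.univ : Finset (ColouredGraph D (Option (Fin k)) (Option (Fin k)))).filter
        (fun C => C.removeNone = B ∧ C.edge a none = none),
        ((q.out.aut.card : ℝ)⁻¹ * (C.isos q.out).card) • legSum E a t X C := by
    intro q
    rw [← Finset.smul_sum, hq, Finset.smul_sum]
    simp only [smul_smul]
  refine (Finset.sum_congr rfl fun q _ => hq' q).trans ?_
  rw [Finset.sum_comm]
  refine Finset.sum_congr rfl fun C _ => ?_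
  rw [← Finset.sum_smul, ColouredGraph.sum_inv_card_aut_mul_card_isos (finSuccEquiv k).symm
    (finSuccEquiv k).symm, one_smul]

end WardCoefficients

/-! ### The Schwinger–Dyson equations -/

section SchwingerDyson

variable {D : ℕ} {W K : Type} {I : Fin D → Finset ℤ} [Fintype W] [Fintype K]

open Classical in
/-- The insertions of a vertex of colour `a` at the leg `α`, sorted by the end of the `a`-coloured
face that starts at the new leg: the other new leg, the leg `α`, or another leg `ρ`. -/
theorem expSeries_insertionSum [hW : DecidableEq W] [hK : DecidableEq K] (hD : 2 ≤ D)
    (E : Momentum I → ℝ) (hE : ∀ p, 0 < E p) (Ediff : (a : Fin D) → I a → I a → ℝ)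
    (hEdiff : ∀ a (p : Momentum I) (t s : I a),
      E (Function.update p a t) - E (Function.update p a s) = Ediff a t s)
    {B : ColouredGraph D W K} (hB : B.Connected) (X : W → Momentum I) (α : K) (a : Fin D) :
    (expSeries fun n => Diagram.insertionSum (Fin n) E B X α a) =
      (∑ C ∈ (Finset.univ : Finset (ColouredGraph D (Option W) (Option K))).filter
        (fun C => C.removeNone = B ∧ C.edge a none = none), legSum E a (B.target X α a) X C) +
      (∑ q : Momentum I, if q a = B.target X α a then
        corr E (ColouredGraph.melon D) (fun _ => q) else 0) * corr E B X +
      ((∑ ρ ∈ Finset.univ.erase α,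
        -diffQuot Ediff (partitionCorrShift E (B.swapEdges a α ρ)) X
          ((B.edge a).symm α) a (B.target X ρ a)) -
        ∑ b : I a, diffQuot Ediff (corrShift E B) X ((B.edge a).symm α) a b) := by
  have : Nonempty W := ⟨(B.edge a).symm α⟩
  have hsplit : ∀ n, Diagram.insertionSum (Fin n) E B X α a =
      (∑ C ∈ (Finset.univ : Finset (ColouredGraph D (Option W) (Option K))).filter
        (fun C => C.glue a α = B ∧ C.edge a none = none),
      ∑ z ∈ (Finset.univ : Finset (Momentum I)).filter
        (Diagram.Conserves C a α (B.target X α) X),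
        Diagram.bdrySum (V := Fin n) Diagram.NoVac E C (fun v => v.elim z X) 0) +
      -∑ ρ, ∑ b ∈ (Finset.univ : Finset (I a)).filter (fun b => ρ ≠ α → b = B.target X ρ a),
        ∑ Γ ∈ (Finset.univ : Finset (Diagram D W K (Fin n))).filter
          (fun Γ => Γ.NoVac ∧ Γ.HasBdry (B.swapEdges a α ρ)),
          Γ.amplitudeQuot E Ediff X ((B.edge a).symm α) a b := by
    intro n
    rw [← Diagram.sum_edge_ne_none E hE Ediff hEdiff B X α a, ← Finset.filter_filter,
      ← Finset.filter_filter, Finset.sum_filter_add_sum_filter_not]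
    rfl
  have hdiff : ∀ ρ b, (expSeries fun n =>
      ∑ Γ ∈ (Finset.univ : Finset (Diagram D W K (Fin n))).filter
        (fun Γ => Γ.NoVac ∧ Γ.HasBdry (B.swapEdges a α ρ)),
        Γ.amplitudeQuot E Ediff X ((B.edge a).symm α) a b) =
      diffQuot Ediff (partitionCorrShift E (B.swapEdges a α ρ)) X ((B.edge a).symm α) a b :=
    fun ρ b => (diffQuot_expSeries E hE Ediff (B.swapEdges a α ρ) _
      (partitionCorrShift_eq_noVac E _) X _ a b).symm
  -- for `ρ = α` the boundary graph is the connected graph `B` itself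
  have hself : B.swapEdges a α α = B := by
    ext c v
    simp [ColouredGraph.swapEdges]
  have hcorr : partitionCorrShift E B = corrShift E B := by
    funext X δ
    rw [partitionCorrShift_eq_noVac, corrShift_eq_noVac hD E hB]
  simp only [hsplit, expSeries_add, expSeries_neg, expSeries_sum]
  rw [sum_edge_eq_none hD E hB X α a]
  unfold legSum
  congr 1
  simp only [hdiff]
  rw [← Finset.add_sum_erase _ _ (Finset.mem_univ α), neg_add_rev, Finset.sum_neg_distrib,
    sub_eq_add_neg, hself, hcorr]
  congr 2
  · refine Finset.sum_congr rfl fun ρ hρ => ?_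
    have hb : (Finset.univ : Finset (I a)).filter (fun b => ρ ≠ α → b = B.target X ρ a) =
        {B.target X ρ a} := by
      ext b
      simp [Finset.ne_of_mem_erase hρ]
    rw [hb, Finset.sum_singleton]
  · refine Finset.sum_congr (Finset.filter_true_of_mem fun b _ h => (h rfl).elim) fun _ _ => rfl

end SchwingerDyson

theorem mainTheorem1 {D : ℕ} (hD : 3 ≤ D) (I : Fin D → Finset ℤ)
    (E : Momentum I → ℝ) (hE : ∀ p, 0 < E p)
    (Ediff : (a : Fin D) → I a → I a → ℝ)
    (hEdiff : ∀ a (p : Momentum I) (t s : I a),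
      E (Function.update p a t) - E (Function.update p a s) = Ediff a t s)
    {k : ℕ} (B : ColouredGraph D (Fin k) (Fin k)) (hB : B.Connected) (α : Fin k) :
    -- the boundary graph expansions of `W` and of `Z / Z_0`
    (∀ X Y : Fin k → Momentum I,
      sourceDeriv (freeEnergy E) X Y =
        ∑ C : ColouredGraph D (Fin k) (Fin k), (if C.target X = Y then corr E C X else 0) ∧
      (vacuum E)⁻¹ * sourceDeriv (partitionFunction E) X Y =
        ∑ C : ColouredGraph D (Fin k) (Fin k),
          (if C.target X = Y then partitionCorr E C X else 0)) ∧
    -- on generic momenta, the sectors are the graph derivatives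
    (∀ (C : ColouredGraph D (Fin k) (Fin k)) (X : Fin k → Momentum I), IsGeneric X →
      graphDeriv (freeEnergy E) C X = corr E C X ∧
      (vacuum E)⁻¹ * graphDeriv (partitionFunction E) C X = partitionCorr E C X) ∧
    -- the Schwinger-Dyson equations
    (∀ X : Fin k → Momentum I, IsGeneric X →
      let s : Momentum I := B.target X α
      (1 + PowerSeries.C (2 / E s) * PowerSeries.X *
          ∑ a : Fin D, ∑ q : Momentum I,
            (if q a = s a then corr E (ColouredGraph.melon D) (fun _ => q) else 0)) *
          corr E B X =
        PowerSeries.C (if k = 1 then 1 / E s else 0) +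
        PowerSeries.C (-2 / E s) * PowerSeries.X *
          ∑ a : Fin D,
            ((∑ σ ∈ B.aut, wardCoeff E B a (s a) (fun v => X (σ.1.symm v)))
              + (∑ ρ ∈ Finset.univ.erase α,
                  -diffQuot Ediff (partitionCorrShift E (B.swapEdges a α ρ)) X
                    ((B.edge a).symm α) a (B.target X ρ a))
              - (∑ b : I a, diffQuot Ediff (corrShift E B) X ((B.edge a).symm α) a b))) := by
  have hD' : 2 ≤ D := by omega
  have hW : ∀ X Y : Fin k → Momentum I, sourceDeriv (freeEnergy E) X Y =
      ∑ C : ColouredGraph D (Fin k) (Fin k), (if C.target X = Y then corr E C X else 0) := by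
    intro X Y
    rw [sourceDeriv_freeEnergy_eq_sum_corr hD' E X Y ⟨Sum.inl α⟩]
  have hZ : ∀ X Y : Fin k → Momentum I, (vacuum E)⁻¹ * sourceDeriv (partitionFunction E) X Y =
      ∑ C : ColouredGraph D (Fin k) (Fin k),
        (if C.target X = Y then partitionCorr E C X else 0) := by
    intro X Y
    rw [sourceDeriv_partitionFunction_eq_sum_partitionCorr]
  refine ⟨fun X Y => ⟨hW X Y, hZ X Y⟩, fun C X hX => ⟨?_, ?_⟩, fun X _ => ?_⟩
  · rw [graphDeriv, hW, ← hX.sum_target_eq C fun C => corr E C X]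
  · rw [graphDeriv, hZ, ← hX.sum_target_eq C fun C => partitionCorr E C X]
  · dsimp only
    have hG := corr_eq_insertion hD' E hB X α
    simp only [expSeries_insertionSum hD' E hE Ediff hEdiff hB, ← sum_wardCoeff hD',
      Fintype.card_fin] at hG
    rw [Finset.sum_add_distrib, Finset.sum_add_distrib, ← Finset.sum_mul] at hG
    have hneg : PowerSeries.C (-2 / E (B.target X α)) = -PowerSeries.C (2 / E (B.target X α)) := by
      rw [← map_neg, neg_div]
    simp only [add_sub_assoc]
    rw [Finset.sum_add_distrib]
    rw [hneg] at hG ⊢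
    linear_combination hG
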